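/- Let $\theta>0$, let $\mathbb T=\{w\in\mathbb C:|w|=1\}$, let $z$ be a $\mathbb T$-valued random variable, and let $x\in\mathbb T$ be not a root of unity, i.e. $x^m\neq 1$ for all integers $m\ge 1$. For every $n$ let $\sigma=\sigma_n$ be a random permutation of $n$ elements with the Ewens distribution of parameter $\theta$, $\mathbb P[\sigma=\tau]=\theta^{l_\tau}/(\theta(\theta+1)\cdots(\theta+n-1))$, where $l_\tau$ is the number of cycles of $\tau$ (fixed points included). Let $C_m$ be the number of cycles of length $m$ of $\sigma$, and let $(T_{m,k})_{m,k\ge1}$ be independent random variables, independent of $\sigma$, such that $T_{m,k}$ has the law of a product of $m$ independent copies of $z$. Put $$\log Z_{n,z}(x):=\sum_{m=1}^n\sum_{k=1}^{C_m}\log\bigl(1-x^{-m}T_{m,k}\bigr)$$ with the principal branch of the logarithm (imaginary part in $(-\pi,\pi]$). Suppose that one of the following conditions holds. 1. $z$ is uniformly distributed on $\mathbb T$. 2. $z=e^{2\pi i\phi}$ in law, where $\phi\in[0,1]$ is absolutely continuous with a density $g:[0,1]\to[0,\infty)$ of the form $g(\phi)=\sum_{j\in\mathbb Z}c_je^{2\pi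 ij\phi}$ with $\sum_{j\in\mathbb Z}|c_j|<\infty$ and $|c_j|<1$ for all $j\neq0$. 3. There is an integer $\rho\ge1$ with $z^\rho=1$ almost surely, such that for all $1\le k\le\rho$ $$\mathbb P\bigl[z=e^{2\pi ik/\rho}\bigr]=\frac1\rho\sum_{j=0}^{\rho-1}c_je^{2\pi ijk/\rho}\quad\text{with }|c_j|<1\text{ for }1\le j\le\rho-1,$$ and $x$ is of finite type: $x=e^{2\pi i\varphi}$ for some $\varphi\in[0,1]$ for which there are $K>0$ and $\gamma\ge1$ with $\inf_{a\in\mathbb Z}|q\varphi-a|\ge K/|q|^{\gamma}$ for all $q\in\mathbb Z\setminus\{0\}$. Then, as $n\to\infty$, $$\frac{\operatorname{Re}\log Z_{n,z}(x)}{\sqrt{\log n}}\xrightarrow{d}\mathcal N\Bigl(0,\theta\frac{\pi^2}{12}\Bigr)\quad\text{and}\quad\frac{\operatorname{Im}\log Z_{n,z}(x)}{\sqrt{\log n}}\xrightarrow{d}\mathcal N\Bigl(0,\theta\frac{\pi^2}{12}\Bigr).$$ In particular, if $z$ is uniformly distributed on $\mathbb T$, then $$\frac{\operatorname{Re}\log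 Z_{n,z}(x)}{\sqrt{\frac{\pi^2}{12}\theta\log n}}\xrightarrow{d}\mathcal N(0,1)\quad\text{and}\quad\frac{\operatorname{Im}\log Z_{n,z}(x)}{\sqrt{\frac{\pi^2}{12}\theta\log n}}\xrightarrow{d}\mathcal N(0,1).$$ -/

import Mathlib

open MeasureTheory ProbabilityTheory Filter Topology

noncomputable section

/-- The Borel sigma-algebra on the unit circle. -/
instance circleMeasurableSpace : MeasurableSpace Circle := borel Circle

instance circleBorelSpace : BorelSpace Circle := ⟨rfl⟩

/-- Every subset of the finite group `Perm (Fin n)` is measurable. -/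
instance permMeasurableSpace (n : ℕ) : MeasurableSpace (Equiv.Perm (Fin n)) := ⊤

/-- `C_m(σ)`: the number of cycles of length `m` of `σ`, fixed points being cycles of length `1`. -/
def cycleCount {n : ℕ} (σ : Equiv.Perm (Fin n)) (m : ℕ) : ℕ := σ.partition.parts.count m

/-- The total number of cycles of `σ`, fixed points included. -/
def totalCycles {n : ℕ} (σ : Equiv.Perm (Fin n)) : ℕ := Multiset.card σ.partition.parts

/-- The Ewens distribution with parameter `θ` on the symmetric group of degree `n`: the permutation
`τ` has mass `θ ^ (number of cycles of τ) / (θ (θ + 1) ⋯ (θ + n - 1))`. -/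
def ewensMeasure (θ : ℝ) (n : ℕ) : Measure (Equiv.Perm (Fin n)) :=
  ∑ τ : Equiv.Perm (Fin n),
    ENNReal.ofReal (θ ^ totalCycles τ / ∏ i ∈ Finset.range n, (θ + i)) • Measure.dirac τ

/-- The law of the product of `m` independent random variables with common law `μ`. -/
def productLaw (μ : Measure Circle) (m : ℕ) : Measure Circle :=
  (Measure.pi fun _ : Fin m => μ).map fun w => ∏ j, w j

/-- The logarithm of `Z_{n,z}(x)` for the permutation `σ`:
`∑_{m = 1}^n ∑_{k = 1}^{C_m(σ)} log (1 - x^{-m} T_{m,k})`, with the principal branch (imaginary part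
in `(-π, π]`). The second index of `T` is counted from `0`. -/
def logZ {n : ℕ} (x : Circle) (σ : Equiv.Perm (Fin n)) (T : ℕ → ℕ → Circle) : ℂ :=
  ∑ m ∈ Finset.Icc 1 n, ∑ k ∈ Finset.range (cycleCount σ m),
    Complex.log (1 - ((x : ℂ) ^ m)⁻¹ * (T m k : ℂ))

/-- The point `e^{2π i φ}` of the unit circle. -/
def circlePoint (φ : ℝ) : Circle := Circle.exp (2 * Real.pi * φ)

/-- The law on the circle of `e^{2π i φ}`, where `φ` has density `g` on `[0, 1]`. -/
def circleDensityLaw (g : ℝ → ℝ) : Measure Circle :=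
  ((volume.restrict (Set.Icc (0 : ℝ) 1)).withDensity fun φ => ENNReal.ofReal (g φ)).map circlePoint

/-- The uniform distribution on the circle. -/
def uniformCircleLaw : Measure Circle := (volume.restrict (Set.Icc (0 : ℝ) 1)).map circlePoint

/-- Distance to the nearest integer. -/
def distToInt (a : ℝ) : ℝ := ⨅ j : ℤ, |a - j|

/-- `x = e^{2π i φ}`, with `φ ∈ [0, 1]`, is of finite type. -/
def IsFiniteType (x : Circle) : Prop :=
  ∃ φ ∈ Set.Icc (0 : ℝ) 1, x = circlePoint φ ∧
    ∃ K > (0 : ℝ), ∃ γ ≥ (1 : ℝ), ∀ q : ℤ, q ≠ 0 → K / |(q : ℝ)| ^ γ ≤ distToInt (q * φ)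

/-- `μ` is absolutely continuous, with a nonnegative density on `[0, 1]` that is the sum of an
absolutely convergent Fourier series all of whose coefficients of nonzero index have modulus less
than `1`. -/
def IsFourierDensityLaw (μ : Measure Circle) : Prop :=
  ∃ (g : ℝ → ℝ) (c : ℤ → ℂ),
    (∀ φ ∈ Set.Icc (0 : ℝ) 1, 0 ≤ g φ) ∧
    μ = circleDensityLaw g ∧
    (Summable fun j => ‖c j‖) ∧
    (∀ j, j ≠ 0 → ‖c j‖ < 1) ∧
    ∀ φ ∈ Set.Icc (0 : ℝ) 1,
      HasSum (fun j : ℤ => c j * Complex.exp (2 * Real.pi * Complex.I * j * φ)) (g φ : ℂ)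

/-- `μ` is carried by the `ρ`-th roots of unity for some `ρ ≥ 1`, and all discrete Fourier
coefficients `c_j`, `1 ≤ j < ρ`, of its point masses have modulus less than `1`. -/
def IsDiscreteFourierLaw (μ : Measure Circle) : Prop :=
  ∃ ρ : ℕ, 0 < ρ ∧ (∀ᵐ w ∂μ, w ^ ρ = 1) ∧
    ∃ c : ℕ → ℂ, (∀ j, 0 < j → j < ρ → ‖c j‖ < 1) ∧
      ∀ k : ℕ, 1 ≤ k → k ≤ ρ →
        ((μ.real {circlePoint ((k : ℝ) / ρ)} : ℝ) : ℂ) =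
          1 / (ρ : ℂ) * ∑ j ∈ Finset.range ρ,
            c j * Complex.exp (2 * Real.pi * Complex.I * j * k / ρ)

end

/-! Let X be the real or the imaginary part of w ↦ log(1 - w). Given the permutation, the summands
are independent, so the characteristic function at s of the sum over the cycles is F_n = E ∏ a_m ^
C_m, where a_m is the characteristic function at s of X(x⁻ᵐ T_m) (`charFun_cycleSum`). The relevant
scale is s = t / √(log n).

If the C_m were independent Poisson variables of means θ/m, F_n would equal exp(θ ∑_{m ≤ n} (a_m -
1)/m). By `tendsto_exp_sub_ewensGen` the two agree in the limit once the average of |a_m - 1| over m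
≤ n tends to 0. Indeed, let p_n be the rising factorial of θ divided by n!. Then n p_n F_n = θ ∑_{k
< n} a_{n-k} p_k F_k. Replace a_m by 1 for m > n, which does not affect F_n. The recursion becomes a
differential equation, so that ∑ p_k F_k t^k is exp(θ ∑_{m ≤ n} (a_m - 1) t^m / m) times ∑ p_k t^k.
Since ∑ p_k diverges, letting t → 1 shows that the Poisson value lies as close to F_n as all F_N
with N ≥ n do (`norm_exp_sub_le_of_forall_ge`). These hardly differ from F_n: F_N is close to a
weighted mean of its predecessors, and that mean moves slowly (`norm_sub_le_of_ewensMean_le`).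

It remains to expand a_m - 1 to third order in s, which calls for the sums of E[h(x⁻ᵐ T_m)]/m with h
= X, X², |X|³. The law of T_m has Fourier coefficients c_j^m, so it approaches the uniform law on
the circle, or on the ρ-th roots of unity, geometrically fast. In the first case E h is replaced by
the integral of h exactly. In the second case one averages h along orbits of the rotation by the
angle of x; a Denjoy–Koksma inequality for functions with weak singularities, together with the
finite type of x, gives equidistribution with a power saving
(`EdgeSingular.exists_abs_sum_rotation_sub_le`). Power saving makes the harmonic sums equal to (∫ h)
∑ 1/m + O(1). As ∫ X = 0, the linear term is s · O(1) → 0; the quadratic one tends to -(t²/2) ∫ X²;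
the cubic one is s³ · O(log n) → 0.

Finally ∫ X² = π²/12 in both cases: the imaginary part is linear in the angle, and the mean value
property for log(1 - z)² gives the real part the same second moment. -/

noncomputable section

/-! ### Cycle index and the Ewens recursion -/

/-- The weight of a cycle type `s` in the cycle index with indeterminates `b`. -/
def cycleIndexWeight (b : ℕ → ℂ) (s : Multiset ℕ) : ℂ :=
  (s.map b).prod / ((s.prod * ∏ m ∈ s.toFinset, (s.count m).factorial : ℕ) : ℂ)

/-- The cycle index of the symmetric group of degree `n`, with indeterminates `b`. -/
def cycleIndex (b : ℕ → ℂ) (n : ℕ) : ℂ :=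
  ∑ l : n.Partition, cycleIndexWeight b l.parts

lemma prod_count_factorial_eq_of_subset (s : Multiset ℕ) (u : Finset ℕ) (h : s.toFinset ⊆ u) :
    ∏ m ∈ s.toFinset, (s.count m).factorial = ∏ m ∈ u, (s.count m).factorial := by
  refine Finset.prod_subset h fun m _ hm => ?_
  rw [Multiset.count_eq_zero_of_notMem (by simpa using hm), Nat.factorial_zero]

/-- A further part `m` multiplies the product of the parts by `m` and the product of factorials by
the new multiplicity of `m`; these are the factors on the left. -/
lemma mul_cycleIndexWeight_cons (b : ℕ → ℂ) (t : Multiset ℕ) (ht : ∀ i ∈ t, 0 < i) {m : ℕ}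
    (hm : 0 < m) :
    (m * ((m ::ₘ t).count m) : ℂ) * cycleIndexWeight b (m ::ₘ t) = b m * cycleIndexWeight b t := by
  have h1 : ∏ i ∈ (m ::ₘ t).toFinset, ((m ::ₘ t).count i).factorial =
      (t.count m + 1) * ∏ i ∈ t.toFinset, (t.count i).factorial := by
    rw [prod_count_factorial_eq_of_subset t (m ::ₘ t).toFinset (by
        intro i hi; simp at hi ⊢; exact Or.inr hi),
      ← Finset.mul_prod_erase _ _ (a := m) (by simp),
      ← Finset.mul_prod_erase (s := (m ::ₘ t).toFinset) (f := fun i => (t.count i).factorial)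
        (a := m) (by simp),
      Multiset.count_cons_self, Nat.factorial_succ, mul_assoc]
    congr 2
    refine Finset.prod_congr rfl fun i hi => ?_
    rw [Multiset.count_cons_of_ne (Finset.ne_of_mem_erase hi)]
  have h2 : ((t.prod : ℕ) : ℂ) ≠ 0 := by
    exact_mod_cast (Multiset.prod_pos ht).ne'
  have h3 : ((∏ i ∈ t.toFinset, (t.count i).factorial : ℕ) : ℂ) ≠ 0 := by
    exact_mod_cast (Finset.prod_pos fun i _ => Nat.factorial_pos _).ne'
  have h4 : (m : ℂ) ≠ 0 := by exact_mod_cast hm.ne'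
  have h5 : (t.count m : ℂ) + 1 ≠ 0 := by exact_mod_cast (Nat.succ_ne_zero (t.count m))
  unfold cycleIndexWeight
  rw [h1, Multiset.prod_cons, Multiset.map_cons, Multiset.prod_cons, Multiset.count_cons_self]
  push_cast at h3 ⊢
  field_simp

/-- Write n as the sum of m times the multiplicity of m over the distinct parts m. Removing one part
m is a bijection from pairs (partition of n, distinct part m) to pairs (m, partition of n - m), and
the weights match by `mul_cycleIndexWeight_cons`. -/
lemma card_mul_cycleIndex (b : ℕ → ℂ) (n : ℕ) :
    (n : ℂ) * cycleIndex b n = ∑ m ∈ Finset.Icc 1 n, b m * cycleIndex b (n - m) := by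
  unfold cycleIndex
  have key : ∀ l : n.Partition, (n : ℂ) * cycleIndexWeight b l.parts =
      ∑ m ∈ l.parts.toFinset, b m * cycleIndexWeight b (l.parts.erase m) := by
    intro l
    have hn : (n : ℂ) = ∑ m ∈ l.parts.toFinset, (m : ℂ) * (l.parts.count m : ℂ) := by
      have := Finset.sum_multiset_count l.parts
      rw [l.parts_sum] at this
      refine (congrArg (Nat.cast : ℕ → ℂ) this).trans ?_
      push_cast
      refine Finset.sum_congr rfl fun m _ => ?_
      simp [mul_comm]
    rw [hn, Finset.sum_mul]
    refine Finset.sum_congr rfl fun m hm => ?_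
    have hm' : m ∈ l.parts := by simpa using hm
    have := mul_cycleIndexWeight_cons b (l.parts.erase m)
      (fun i hi => l.parts_pos (Multiset.mem_of_mem_erase hi)) (l.parts_pos hm')
    rwa [Multiset.cons_erase hm'] at this
  rw [Finset.mul_sum, Finset.sum_congr rfl fun l _ => key l]
  simp_rw [Finset.mul_sum]
  rw [Finset.sum_sigma', Finset.sum_sigma']
  refine Finset.sum_bij'
    (i := fun x hx => ⟨x.2, ⟨x.1.parts.erase x.2, fun {i} hi =>
        x.1.parts_pos (Multiset.mem_of_mem_erase hi), by
          have hm : x.2 ∈ x.1.parts := by simpa using hx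
          have := congrArg Multiset.sum (Multiset.cons_erase hm)
          rw [Multiset.sum_cons, x.1.parts_sum] at this
          omega⟩⟩)
    (j := fun y hy => ⟨⟨y.1 ::ₘ y.2.parts, fun {i} hi => by
          have hy' : 1 ≤ y.1 ∧ y.1 ≤ n := by simpa using hy
          rcases Multiset.mem_cons.1 hi with h | h
          · omega
          · exact y.2.parts_pos h, by
          have hy' : 1 ≤ y.1 ∧ y.1 ≤ n := by simpa using hy
          rw [Multiset.sum_cons, y.2.parts_sum]; omega⟩, y.1⟩) ?_ ?_ ?_ ?_ ?_
  · rintro ⟨l, m⟩ hx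
    have hm : m ∈ l.parts := by simpa using hx
    simp only [Finset.mem_sigma, Finset.mem_univ, and_true, Finset.mem_Icc]
    exact ⟨l.parts_pos hm, Nat.Partition.le_of_mem_parts hm⟩
  · rintro ⟨m, l⟩ hy
    simp
  · rintro ⟨l, m⟩ hx
    have hm : m ∈ l.parts := by simpa using hx
    simp only [Sigma.mk.injEq, heq_eq_eq, and_true]
    ext1
    exact Multiset.cons_erase hm
  · rintro ⟨m, l⟩ hy
    simp
  · rintro ⟨l, m⟩ hx
    rfl

-- Cauchy's count of a conjugacy class. A cycle type omits fixed points whereas a partition records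
-- them as parts equal to 1, so the work is to split off the ones.
open Equiv.Perm in
lemma card_partition_eq_mul {α : Type*} [Fintype α] [DecidableEq α]
    (l : (Fintype.card α).Partition) :
    (Finset.univ.filter fun σ : Equiv.Perm α => σ.partition = l).card *
      (l.parts.prod * ∏ m ∈ l.parts.toFinset, (l.parts.count m).factorial) =
      (Fintype.card α).factorial := by
  classical
  let N := Fintype.card α
  set μ := l.parts.filter (fun i => 2 ≤ i) with hμ
  have hsplit : l.parts = μ + Multiset.replicate (N - μ.sum) 1 := by
    have h1 : l.parts.filter (fun i => ¬ 2 ≤ i) = Multiset.replicate (l.parts.count 1) 1 := by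
      rw [← Multiset.filter_eq']
      refine Multiset.filter_congr fun i hi => ?_
      have := l.parts_pos hi
      omega
    have h2 := Multiset.filter_add_not (fun i => 2 ≤ i) l.parts
    rw [h1, ← hμ] at h2
    have h3 := congrArg Multiset.sum h2
    rw [l.parts_sum, Multiset.sum_add, Multiset.sum_replicate, smul_eq_mul, mul_one] at h3
    change _ = N at h3
    have h4 : N - μ.sum = l.parts.count 1 := by omega
    rw [h4, h2]
  have hle : μ.sum ≤ N := by
    have h3 := congrArg Multiset.sum (Multiset.filter_add_not (fun i => 2 ≤ i) l.parts)
    rw [l.parts_sum, Multiset.sum_add, ← hμ] at h3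
    change _ = N at h3
    omega
  have h2μ : ∀ a ∈ μ, 2 ≤ a := fun a ha => (Multiset.mem_filter.1 ha).2
  have hset : (Finset.univ.filter fun σ : Equiv.Perm α => σ.partition = l) =
      Finset.univ.filter fun σ : Equiv.Perm α => σ.cycleType = μ := by
    ext σ
    simp only [Finset.mem_filter, Finset.mem_univ, true_and]
    constructor
    · rintro h
      rw [hμ, ← h, filter_parts_partition_eq_cycleType]
    · intro h
      rw [Nat.Partition.ext_iff, parts_partition, hsplit, h, ← sum_cycleType, h]
  rw [hset]
  have hprod : l.parts.prod = μ.prod := by rw [hsplit]; simp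
  have hfact : ∏ m ∈ l.parts.toFinset, (l.parts.count m).factorial =
      (N - μ.sum).factorial * ∏ m ∈ μ.toFinset, (μ.count m).factorial := by
    have h1μ : μ.count 1 = 0 := Multiset.count_eq_zero_of_notMem fun h => by
      have := h2μ 1 h; omega
    have hsub : μ.toFinset ⊆ insert 1 l.parts.toFinset := by
      intro i hi
      simp only [Multiset.mem_toFinset, Finset.mem_insert] at hi ⊢
      exact Or.inr (Multiset.mem_of_mem_filter hi)
    rw [prod_count_factorial_eq_of_subset _ _ (Finset.subset_insert 1 l.parts.toFinset),
      prod_count_factorial_eq_of_subset _ _ hsub,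
      ← Finset.mul_prod_erase _ _ (Finset.mem_insert_self 1 _),
      ← Finset.mul_prod_erase _ (fun m => (μ.count m).factorial) (Finset.mem_insert_self 1 _),
      h1μ, Nat.factorial_zero, one_mul]
    congr 1
    · rw [hsplit, Multiset.count_add, h1μ, Multiset.count_replicate_self, zero_add]
    · refine Finset.prod_congr rfl fun i hi => ?_
      have hi1 : 1 ≠ i := (Finset.ne_of_mem_erase hi).symm
      rw [hsplit, Multiset.count_add, Multiset.count_replicate, if_neg hi1, add_zero]
  rw [hprod, hfact]
  have := card_of_cycleType_mul_eq α μ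
  rw [if_pos ⟨hle, h2μ⟩] at this
  rw [← this]
  ring

lemma sum_prod_partition_eq (b : ℕ → ℂ) {α : Type*} [Fintype α] [DecidableEq α] :
    ∑ σ : Equiv.Perm α, (σ.partition.parts.map b).prod =
      (Fintype.card α).factorial * cycleIndex b (Fintype.card α) := by
  classical
  rw [cycleIndex, Finset.mul_sum,
    ← Finset.sum_fiberwise_of_maps_to (s := Finset.univ) (t := Finset.univ)
      (g := fun σ : Equiv.Perm α => σ.partition) (fun _ _ => Finset.mem_univ _)]
  refine Finset.sum_congr rfl fun l _ => ?_
  rw [Finset.sum_congr rfl (g := fun _ => (l.parts.map b).prod) (by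
    intro σ hσ; rw [(Finset.mem_filter.1 hσ).2])]
  rw [Finset.sum_const, nsmul_eq_mul, cycleIndexWeight, ← card_partition_eq_mul l]
  have h2 : ((l.parts.prod * ∏ i ∈ l.parts.toFinset, (l.parts.count i).factorial : ℕ) : ℂ) ≠ 0 := by
    exact_mod_cast (Nat.mul_pos (Multiset.prod_pos fun i hi => l.parts_pos hi)
      (Finset.prod_pos fun i _ => Nat.factorial_pos _)).ne'
  rw [Nat.cast_mul]
  field_simp

/-- The expectation of `∏ a_m ^ C_m` under the Ewens distribution. -/
def ewensGen (θ : ℝ) (a : ℕ → ℂ) (n : ℕ) : ℂ :=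
  (∑ σ : Equiv.Perm (Fin n), (θ : ℂ) ^ totalCycles σ * (σ.partition.parts.map a).prod) /
    ∏ i ∈ Finset.range n, ((θ : ℂ) + i)

/-- The rising factorial `θ (θ + 1) ⋯ (θ + n - 1)` divided by `n!`. -/
def ewensWeight (θ : ℝ) (n : ℕ) : ℝ := (∏ i ∈ Finset.range n, (θ + i)) / n.factorial

lemma ewensWeight_zero (θ : ℝ) : ewensWeight θ 0 = 1 := by simp [ewensWeight]

lemma ewensWeight_pos {θ : ℝ} (hθ : 0 < θ) (n : ℕ) : 0 < ewensWeight θ n := by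
  unfold ewensWeight
  have : 0 < ∏ i ∈ Finset.range n, (θ + i) := Finset.prod_pos fun i _ => by positivity
  positivity

lemma ewensWeight_succ (θ : ℝ) (n : ℕ) :
    (n + 1 : ℝ) * ewensWeight θ (n + 1) = (θ + n) * ewensWeight θ n := by
  unfold ewensWeight
  rw [Finset.prod_range_succ, Nat.factorial_succ]
  have : (n.factorial : ℝ) ≠ 0 := by exact_mod_cast n.factorial_ne_zero
  push_cast
  field_simp

/-- The factor θ per cycle is absorbed into the indeterminates, and the n! permutations cancel the
n! in `ewensWeight`. -/
lemma ewensWeight_mul_ewensGen {θ : ℝ} (hθ : 0 < θ) (a : ℕ → ℂ) (n : ℕ) :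
    (ewensWeight θ n : ℂ) * ewensGen θ a n = cycleIndex (fun m => θ * a m) n := by
  have h := sum_prod_partition_eq (fun m => θ * a m) (α := Fin n)
  have h0 : (n.factorial : ℂ) ≠ 0 := by exact_mod_cast n.factorial_ne_zero
  have h1 : (∏ i ∈ Finset.range n, ((θ : ℂ) + i)) ≠ 0 := by
    have : 0 < ∏ i ∈ Finset.range n, (θ + i) := Finset.prod_pos fun i _ => by positivity
    exact_mod_cast this.ne'
  have h2 : ∀ σ : Equiv.Perm (Fin n), (σ.partition.parts.map fun m => (θ : ℂ) * a m).prod =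
      (θ : ℂ) ^ totalCycles σ * (σ.partition.parts.map a).prod := by
    intro σ
    rw [Multiset.prod_map_mul, Multiset.map_const', Multiset.prod_replicate, totalCycles]
  rw [Finset.sum_congr rfl fun σ _ => h2 σ] at h
  unfold ewensGen ewensWeight
  rw [h]
  simp only [Fintype.card_fin]
  push_cast
  field_simp

/-- Conditioning on the cycle of a given element: it has length m with probability θ p_{n-m} / (n
p_n), where p is `ewensWeight θ`, and the rest is an Ewens permutation of n - m elements. -/
lemma ewensGen_recursion {θ : ℝ} (hθ : 0 < θ) (a : ℕ → ℂ) (n : ℕ) :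
    (n : ℂ) * (ewensWeight θ n * ewensGen θ a n) =
      θ * ∑ m ∈ Finset.Icc 1 n, a m * (ewensWeight θ (n - m) * ewensGen θ a (n - m)) := by
  simp only [ewensWeight_mul_ewensGen hθ]
  rw [card_mul_cycleIndex, Finset.mul_sum]
  simp only [mul_assoc]

lemma ewensGen_recursion_range {θ : ℝ} (hθ : 0 < θ) (a : ℕ → ℂ) (n : ℕ) :
    (n : ℂ) * (ewensWeight θ n * ewensGen θ a n) =
      θ * ∑ k ∈ Finset.range n, a (n - k) * (ewensWeight θ k * ewensGen θ a k) := by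
  rw [ewensGen_recursion hθ]
  congr 1
  refine Finset.sum_bij' (fun m _ => n - m) (fun k _ => n - k) ?_ ?_ ?_ ?_ ?_
  · intro m hm; simp at hm ⊢; omega
  · intro m hm; simp at hm ⊢; omega
  · intro m hm; simp at hm ⊢; omega
  · intro m hm; simp at hm ⊢; omega
  · intro m hm
    simp only [Finset.mem_Icc] at hm
    rw [Nat.sub_sub_self hm.2]

lemma ewensGen_congr (θ : ℝ) {a a' : ℕ → ℂ} {n : ℕ} (h : ∀ m, 0 < m → m ≤ n → a m = a' m) :
    ewensGen θ a n = ewensGen θ a' n := by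
  unfold ewensGen
  congr 1
  refine Finset.sum_congr rfl fun σ _ => ?_
  congr 2
  refine Multiset.map_congr rfl fun m hm => h m (σ.partition.parts_pos hm) ?_
  simpa using Nat.Partition.le_of_mem_parts hm

lemma ewensGen_zero (θ : ℝ) (a : ℕ → ℂ) : ewensGen θ a 0 = 1 := by
  unfold ewensGen totalCycles
  have : ∀ σ : Equiv.Perm (Fin 0), σ.partition.parts = 0 := fun σ =>
    Multiset.eq_zero_of_forall_notMem fun i hi => by
      have h1 := Nat.Partition.le_of_mem_parts hi
      have h2 := σ.partition.parts_pos hi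
      simp at h1; omega
  simp [this]

/-! ### Growth of the weights -/

section Weights

variable {θ : ℝ}

/-- The recursion for `a = 1`: the probabilities of the lengths of the cycle of a given element add
up to 1. -/
lemma sum_range_ewensWeight (N : ℕ) :
    θ * ∑ k ∈ Finset.range N, ewensWeight θ k = N * ewensWeight θ N := by
  induction N with
  | zero => simp
  | succ N ih =>
    rw [Finset.sum_range_succ, mul_add, ih]
    push_cast
    rw [ewensWeight_succ]
    ring

lemma mul_ewensWeight_mono (hθ : 0 < θ) : Monotone fun k : ℕ => k * ewensWeight θ k := by
  refine monotone_nat_of_le_succ fun k => ?_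
  have := (ewensWeight_pos hθ k)
  push_cast
  rw [ewensWeight_succ]
  nlinarith

/-- A substitute for the asymptotics k p_k ~ k^θ / Γ(θ). A step from k to k + 1 multiplies k p_k by
1 + θ/k, which is at least 1 + θ/(2K) for K ≤ k ≤ 2K; Bernoulli's inequality over K steps gives 1 +
θ/2. -/
lemma mul_ewensWeight_double (hθ : 0 < θ) (K : ℕ) :
    (1 + θ / 2) * (K * ewensWeight θ K) ≤ (2 * K : ℕ) * ewensWeight θ (2 * K) := by
  rcases Nat.eq_zero_or_pos K with rfl | hK
  · simp
  have hK' : (0 : ℝ) < K := by exact_mod_cast hK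
  have key : ∀ i ≤ K, (1 + θ / (2 * K)) ^ i * (K * ewensWeight θ K) ≤
      (K + i : ℕ) * ewensWeight θ (K + i) := by
    intro i
    induction i with
    | zero => simp
    | succ i ih =>
      intro hi
      have h1 := ih (by omega)
      have h2 := ewensWeight_succ θ (K + i)
      have hp := ewensWeight_pos hθ (K + i)
      rw [← add_assoc]
      push_cast at h1 h2 ⊢
      rw [h2, pow_succ]
      have hi' : ((i : ℝ) + 1) ≤ K := by exact_mod_cast hi
      have h3 : θ / (2 * K) * (K + i) ≤ θ := by
        rw [div_mul_eq_mul_div, div_le_iff₀ (by positivity)]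
        nlinarith
      calc _ = (1 + θ / (2 * K)) * ((1 + θ / (2 * K)) ^ i * (K * ewensWeight θ K)) := by ring
        _ ≤ (1 + θ / (2 * K)) * ((K + i) * ewensWeight θ (K + i)) := by gcongr
        _ = (K + i + θ / (2 * K) * (K + i)) * ewensWeight θ (K + i) := by ring
        _ ≤ (θ + (K + i)) * ewensWeight θ (K + i) :=
          mul_le_mul_of_nonneg_right (by linarith) hp.le
  have h := key K le_rfl
  rw [← two_mul] at h
  refine le_trans ?_ h
  have hp := ewensWeight_pos hθ K
  gcongr
  have := one_add_mul_le_pow (a := θ / (2 * K)) (by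
    have : 0 ≤ θ / (2 * K) := by positivity
    linarith) K
  refine le_trans (le_of_eq ?_) this
  field_simp

lemma mul_ewensWeight_pow_two (hθ : 0 < θ) (K j : ℕ) :
    (1 + θ / 2) ^ j * (K * ewensWeight θ K) ≤ (2 ^ j * K : ℕ) * ewensWeight θ (2 ^ j * K) := by
  induction j with
  | zero => simp
  | succ j ih =>
    have h := mul_ewensWeight_double hθ (2 ^ j * K)
    have e : 2 ^ (j + 1) * K = 2 * (2 ^ j * K) := by ring
    rw [e]
    refine le_trans ?_ h
    rw [pow_succ']
    rw [mul_assoc]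
    gcongr

lemma summable_mul_ewensWeight (hθ : 0 < θ) {r : ℝ} (h0 : 0 < r) (h1 : r < 1) :
    Summable fun k : ℕ => (k : ℝ) * ewensWeight θ k * r ^ k := by
  refine summable_of_ratio_test_tendsto_lt_one h1 ?_ ?_
  · filter_upwards [eventually_gt_atTop 0] with k hk
    have := ewensWeight_pos hθ k
    have : (0 : ℝ) < k := by exact_mod_cast hk
    positivity
  · have : Tendsto (fun k : ℕ => r * (1 + θ / k)) atTop (𝓝 (r * (1 + 0))) :=
      (tendsto_const_nhds.add (tendsto_const_div_atTop_nhds_zero_nat θ)).const_mul r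
    rw [add_zero, mul_one] at this
    refine this.congr' ?_
    filter_upwards [eventually_gt_atTop 0] with k hk
    have hp := ewensWeight_pos hθ k
    have hp' := ewensWeight_pos hθ (k + 1)
    have hk' : (0 : ℝ) < k := by exact_mod_cast hk
    rw [Real.norm_of_nonneg (by positivity), Real.norm_of_nonneg (by positivity)]
    push_cast
    rw [ewensWeight_succ]
    field_simp
    ring

lemma summable_ewensWeight (hθ : 0 < θ) {r : ℝ} (h0 : 0 < r) (h1 : r < 1) :
    Summable fun k : ℕ => ewensWeight θ k * r ^ k := by
  rw [← summable_nat_add_iff 1]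
  refine Summable.of_nonneg_of_le (fun k => ?_) (fun k => ?_)
    ((summable_nat_add_iff 1).2 (summable_mul_ewensWeight hθ h0 h1))
  · have := ewensWeight_pos hθ (k + 1); positivity
  · have hp := ewensWeight_pos hθ (k + 1)
    rw [mul_assoc]
    refine le_mul_of_one_le_left (by positivity) ?_
    push_cast; linarith [(Nat.cast_nonneg k : (0 : ℝ) ≤ k)]

/-- By monotonicity k p_k ≥ p_1 = θ for k ≥ 1, so the harmonic series is a lower bound. -/
lemma not_summable_ewensWeight (hθ : 0 < θ) : ¬ Summable (ewensWeight θ) := by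
  intro h
  refine Real.not_summable_one_div_natCast ?_
  rw [← summable_nat_add_iff 1] at h ⊢
  refine Summable.of_nonneg_of_le (fun k => by positivity) (fun k => ?_) (h.mul_left θ⁻¹)
  have h1 := mul_ewensWeight_mono hθ (show 1 ≤ k + 1 by omega)
  have h2 := ewensWeight_succ θ 0
  simp only [ewensWeight_zero] at h2
  push_cast at h1 h2 ⊢
  simp only [zero_add, add_zero, one_mul, mul_one] at h1 h2
  rw [h2] at h1
  rw [div_le_iff₀ (by positivity), mul_assoc, mul_comm (ewensWeight θ (k+1)),
    ← div_eq_inv_mul, le_div_iff₀ hθ, one_mul]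
  exact h1

end Weights

/-! ### Generating functions and the Abelian step -/

section PowerSeries

variable {θ : ℝ} {a F : ℕ → ℂ}

/-- By `sum_range_ewensWeight`, the recursion writes `F n` as a convex combination of the numbers `a
(n - k) * F k`. -/
lemma norm_le_one_of_recursion (hθ : 0 < θ) (ha : ∀ m, ‖a m‖ ≤ 1) (hF0 : F 0 = 1)
    (hF : ∀ n : ℕ, (n : ℂ) * (ewensWeight θ n * F n) =
      θ * ∑ k ∈ Finset.range n, a (n - k) * (ewensWeight θ k * F k)) (n : ℕ) : ‖F n‖ ≤ 1 := by
  induction n using Nat.strong_induction_on with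
  | _ n ih =>
    rcases Nat.eq_zero_or_pos n with rfl | hn
    · simp [hF0]
    have hp : ∀ k, 0 < ewensWeight θ k := ewensWeight_pos hθ
    have hn' : (0 : ℝ) < n := by exact_mod_cast hn
    have h := congrArg norm (hF n)
    rw [norm_mul, norm_mul, norm_mul, Complex.norm_natCast, Complex.norm_real, Complex.norm_real,
      Real.norm_of_nonneg (hp n).le, Real.norm_of_nonneg hθ.le] at h
    have h2 : ‖∑ k ∈ Finset.range n, a (n - k) * (ewensWeight θ k * F k)‖ ≤
        ∑ k ∈ Finset.range n, ewensWeight θ k := by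
      refine norm_sum_le_of_le _ fun k hk => ?_
      rw [norm_mul, norm_mul, Complex.norm_real, Real.norm_of_nonneg (hp k).le]
      have := ih k (Finset.mem_range.1 hk)
      calc _ ≤ 1 * (ewensWeight θ k * 1) := by
            have := (hp k).le
            gcongr
            exact ha _
        _ = _ := by ring
    have h3 : (n * ewensWeight θ n) * ‖F n‖ ≤ (n * ewensWeight θ n) * 1 := by
      rw [mul_assoc, h, mul_one, ← sum_range_ewensWeight]
      gcongr
    exact le_of_mul_le_mul_left h3 (mul_pos hn' (hp n))

/-- The differential equation satisfied by the generating function of `h`. -/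
lemma hasDerivAt_tsum_of_recursion (hθ : 0 < θ) (ha : ∀ m, ‖a m‖ ≤ 1) {h : ℕ → ℂ}
    (hb : ∀ k, ‖h k‖ ≤ ewensWeight θ k)
    (hh : ∀ n : ℕ, (n : ℂ) * h n = θ * ∑ k ∈ Finset.range n, a (n - k) * h k)
    {r : ℝ} (h0 : 0 ≤ r) (h1 : r < 1) :
    HasDerivAt (fun t : ℝ => ∑' k, h k * (t : ℂ) ^ k)
      (θ * (∑' i, a (i + 1) * (r : ℂ) ^ i) * ∑' k, h k * (r : ℂ) ^ k) r := by
  obtain ⟨ρ, hrρ, hρ1⟩ := exists_between h1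
  have hρ0 : 0 < ρ := h0.trans_lt hrρ
  have hsum : Summable fun k : ℕ => ((k : ℝ) * ewensWeight θ k * ρ ^ k) * ρ⁻¹ :=
    (summable_mul_ewensWeight hθ hρ0 hρ1).mul_right _
  have hs1 : Summable fun k : ℕ => ‖h k * (r : ℂ) ^ k‖ := by
    refine Summable.of_nonneg_of_le (fun _ => norm_nonneg _) (fun k => ?_)
      (summable_ewensWeight hθ hρ0 hρ1)
    rw [norm_mul, norm_pow, Complex.norm_real, Real.norm_of_nonneg h0]
    gcongr
    · exact (ewensWeight_pos hθ k).le
    · exact hb k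
  have hs2 : Summable fun i : ℕ => ‖a (i + 1) * (r : ℂ) ^ i‖ := by
    refine Summable.of_nonneg_of_le (fun _ => norm_nonneg _) (fun k => ?_)
      (summable_geometric_of_lt_one h0 h1)
    rw [norm_mul, norm_pow, Complex.norm_real, Real.norm_of_nonneg h0]
    exact mul_le_of_le_one_left (by positivity) (ha _)
  have hmain : HasDerivAt (fun t : ℝ => ∑' k, h k * (t : ℂ) ^ k)
      (∑' k : ℕ, h k * (k * (r : ℂ) ^ (k - 1))) r := by
    refine hasDerivAt_tsum_of_isPreconnected (t := Set.Ioo (-ρ) ρ) (y₀ := r)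
      (g := fun k (t : ℝ) => h k * (t : ℂ) ^ k) (g' := fun k (t : ℝ) => h k * (k * (t : ℂ) ^ (k - 1)))
      hsum isOpen_Ioo (convex_Ioo _ _).isPreconnected ?_ ?_ ?_ hs1.of_norm ?_
    · intro k y _
      exact ((Complex.ofRealCLM.hasDerivAt (x := y)).pow k |>.const_mul (h k)).congr_deriv (by simp)
    · intro k y hy
      rcases Nat.eq_zero_or_pos k with rfl | hk
      · simp
      have hy' : |y| ≤ ρ := abs_le.2 ⟨hy.1.le, hy.2.le⟩
      rw [norm_mul, norm_mul, norm_pow, Complex.norm_real, Complex.norm_natCast, Real.norm_eq_abs]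
      have hpk := ewensWeight_pos hθ k
      calc _ ≤ ewensWeight θ k * (k * ρ ^ (k - 1)) := by gcongr; exact hb k
        _ = _ := by
          obtain ⟨j, rfl⟩ := Nat.exists_eq_succ_of_ne_zero hk.ne'
          rw [Nat.succ_eq_add_one, Nat.add_sub_cancel, pow_succ]
          field_simp
    · exact ⟨by linarith, hrρ⟩
    · exact ⟨by linarith, hrρ⟩
  refine hmain.congr_deriv ?_
  have hsder : Summable fun k : ℕ => h k * (k * (r : ℂ) ^ (k - 1)) := by
    refine Summable.of_norm_bounded hsum fun k => ?_
    rcases Nat.eq_zero_or_pos k with rfl | hk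
    · simp
    rw [norm_mul, norm_mul, norm_pow, Complex.norm_real, Complex.norm_natCast,
      Real.norm_of_nonneg h0]
    have hpk := ewensWeight_pos hθ k
    calc _ ≤ ewensWeight θ k * (k * ρ ^ (k - 1)) := by gcongr; exact hb k
      _ = _ := by
        obtain ⟨j, rfl⟩ := Nat.exists_eq_succ_of_ne_zero hk.ne'
        rw [Nat.succ_eq_add_one, Nat.add_sub_cancel, pow_succ]
        field_simp
  -- The coefficient of r^k in the derivative is (k + 1) h_{k+1}, which the recursion turns into the
  -- Cauchy product of the two series.
  rw [hsder.tsum_eq_zero_add, mul_assoc, mul_comm (∑' i, a (i + 1) * (r : ℂ) ^ i),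
    tsum_mul_tsum_eq_tsum_sum_antidiagonal_of_summable_norm hs1 hs2, ← tsum_mul_left]
  simp only [Nat.cast_zero, zero_mul, mul_zero, zero_add]
  refine tsum_congr fun k => ?_
  rw [Finset.Nat.sum_antidiagonal_eq_sum_range_succ
    (fun i j => h i * (r : ℂ) ^ i * (a (j + 1) * (r : ℂ) ^ j)), Nat.add_sub_cancel, ← mul_assoc,
    mul_comm (h (k + 1)), hh (k + 1), mul_assoc, Finset.sum_mul]
  congr 1
  refine Finset.sum_congr rfl fun i hi => ?_
  have hi' : i ≤ k := Nat.lt_succ_iff.1 (Finset.mem_range.1 hi)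
  rw [show k + 1 - i = k - i + 1 by omega]
  have : (r : ℂ) ^ k = (r : ℂ) ^ i * (r : ℂ) ^ (k - i) := by rw [← pow_add]; congr 1; omega
  rw [this]
  ring

/-- Both series solve first-order linear equations, with coefficients θ ∑ a_{i+1} t^i and θ ∑ t^i.
These differ by the derivative of the polynomial G in the exponent, so u e^{-G} / v is constant on
[0, 1), with value 1 at 0. -/
lemma tsum_eq_exp_mul_tsum (hθ : 0 < θ) (ha : ∀ m, ‖a m‖ ≤ 1) {n : ℕ} (ha1 : ∀ m, n < m → a m = 1)
    (hF0 : F 0 = 1)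
    (hF : ∀ n : ℕ, (n : ℂ) * (ewensWeight θ n * F n) =
      θ * ∑ k ∈ Finset.range n, a (n - k) * (ewensWeight θ k * F k))
    {r : ℝ} (h0 : 0 ≤ r) (h1 : r < 1) :
    ∑' k, ewensWeight θ k * F k * (r : ℂ) ^ k =
      Complex.exp (θ * ∑ i ∈ Finset.range n, (a (i + 1) - 1) / (i + 1 : ℕ) * (r : ℂ) ^ (i + 1)) *
        ∑' k, (ewensWeight θ k : ℂ) * (r : ℂ) ^ k := by
  have hp : ∀ k, 0 < ewensWeight θ k := ewensWeight_pos hθ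
  have hFb := norm_le_one_of_recursion hθ ha hF0 hF
  set u : ℝ → ℂ := fun t => ∑' k, ewensWeight θ k * F k * (t : ℂ) ^ k with hu
  set v : ℝ → ℂ := fun t => ∑' k, (ewensWeight θ k : ℂ) * (t : ℂ) ^ k with hv
  set G : ℝ → ℂ := fun t =>
    θ * ∑ i ∈ Finset.range n, (a (i + 1) - 1) / (i + 1 : ℕ) * (t : ℂ) ^ (i + 1) with hG
  have hu' : ∀ t : ℝ, 0 ≤ t → t < 1 →
      HasDerivAt u (θ * (∑' i, a (i + 1) * (t : ℂ) ^ i) * u t) t := fun t ht0 ht1 =>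
    hasDerivAt_tsum_of_recursion hθ ha (h := fun k => ewensWeight θ k * F k)
      (fun k => by
        rw [norm_mul, Complex.norm_real, Real.norm_of_nonneg (hp k).le]
        exact mul_le_of_le_one_right (hp k).le (hFb k)) hF ht0 ht1
  have hv' : ∀ t : ℝ, 0 ≤ t → t < 1 →
      HasDerivAt v (θ * (∑' i : ℕ, (1 : ℂ) * (t : ℂ) ^ i) * v t) t := fun t ht0 ht1 =>
    hasDerivAt_tsum_of_recursion hθ (a := fun _ => 1) (by simp)
      (h := fun k => (ewensWeight θ k : ℂ))
      (fun k => by rw [Complex.norm_real, Real.norm_of_nonneg (hp k).le])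
      (fun N => by
        simp only [one_mul]
        exact_mod_cast (sum_range_ewensWeight (θ := θ) N).symm) ht0 ht1
  have hG' : ∀ t : ℝ, HasDerivAt G (θ * ∑ i ∈ Finset.range n, (a (i + 1) - 1) * (t : ℂ) ^ i) t := by
    intro t
    refine (HasDerivAt.fun_sum fun i _ => ((Complex.ofRealCLM.hasDerivAt (x := t)).pow (i + 1)
      |>.const_mul ((a (i + 1) - 1) / (i + 1 : ℕ)))).const_mul (θ : ℂ) |>.congr_deriv ?_
    congr 1
    refine Finset.sum_congr rfl fun i _ => ?_
    have : ((i + 1 : ℕ) : ℂ) ≠ 0 := by exact_mod_cast Nat.succ_ne_zero i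
    simp only [Complex.ofRealCLM_apply, Complex.ofReal_one, mul_one, Nat.add_sub_cancel]
    field_simp
  have hA : ∀ t : ℝ, 0 ≤ t → t < 1 → ∑' i, a (i + 1) * (t : ℂ) ^ i =
      ∑ i ∈ Finset.range n, (a (i + 1) - 1) * (t : ℂ) ^ i + ∑' i : ℕ, (1 : ℂ) * (t : ℂ) ^ i := by
    intro t ht0 ht1
    have hg : Summable fun i : ℕ => (1 : ℂ) * (t : ℂ) ^ i := by
      simp only [one_mul]
      exact summable_geometric_of_norm_lt_one (by
        rwa [Complex.norm_real, Real.norm_of_nonneg ht0])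
    have hfin : HasSum (fun i => (a (i + 1) - 1) * (t : ℂ) ^ i)
        (∑ i ∈ Finset.range n, (a (i + 1) - 1) * (t : ℂ) ^ i) := by
      refine hasSum_sum_of_ne_finset_zero fun i hi => ?_
      rw [ha1 (i + 1) (by simp at hi; omega)]; simp
    refine (HasSum.congr_fun (hfin.add hg.hasSum) ?_).tsum_eq
    intro i; ring
  have hv0 : ∀ t : ℝ, 0 ≤ t → t < 1 → v t ≠ 0 := by
    intro t ht0 ht1
    have hs : Summable fun k => ewensWeight θ k * t ^ k := by
      rcases ht0.eq_or_lt with rfl | h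
      · refine summable_of_ne_finset_zero (s := {0}) fun k hk => ?_
        simp at hk; simp [hk]
      · exact summable_ewensWeight hθ h ht1
    have : v t = ((∑' k, ewensWeight θ k * t ^ k : ℝ) : ℂ) := by
      rw [Complex.ofReal_tsum]; simp [hv]
    rw [this]
    have h2 := hs.le_tsum 0 (fun k _ => mul_nonneg (hp k).le (by positivity))
    simp only [ewensWeight_zero, pow_zero, mul_one] at h2
    exact_mod_cast (zero_lt_one.trans_le h2).ne'
  set w : ℝ → ℂ := fun t => u t * Complex.exp (-G t) / v t with hw
  have hw' : ∀ t : ℝ, 0 ≤ t → t < 1 → HasDerivAt w 0 t := by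
    intro t ht0 ht1
    have := ((hu' t ht0 ht1).mul (hG' t).neg.cexp).div (hv' t ht0 ht1) (hv0 t ht0 ht1)
    refine this.congr_deriv ?_
    rw [hA t ht0 ht1]
    simp only [Pi.mul_apply, Pi.neg_apply]
    ring
  have hconst : w r = w 0 := by
    refine constant_of_has_deriv_right_zero (a := 0) (b := r) ?_ ?_ r ⟨h0, le_rfl⟩
    · exact fun t ht => (hw' t ht.1 (ht.2.trans_lt h1)).continuousAt.continuousWithinAt
    · exact fun t ht => (hw' t ht.1 (ht.2.trans h1)).hasDerivWithinAt
  have hw0 : w 0 = 1 := by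
    have e1 : u 0 = 1 := by
      simp only [hu]
      rw [tsum_eq_single 0 (fun k hk => by simp [hk])]
      simp [hF0, ewensWeight_zero]
    have e2 : v 0 = 1 := by
      simp only [hv]
      rw [tsum_eq_single 0 (fun k hk => by simp [hk])]
      simp [ewensWeight_zero]
    simp [hw, e1, e2, hG]
  rw [hw0] at hconst
  have := hv0 r h0 h1
  change u r = Complex.exp (G r) * v r
  simp only [hw] at hconst
  rw [div_eq_one_iff_eq this] at hconst
  rw [← hconst, mul_comm, mul_assoc, ← Complex.exp_add, neg_add_cancel, Complex.exp_zero, mul_one]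

/-- Abelian theorem: an eventual bound on `F` passes to the limit. -/
lemma norm_exp_sub_le_of_forall_ge (hθ : 0 < θ) (ha : ∀ m, ‖a m‖ ≤ 1) {n : ℕ}
    (ha1 : ∀ m, n < m → a m = 1) (hF0 : F 0 = 1)
    (hF : ∀ n : ℕ, (n : ℂ) * (ewensWeight θ n * F n) =
      θ * ∑ k ∈ Finset.range n, a (n - k) * (ewensWeight θ k * F k))
    {w : ℂ} {δ : ℝ} {N₀ : ℕ} (hδ : ∀ N, N₀ ≤ N → ‖F N - w‖ ≤ δ) :
    ‖Complex.exp (θ * ∑ i ∈ Finset.range n, (a (i + 1) - 1) / (i + 1 : ℕ)) - w‖ ≤ δ := by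
  have hp : ∀ k, 0 < ewensWeight θ k := ewensWeight_pos hθ
  have hδ0 : 0 ≤ δ := (norm_nonneg _).trans (hδ N₀ le_rfl)
  set v : ℝ → ℝ := fun t => ∑' k, ewensWeight θ k * t ^ k with hv
  set B : ℝ := ∑ k ∈ Finset.range N₀, ewensWeight θ k * ‖F k - w‖ with hB
  have hB0 : 0 ≤ B := Finset.sum_nonneg fun k _ => mul_nonneg (hp k).le (norm_nonneg _)
  have hFb := norm_le_one_of_recursion hθ ha hF0 hF
  have key : ∀ r : ℝ, 0 < r → r < 1 →
      ‖Complex.exp (θ * ∑ i ∈ Finset.range n, (a (i + 1) - 1) / (i + 1 : ℕ) * (r : ℂ) ^ (i + 1))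
        - w‖ * v r ≤ B + δ * v r := by
    intro r h0 h1
    have hs := summable_ewensWeight hθ h0 h1
    have hv0 : 0 ≤ v r := tsum_nonneg fun k => mul_nonneg (hp k).le (by positivity)
    have e := tsum_eq_exp_mul_tsum hθ ha ha1 hF0 hF h0.le h1
    have e2 : (∑' k, (ewensWeight θ k : ℂ) * (r : ℂ) ^ k) = (v r : ℂ) := by
      simp only [hv]; rw [Complex.ofReal_tsum]; simp
    rw [e2] at e
    have hs2 : Summable fun k => (ewensWeight θ k : ℂ) * (r : ℂ) ^ k := by
      have := Complex.ofRealCLM.summable hs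
      simpa using this
    have hs1 : Summable fun k => ewensWeight θ k * F k * (r : ℂ) ^ k := by
      refine Summable.of_norm_bounded hs fun k => ?_
      rw [norm_mul, norm_mul, norm_pow, Complex.norm_real, Complex.norm_real,
        Real.norm_of_nonneg (hp k).le, Real.norm_of_nonneg h0.le]
      gcongr
      exact mul_le_of_le_one_right (hp k).le (hFb k)
    have hterm : ∀ k, ‖ewensWeight θ k * F k * (r : ℂ) ^ k - w * (ewensWeight θ k * (r : ℂ) ^ k)‖ =
        ewensWeight θ k * r ^ k * ‖F k - w‖ := by
      intro k
      rw [show ewensWeight θ k * F k * (r : ℂ) ^ k - w * (ewensWeight θ k * (r : ℂ) ^ k) =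
        ewensWeight θ k * (r : ℂ) ^ k * (F k - w) by ring, norm_mul, norm_mul, norm_pow,
        Complex.norm_real, Complex.norm_real, Real.norm_of_nonneg (hp k).le,
        Real.norm_of_nonneg h0.le]
    have hs3 : Summable fun k => ewensWeight θ k * r ^ k * ‖F k - w‖ := by
      simp only [← hterm]
      refine Summable.norm ?_
      exact hs1.sub (hs2.mul_left w)
    have e3 : (Complex.exp (θ * ∑ i ∈ Finset.range n, (a (i + 1) - 1) / (i + 1 : ℕ) *
        (r : ℂ) ^ (i + 1)) - w) * v r =
        ∑' k, (ewensWeight θ k * F k * (r : ℂ) ^ k - w * (ewensWeight θ k * (r : ℂ) ^ k)) := by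
      rw [hs1.tsum_sub (hs2.mul_left w), e, tsum_mul_left, e2]; ring
    have e4 := congrArg norm e3
    rw [norm_mul, Complex.norm_real, Real.norm_of_nonneg hv0] at e4
    rw [e4]
    refine (norm_tsum_le_tsum_norm (by simpa only [hterm] using hs3)).trans ?_
    simp only [hterm]
    have hhs : Summable fun k => if k < N₀ then ewensWeight θ k * ‖F k - w‖ else 0 :=
      summable_of_ne_finset_zero (s := Finset.range N₀) fun k hk => by
        rw [if_neg]; simpa using hk
    have hB' : B = ∑' k, if k < N₀ then ewensWeight θ k * ‖F k - w‖ else 0 := by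
      rw [tsum_eq_sum (s := Finset.range N₀) fun k hk => by rw [if_neg]; simpa using hk]
      refine Finset.sum_congr rfl fun k hk => ?_
      rw [if_pos (Finset.mem_range.1 hk)]
    rw [hB', hv, ← tsum_mul_left, ← hhs.tsum_add (hs.mul_left δ)]
    refine hs3.tsum_le_tsum (fun k => ?_) (hhs.add (hs.mul_left δ))
    have hr1 : r ^ k ≤ 1 := pow_le_one₀ h0.le h1.le
    split_ifs with hk
    · have : ewensWeight θ k * r ^ k * ‖F k - w‖ ≤ ewensWeight θ k * 1 * ‖F k - w‖ := by
        gcongr; exact (hp k).le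
      have h5 : 0 ≤ δ * (ewensWeight θ k * r ^ k) :=
        mul_nonneg hδ0 (mul_nonneg (hp k).le (by positivity))
      linarith
    · rw [zero_add, mul_comm]
      gcongr
      · exact mul_nonneg (hp k).le (by positivity)
      · exact hδ k (not_lt.1 hk)
  -- Divergence of v at 1 makes the contribution B of the indices below N₀ negligible after division
  -- by v.
  have hvt : Tendsto v (𝓝[<] 1) atTop := by
    rw [tendsto_atTop]
    intro b
    have hns := (not_summable_iff_tendsto_nat_atTop_of_nonneg fun k => (hp k).le).1
      (not_summable_ewensWeight hθ)
    obtain ⟨K, hK⟩ := ((tendsto_atTop.1 hns) (b + 1)).exists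
    have hc : Tendsto (fun r : ℝ => ∑ k ∈ Finset.range K, ewensWeight θ k * r ^ k) (𝓝[<] 1)
        (𝓝 (∑ k ∈ Finset.range K, ewensWeight θ k * 1 ^ k)) :=
      (Continuous.tendsto (by fun_prop) 1).mono_left nhdsWithin_le_nhds
    simp only [one_pow, mul_one] at hc
    have hlt := hc.eventually (lt_mem_nhds (show b < _ by linarith))
    filter_upwards [hlt, Ioo_mem_nhdsLT (zero_lt_one (α := ℝ))] with r hr hr01
    refine hr.le.trans ((summable_ewensWeight hθ hr01.1 hr01.2).sum_le_tsum _ fun k _ => ?_)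
    exact mul_nonneg (hp k).le (pow_nonneg hr01.1.le k)
  have hcont : Tendsto (fun r : ℝ => ‖Complex.exp (θ * ∑ i ∈ Finset.range n,
      (a (i + 1) - 1) / (i + 1 : ℕ) * (r : ℂ) ^ (i + 1)) - w‖) (𝓝[<] 1)
      (𝓝 ‖Complex.exp (θ * ∑ i ∈ Finset.range n, (a (i + 1) - 1) / (i + 1 : ℕ) *
        ((1 : ℝ) : ℂ) ^ (i + 1)) - w‖) :=
    (Continuous.tendsto (by fun_prop) 1).mono_left nhdsWithin_le_nhds
  simp only [Complex.ofReal_one, one_pow, mul_one] at hcont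
  have hlim : Tendsto (fun r => B / v r + δ) (𝓝[<] 1) (𝓝 (0 + δ)) :=
    (hvt.const_div_atTop B).add_const δ
  rw [zero_add] at hlim
  refine le_of_tendsto_of_tendsto hcont hlim ?_
  filter_upwards [hvt.eventually_gt_atTop 0, Ioo_mem_nhdsLT (zero_lt_one (α := ℝ))] with r hr hr01
  have := key r hr01.1 hr01.2
  rw [← le_div_iff₀ hr] at this
  refine this.trans (le_of_eq ?_)
  field_simp

end PowerSeries

/-! ### Slow variation of `F` beyond `n` -/

section Comparison

variable {θ : ℝ} {a F : ℕ → ℂ}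

/-- The mean of `e m`, when `m` is the length of the cycle of a given element of an Ewens
permutation of `N` elements. -/
def ewensMean (θ : ℝ) (e : ℕ → ℝ) (N : ℕ) : ℝ :=
  θ / (N * ewensWeight θ N) * ∑ k ∈ Finset.range N, e (N - k) * ewensWeight θ k

lemma sum_range_sub_eq_of_eq_zero {e : ℕ → ℝ} {n N : ℕ} (he : ∀ m, n < m → e m = 0) (h : n ≤ N) :
    ∑ k ∈ Finset.range N, e (N - k) = ∑ i ∈ Finset.range n, e (i + 1) := by
  have h1 : ∑ k ∈ Finset.range N, e (N - k) = ∑ i ∈ Finset.range N, e (i + 1) := by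
    rw [← Finset.sum_range_reflect (fun i => e (i + 1))]
    refine Finset.sum_congr rfl fun k hk => ?_
    have := Finset.mem_range.1 hk
    congr 1; omega
  rw [h1]
  refine (Finset.sum_subset (by simpa using h) fun i _ hi => he _ ?_).symm
  simp at hi; omega

/-- Only k ≥ N - n ≥ N/2 contribute, and there p_k ≤ 2 p_N by monotonicity of k p_k. The decay in
1/N is what makes the increments of `restMean` summable far out. -/
lemma ewensMean_le_far (hθ : 0 < θ) {e : ℕ → ℝ} (he0 : ∀ m, 0 ≤ e m) {n N : ℕ}
    (he : ∀ m, n < m → e m = 0) (hn : 0 < n) (hN : 2 * n ≤ N) :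
    ewensMean θ e N ≤ 2 * θ * (∑ i ∈ Finset.range n, e (i + 1)) / N := by
  have hp : ∀ k, 0 < ewensWeight θ k := ewensWeight_pos hθ
  have hN0 : (0 : ℝ) < N := by exact_mod_cast (by omega : 0 < N)
  have h1 : ∑ k ∈ Finset.range N, e (N - k) * ewensWeight θ k ≤
      (∑ k ∈ Finset.range N, e (N - k)) * (2 * ewensWeight θ N) := by
    rw [Finset.sum_mul]
    refine Finset.sum_le_sum fun k hk => ?_
    have hk' := Finset.mem_range.1 hk
    by_cases hkn : n < N - k
    · simp [he _ hkn]
    · refine mul_le_mul_of_nonneg_left ?_ (he0 _)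
      have hk2 : (N : ℝ) ≤ 2 * k := by exact_mod_cast (by omega : N ≤ 2 * k)
      have hk0 : (0 : ℝ) < k := by linarith
      have hm := mul_ewensWeight_mono hθ hk'.le
      simp only at hm
      have : (k : ℝ) * ewensWeight θ k ≤ k * (2 * ewensWeight θ N) := by
        nlinarith [hp N]
      exact le_of_mul_le_mul_left this hk0
  unfold ewensMean
  rw [sum_range_sub_eq_of_eq_zero he (by omega)] at h1
  have hpN := hp N
  calc _ ≤ θ / (N * ewensWeight θ N) * ((∑ i ∈ Finset.range n, e (i + 1)) * (2 * ewensWeight θ N)) := by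
        gcongr
    _ = _ := by field_simp

/-- Split at K = N / 2^j. Below K the weights carry at most a proportion (1 + θ/2)^(-j) of the
total, by iterated doubling, and `e ≤ 2`. Above K one has p_k ≤ 2^(j+1) p_N, so the plain sum of `e`
suffices. The integer j is free, to be taken large before E is made small. -/
lemma ewensMean_le (hθ : 0 < θ) {e : ℕ → ℝ} (he0 : ∀ m, 0 ≤ e m) (he2 : ∀ m, e m ≤ 2) {n N j : ℕ}
    (he : ∀ m, n < m → e m = 0) (hj : 2 ^ j ≤ n) (hN : n ≤ N) {E : ℝ}
    (hE : ∑ i ∈ Finset.range n, e (i + 1) ≤ E * n) :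
    ewensMean θ e N ≤ θ * 2 ^ (j + 1) * E + 2 * ((1 + θ / 2) ^ j)⁻¹ := by
  have hp : ∀ k, 0 < ewensWeight θ k := ewensWeight_pos hθ
  have hn0 : 0 < n := lt_of_lt_of_le (by positivity) hj
  have hN0 : (0 : ℝ) < N := by exact_mod_cast (by omega : 0 < N)
  have hE0 : 0 ≤ E := by
    have h1 : 0 ≤ E * n := (Finset.sum_nonneg fun i _ => he0 (i + 1)).trans hE
    have h2 : (0 : ℝ) < n := by exact_mod_cast hn0
    exact nonneg_of_mul_nonneg_left h1 h2
  set K := N / 2 ^ j with hK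
  have hK1 : 0 < K := Nat.div_pos (hj.trans hN) (by positivity)
  have hKN : 2 ^ j * K ≤ N := Nat.mul_div_le N (2 ^ j)
  have hNK : N ≤ 2 ^ (j + 1) * K := by
    have h1 : N < 2 ^ j * (K + 1) := Nat.lt_mul_div_succ N (by positivity)
    have h2 : 2 ^ j * (K + 1) ≤ 2 ^ j * (2 * K) := Nat.mul_le_mul_left _ (by omega)
    rw [pow_succ, mul_assoc]; omega
  have hK0 : (0 : ℝ) < K := by exact_mod_cast hK1
  have hbig : ∀ k, K ≤ k → k < N → ewensWeight θ k ≤ 2 ^ (j + 1) * ewensWeight θ N := by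
    intro k hk hkN
    have hm := mul_ewensWeight_mono hθ hkN.le
    simp only at hm
    have h1 : (K : ℝ) ≤ k := by exact_mod_cast hk
    have h2 : (N : ℝ) ≤ 2 ^ (j + 1) * K := by exact_mod_cast hNK
    have : (K : ℝ) * ewensWeight θ k ≤ K * (2 ^ (j + 1) * ewensWeight θ N) := by
      calc _ ≤ (k : ℝ) * ewensWeight θ k := mul_le_mul_of_nonneg_right h1 (hp k).le
        _ ≤ N * ewensWeight θ N := hm
        _ ≤ (2 ^ (j + 1) * K) * ewensWeight θ N := mul_le_mul_of_nonneg_right h2 (hp N).le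
        _ = _ := by ring
    exact le_of_mul_le_mul_left this hK0
  have h1 : ∑ k ∈ Finset.range N, e (N - k) * ewensWeight θ k ≤
      2 * ∑ k ∈ Finset.range K, ewensWeight θ k +
      (∑ k ∈ Finset.range N, e (N - k)) * (2 ^ (j + 1) * ewensWeight θ N) := by
    have hsplit : ∑ k ∈ Finset.range K, ewensWeight θ k =
        ∑ k ∈ Finset.range N, if k < K then ewensWeight θ k else 0 := by
      have hsub : Finset.range K ⊆ Finset.range N := by
        rw [Finset.range_subset_range]; exact Nat.div_le_self _ _
      rw [← Finset.sum_subset (f := fun k => if k < K then ewensWeight θ k else 0) hsub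
        (fun k _ hk => if_neg (by simpa using hk))]
      refine Finset.sum_congr rfl fun k hk => (if_pos (by simpa using hk)).symm
    rw [Finset.sum_mul, hsplit, Finset.mul_sum, ← Finset.sum_add_distrib]
    refine Finset.sum_le_sum fun k hk => ?_
    have hk' := Finset.mem_range.1 hk
    have hnn : 0 ≤ e (N - k) * (2 ^ (j + 1) * ewensWeight θ N) :=
      mul_nonneg (he0 _) (mul_nonneg (by positivity) (hp N).le)
    split_ifs with hkK
    · have := mul_le_mul_of_nonneg_right (he2 (N - k)) (hp k).le
      linarith
    · rw [mul_zero, zero_add]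
      exact mul_le_mul_of_nonneg_left (hbig k (not_lt.1 hkK) hk') (he0 _)
  rw [sum_range_sub_eq_of_eq_zero he hN] at h1
  have h2 : (K : ℝ) * ewensWeight θ K ≤ ((1 + θ / 2) ^ j)⁻¹ * (N * ewensWeight θ N) := by
    have h3 := mul_ewensWeight_pow_two hθ K j
    have h4 := mul_ewensWeight_mono hθ hKN
    simp only at h4
    rw [← div_eq_inv_mul, le_div_iff₀ (by positivity), mul_comm]
    exact h3.trans h4
  have h5 := sum_range_ewensWeight (θ := θ) K
  have h6 : E * n ≤ E * N := mul_le_mul_of_nonneg_left (by exact_mod_cast hN) hE0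
  have hpN := hp N
  have h7 : θ * ∑ k ∈ Finset.range N, e (N - k) * ewensWeight θ k ≤
      (θ * 2 ^ (j + 1) * E + 2 * ((1 + θ / 2) ^ j)⁻¹) * (N * ewensWeight θ N) := by
    calc _ ≤ θ * (2 * ∑ k ∈ Finset.range K, ewensWeight θ k +
          (E * N) * (2 ^ (j + 1) * ewensWeight θ N)) := by
          refine mul_le_mul_of_nonneg_left (h1.trans ?_) hθ.le
          gcongr
          exact hE.trans h6
      _ = 2 * (θ * ∑ k ∈ Finset.range K, ewensWeight θ k) +
          θ * 2 ^ (j + 1) * E * (N * ewensWeight θ N) := by ring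
      _ ≤ 2 * (((1 + θ / 2) ^ j)⁻¹ * (N * ewensWeight θ N)) +
          θ * 2 ^ (j + 1) * E * (N * ewensWeight θ N) := by rw [h5]; gcongr
      _ = _ := by ring
  unfold ewensMean
  rw [div_mul_eq_mul_div, div_le_iff₀ (by positivity)]
  exact h7

/-- The mean of `F` over the number of elements outside the cycle of a given element. -/
def restMean (θ : ℝ) (F : ℕ → ℂ) (N : ℕ) : ℂ :=
  θ / (N * ewensWeight θ N) * ∑ k ∈ Finset.range N, ewensWeight θ k * F k

/-- Subtracting the mean replaces the factor `a (N - k)` in the recursion by `a (N - k) - 1`. -/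
lemma norm_sub_restMean_le (hθ : 0 < θ) (hFb : ∀ k, ‖F k‖ ≤ 1)
    (hF : ∀ n : ℕ, (n : ℂ) * (ewensWeight θ n * F n) =
      θ * ∑ k ∈ Finset.range n, a (n - k) * (ewensWeight θ k * F k)) {N : ℕ} (hN : 0 < N) :
    ‖F N - restMean θ F N‖ ≤ ewensMean θ (fun m => ‖a m - 1‖) N := by
  have hp : ∀ k, 0 < ewensWeight θ k := ewensWeight_pos hθ
  have hN0 : (N : ℂ) ≠ 0 := by exact_mod_cast hN.ne'
  have hpN : (ewensWeight θ N : ℂ) ≠ 0 := by exact_mod_cast (hp N).ne'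
  have e : F N - restMean θ F N = θ / (N * ewensWeight θ N) *
      ∑ k ∈ Finset.range N, (a (N - k) - 1) * (ewensWeight θ k * F k) := by
    have h1 : F N = θ / (N * ewensWeight θ N) *
        ∑ k ∈ Finset.range N, a (N - k) * (ewensWeight θ k * F k) := by
      rw [div_mul_eq_mul_div, ← hF N]; field_simp
    rw [restMean]
    nth_rewrite 1 [h1]
    rw [← mul_sub, ← Finset.sum_sub_distrib]
    congr 1
    exact Finset.sum_congr rfl fun k _ => by ring
  rw [e, norm_mul, ewensMean]
  have : ‖(θ : ℂ) / (N * ewensWeight θ N)‖ = θ / (N * ewensWeight θ N) := by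
    rw [norm_div, norm_mul, Complex.norm_real, Complex.norm_real, Complex.norm_natCast,
      Real.norm_of_nonneg hθ.le, Real.norm_of_nonneg (hp N).le]
  rw [this]
  have h0 : 0 ≤ θ / (N * ewensWeight θ N) := by have := hp N; positivity
  refine mul_le_mul_of_nonneg_left (norm_sum_le_of_le _ fun k _ => ?_) h0
  rw [norm_mul, norm_mul, Complex.norm_real, Real.norm_of_nonneg (hp k).le]
  exact mul_le_mul_of_nonneg_left (mul_le_of_le_one_right (hp k).le (hFb k)) (norm_nonneg _)

/-- A weighted mean moves towards a new entry by the relative weight of that entry, here p_N / ∑_{k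
≤ N} p_k = θ / (θ + N). -/
lemma restMean_succ_sub (hθ : 0 < θ) {N : ℕ} (hN : 0 < N) :
    restMean θ F (N + 1) - restMean θ F N = θ / (θ + N) * (F N - restMean θ F N) := by
  have hp : ∀ k, 0 < ewensWeight θ k := ewensWeight_pos hθ
  have hN0 : (N : ℂ) ≠ 0 := by exact_mod_cast hN.ne'
  have hpN : (ewensWeight θ N : ℂ) ≠ 0 := by exact_mod_cast (hp N).ne'
  have hθN : (θ : ℂ) + N ≠ 0 := by
    have : θ + N ≠ 0 := by positivity
    exact_mod_cast this
  have hs : ((N + 1 : ℕ) : ℂ) * ewensWeight θ (N + 1) = (θ + N) * ewensWeight θ N := by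
    have := ewensWeight_succ θ N
    exact_mod_cast this
  unfold restMean
  rw [hs, Finset.sum_range_succ]
  field_simp
  ring

lemma norm_restMean_succ_sub_le (hθ : 0 < θ) (hFb : ∀ k, ‖F k‖ ≤ 1)
    (hF : ∀ n : ℕ, (n : ℂ) * (ewensWeight θ n * F n) =
      θ * ∑ k ∈ Finset.range n, a (n - k) * (ewensWeight θ k * F k)) {N : ℕ} (hN : 0 < N) {D : ℝ}
    (hD : ewensMean θ (fun m => ‖a m - 1‖) N ≤ D) :
    ‖restMean θ F (N + 1) - restMean θ F N‖ ≤ θ / N * D := by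
  have hN0 : (0 : ℝ) < N := by exact_mod_cast hN
  have h := (norm_sub_restMean_le hθ hFb hF hN).trans hD
  have hD0 : 0 ≤ D := (norm_nonneg _).trans h
  rw [restMean_succ_sub hθ hN, norm_mul]
  have : ‖(θ : ℂ) / (θ + N)‖ = θ / (θ + N) := by
    rw [show (θ : ℂ) / (θ + N) = ((θ / (θ + N) : ℝ) : ℂ) by push_cast; rfl, Complex.norm_real,
      Real.norm_of_nonneg (by positivity)]
  rw [this]
  gcongr
  linarith

/-- `F` is within η of `restMean` at both ends, so it is enough to follow `restMean`. From n to 2n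
there are n steps of size at most θη/n. Beyond 2n a step at N is at most 2θ²En/N², which is
summable. -/
lemma norm_sub_le_of_ewensMean_le (hθ : 0 < θ) (hFb : ∀ k, ‖F k‖ ≤ 1)
    (hF : ∀ n : ℕ, (n : ℂ) * (ewensWeight θ n * F n) =
      θ * ∑ k ∈ Finset.range n, a (n - k) * (ewensWeight θ k * F k)) {n : ℕ} (hn : 0 < n)
    {η E : ℝ} (hE : 0 ≤ E) (hη : ∀ N, n ≤ N → ewensMean θ (fun m => ‖a m - 1‖) N ≤ η)
    (hfar : ∀ N, 2 * n ≤ N → ewensMean θ (fun m => ‖a m - 1‖) N ≤ 2 * θ * (E * n) / N)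
    {M : ℕ} (hM : n ≤ M) :
    ‖F M - F n‖ ≤ (2 + θ) * η + 2 * θ ^ 2 * E := by
  have hn0 : (0 : ℝ) < n := by exact_mod_cast hn
  have hη0 : 0 ≤ η :=
    ((norm_nonneg _).trans (norm_sub_restMean_le hθ hFb hF hn)).trans (hη n le_rfl)
  have near : ∀ i ≤ n, ‖restMean θ F (n + i) - restMean θ F n‖ ≤ i * (θ / n * η) := by
    intro i
    induction i with
    | zero => simp
    | succ i ih =>
      intro hi
      have h1 := ih (by omega)
      have h2 := norm_restMean_succ_sub_le hθ hFb hF (N := n + i) (by omega) (hη (n + i) (by omega))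
      have h3 : θ / (n + i : ℕ) * η ≤ θ / n * η := by
        gcongr; linarith [(Nat.cast_nonneg i : (0 : ℝ) ≤ i)]
      have h4 := norm_sub_le_norm_sub_add_norm_sub (restMean θ F (n + (i + 1)))
        (restMean θ F (n + i)) (restMean θ F n)
      rw [← add_assoc] at h4 ⊢
      push_cast
      linarith
  -- The bound telescopes, as 1/y² ≤ 2 (1/y - 1/(y + 1)) for y ≥ 1; this doubles the constant 2θ²En
  -- to 4θ²En.
  have far : ∀ i, ‖restMean θ F (2 * n + i) - restMean θ F (2 * n)‖ ≤
      4 * θ ^ 2 * E * n * (1 / (2 * n : ℕ) - 1 / (2 * n + i : ℕ)) := by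
    intro i
    induction i with
    | zero => simp
    | succ i ih =>
      have h2 := norm_restMean_succ_sub_le hθ hFb hF (N := 2 * n + i) (by omega)
        (hfar (2 * n + i) (by omega))
      have h4 := norm_sub_le_norm_sub_add_norm_sub (restMean θ F (2 * n + (i + 1)))
        (restMean θ F (2 * n + i)) (restMean θ F (2 * n))
      have h3 : θ / (2 * n + i : ℕ) * (2 * θ * (E * n) / (2 * n + i : ℕ)) ≤
          4 * θ ^ 2 * E * n * (1 / (2 * n + i : ℕ) - 1 / (2 * n + (i + 1) : ℕ)) := by
        have hx : (1 : ℝ) ≤ (2 * n + i : ℕ) := by exact_mod_cast (by omega : 1 ≤ 2 * n + i)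
        have e1 : ((2 * n + (i + 1) : ℕ) : ℝ) = ((2 * n + i : ℕ) : ℝ) + 1 := by push_cast; ring
        rw [e1]
        set x : ℝ := ((2 * n + i : ℕ) : ℝ)
        have e2 : 4 * θ ^ 2 * E * n * (1 / x - 1 / (x + 1)) =
            2 * θ ^ 2 * E * n * (2 / (x * (x + 1))) := by field_simp; ring
        have e3 : θ / x * (2 * θ * (E * n) / x) = 2 * θ ^ 2 * E * n * (1 / x ^ 2) := by
          field_simp
        rw [e2, e3]
        refine mul_le_mul_of_nonneg_left ?_ (by positivity)
        rw [div_le_div_iff₀ (by positivity) (by positivity)]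
        nlinarith
      rw [← add_assoc] at h4 h3 ⊢
      linarith
  have hR : ‖restMean θ F M - restMean θ F n‖ ≤ θ * η + 2 * θ ^ 2 * E := by
    rcases le_total M (2 * n) with h | h
    · obtain ⟨i, rfl⟩ := Nat.exists_eq_add_of_le hM
      have hi : (i : ℝ) ≤ n := by exact_mod_cast (by omega : i ≤ n)
      have h1 := near i (by omega)
      have h2 : (i : ℝ) * (θ / n * η) ≤ n * (θ / n * η) := by gcongr
      have h3 : n * (θ / n * η) = θ * η := by field_simp
      have h4 : 0 ≤ 2 * θ ^ 2 * E := by positivity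
      linarith
    · obtain ⟨i, rfl⟩ := Nat.exists_eq_add_of_le h
      have h1 := near n le_rfl
      rw [← two_mul] at h1
      have h3 : n * (θ / n * η) = θ * η := by field_simp
      have h2 := far i
      have h5 : 4 * θ ^ 2 * E * n * (1 / (2 * n : ℕ) - 1 / (2 * n + i : ℕ)) ≤ 2 * θ ^ 2 * E := by
        have : (1 : ℝ) / (2 * n : ℕ) - 1 / (2 * n + i : ℕ) ≤ 1 / (2 * n : ℕ) := by
          have : (0 : ℝ) ≤ 1 / (2 * n + i : ℕ) := by positivity
          linarith
        calc _ ≤ 4 * θ ^ 2 * E * n * (1 / (2 * n : ℕ)) := by gcongr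
          _ = _ := by push_cast; field_simp; ring
      have h4 := norm_sub_le_norm_sub_add_norm_sub (restMean θ F (2 * n + i))
        (restMean θ F (2 * n)) (restMean θ F n)
      linarith
  have h1 := (norm_sub_restMean_le hθ hFb hF (hn.trans_le hM)).trans (hη M hM)
  have h2 := (norm_sub_restMean_le hθ hFb hF hn).trans (hη n le_rfl)
  rw [norm_sub_rev] at h2
  have h3 := norm_sub_le_norm_sub_add_norm_sub (F M) (restMean θ F M) (F n)
  have h4 := norm_sub_le_norm_sub_add_norm_sub (restMean θ F M) (restMean θ F n) (F n)
  linarith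

end Comparison

/-- Quantitative Poisson approximation of the cycle counts of an Ewens permutation, at the level of
multiplicative functionals. -/
lemma norm_exp_sub_ewensGen_le {θ : ℝ} (hθ : 0 < θ) {a : ℕ → ℂ} (ha : ∀ m, ‖a m‖ ≤ 1) {n j : ℕ}
    (hj : 2 ^ j ≤ n) {E : ℝ} (hE : ∑ i ∈ Finset.range n, ‖a (i + 1) - 1‖ ≤ E * n) :
    ‖Complex.exp (θ * ∑ i ∈ Finset.range n, (a (i + 1) - 1) / (i + 1 : ℕ)) - ewensGen θ a n‖ ≤
      (2 + θ) * (θ * 2 ^ (j + 1) * E + 2 * ((1 + θ / 2) ^ j)⁻¹) + 2 * θ ^ 2 * E := by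
  -- Truncation leaves the value at n unchanged, and it makes the exponent of the generating
  -- function the finite sum up to n that defines the Poisson value.
  set a' : ℕ → ℂ := fun m => if m ≤ n then a m else 1 with ha'
  have hn : 0 < n := lt_of_lt_of_le (by positivity) hj
  have hn0 : (0 : ℝ) < n := by exact_mod_cast hn
  have hE0 : 0 ≤ E := by
    have h1 : 0 ≤ E * n := (Finset.sum_nonneg fun i _ => norm_nonneg (a (i + 1) - 1)).trans hE
    exact nonneg_of_mul_nonneg_left h1 hn0
  have hb : ∀ m, ‖a' m‖ ≤ 1 := by
    intro m; simp only [ha']; split_ifs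
    · exact ha m
    · simp
  have h1 : ∀ m, n < m → a' m = 1 := fun m hm => if_neg (by omega)
  have h1' : ∀ m, n < m → ‖a' m - 1‖ = 0 := fun m hm => by simp [h1 m hm]
  have heq : ∀ i ∈ Finset.range n, a' (i + 1) = a (i + 1) := fun i hi =>
    if_pos (Nat.succ_le_of_lt (Finset.mem_range.1 hi))
  have hE' : ∑ i ∈ Finset.range n, ‖a' (i + 1) - 1‖ ≤ E * n := by
    rw [Finset.sum_congr rfl fun i hi => by rw [heq i hi]]; exact hE
  have hsum : ∑ i ∈ Finset.range n, (a (i + 1) - 1) / (i + 1 : ℕ) =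
      ∑ i ∈ Finset.range n, (a' (i + 1) - 1) / (i + 1 : ℕ) :=
    Finset.sum_congr rfl fun i hi => by rw [heq i hi]
  rw [hsum, ewensGen_congr θ (a := a) (a' := a') (n := n) fun m _ hm => (if_pos hm).symm]
  have hF0 := ewensGen_zero θ a'
  have hF := ewensGen_recursion_range hθ a'
  have hFb := norm_le_one_of_recursion hθ hb hF0 hF
  refine norm_exp_sub_le_of_forall_ge hθ hb h1 hF0 hF (N₀ := n) fun M hM => ?_
  refine norm_sub_le_of_ewensMean_le hθ hFb hF hn hE0 (fun N hN => ?_) (fun N hN => ?_) hM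
  · refine ewensMean_le hθ (fun _ => norm_nonneg _) (fun m => ?_) h1' hj hN hE'
    calc ‖a' m - 1‖ ≤ ‖a' m‖ + ‖(1 : ℂ)‖ := norm_sub_le _ _
      _ ≤ 2 := by rw [norm_one]; linarith [hb m]
  · refine (ewensMean_le_far hθ (fun _ => norm_nonneg _) h1' hn hN).trans ?_
    gcongr

/-- In the quantitative bound, j is fixed first to make the geometric term small; the remaining
terms are then a constant times the average E, which tends to 0. -/
theorem tendsto_exp_sub_ewensGen {θ : ℝ} (hθ : 0 < θ) {a : ℕ → ℕ → ℂ} (ha : ∀ n m, ‖a n m‖ ≤ 1)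
    (h : Tendsto (fun n : ℕ => (∑ i ∈ Finset.range n, ‖a n (i + 1) - 1‖) / n) atTop (𝓝 0)) :
    Tendsto (fun n : ℕ => Complex.exp
      (θ * ∑ i ∈ Finset.range n, (a n (i + 1) - 1) / (i + 1 : ℕ)) - ewensGen θ (a n) n)
      atTop (𝓝 0) := by
  rw [Metric.tendsto_atTop]
  intro ε hε
  have hgeo : Tendsto (fun j : ℕ => (2 + θ) * (2 * ((1 + θ / 2) ^ j)⁻¹)) atTop (𝓝 0) := by
    have h1 := (tendsto_pow_atTop_atTop_of_one_lt (r := 1 + θ / 2) (by linarith)).inv_tendsto_atTop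
    simpa using (h1.const_mul 2).const_mul (2 + θ)
  obtain ⟨j, hj⟩ := (hgeo.eventually (gt_mem_nhds (half_pos hε))).exists
  have hlin : Tendsto (fun n : ℕ => ((2 + θ) * (θ * 2 ^ (j + 1)) + 2 * θ ^ 2) *
      ((∑ i ∈ Finset.range n, ‖a n (i + 1) - 1‖) / n)) atTop (𝓝 0) := by
    simpa using h.const_mul ((2 + θ) * (θ * 2 ^ (j + 1)) + 2 * θ ^ 2)
  obtain ⟨N, hN⟩ := eventually_atTop.1 (hlin.eventually (gt_mem_nhds (half_pos hε)))
  refine ⟨max N (2 ^ j), fun n hn => ?_⟩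
  have h1 := hN n ((le_max_left _ _).trans hn)
  have hjn : 2 ^ j ≤ n := (le_max_right _ _).trans hn
  have hn0 : (0 : ℝ) < n := by exact_mod_cast lt_of_lt_of_le (by positivity) hjn
  have h2 := norm_exp_sub_ewensGen_le hθ (ha n) hjn
    (E := (∑ i ∈ Finset.range n, ‖a n (i + 1) - 1‖) / n) (by rw [div_mul_cancel₀ _ hn0.ne'])
  rw [dist_zero_right]
  nlinarith

/-! ### Functions with weak singularities at the end points -/

/-- Distance to the end points of the unit interval. -/
def edgeDist (t : ℝ) : ℝ := min t (1 - t)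

lemma edgeDist_pos {t : ℝ} (ht : t ∈ Set.Ioo (0 : ℝ) 1) : 0 < edgeDist t :=
  lt_min ht.1 (by linarith [ht.2])

lemma edgeDist_le_one (t : ℝ) : edgeDist t ≤ 1 := by
  rcases le_total t 1 with h | h
  · exact (min_le_left _ _).trans h
  · exact (min_le_right _ _).trans (by linarith)

lemma edgeDist_le_of_mem_Icc {s t u δ : ℝ} (hs : δ ≤ edgeDist s) (ht : δ ≤ edgeDist t)
    (hu : u ∈ Set.Icc s t) : δ ≤ edgeDist u := by
  unfold edgeDist at *
  have h1 := hs.trans (min_le_left _ _)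
  have h2 := ht.trans (min_le_right _ _)
  exact le_min (h1.trans hu.1) (h2.trans (by linarith [hu.2]))

/-- A function on the unit interval whose singularities at the end points are at most those of
`d ^ (-β)`, where `d` is the distance to the end points, together with its Lipschitz constants. -/
structure EdgeSingular (β A : ℝ) (f : ℝ → ℝ) : Prop where
  nonneg : 0 ≤ A
  bound : ∀ t ∈ Set.Ioo (0 : ℝ) 1, |f t| ≤ A * edgeDist t ^ (-β)
  lip : ∀ s ∈ Set.Ioo (0 : ℝ) 1, ∀ t ∈ Set.Ioo (0 : ℝ) 1, ∀ δ : ℝ, 0 < δ → δ ≤ edgeDist s →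
    δ ≤ edgeDist t → |f s - f t| ≤ A * |s - t| * δ ^ (-1 - β)

namespace EdgeSingular

variable {β γ A B : ℝ} {f g : ℝ → ℝ}

/-- The Lipschitz bound is the product rule for differences; its two terms account for the factor 2.
-/
lemma mul (hf : EdgeSingular β A f) (hg : EdgeSingular γ B g) (hβ : 0 ≤ β) (hγ : 0 ≤ γ) :
    EdgeSingular (β + γ) (2 * A * B) (fun t => f t * g t) where
  nonneg := by have := hf.nonneg; have := hg.nonneg; positivity
  bound t ht := by
    have hd := edgeDist_pos ht
    have h1 := hf.bound t ht
    have h2 := hg.bound t ht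
    have hA := hf.nonneg
    have hB := hg.nonneg
    rw [abs_mul, neg_add, Real.rpow_add hd]
    have h3 : 0 ≤ edgeDist t ^ (-β) := Real.rpow_nonneg hd.le _
    have h4 : 0 ≤ edgeDist t ^ (-γ) := Real.rpow_nonneg hd.le _
    calc |f t| * |g t| ≤ (A * edgeDist t ^ (-β)) * (B * edgeDist t ^ (-γ)) := by gcongr
      _ = 1 * (A * B * (edgeDist t ^ (-β) * edgeDist t ^ (-γ))) := by ring
      _ ≤ 2 * (A * B * (edgeDist t ^ (-β) * edgeDist t ^ (-γ))) := by gcongr; norm_num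
      _ = _ := by ring
  lip s hs t ht δ hδ hδs hδt := by
    have hA := hf.nonneg
    have hB := hg.nonneg
    have h1 : |f s| ≤ A * δ ^ (-β) := (hf.bound s hs).trans <| by
      gcongr 1; exact Real.rpow_le_rpow_of_nonpos hδ hδs (by linarith)
    have h2 : |g t| ≤ B * δ ^ (-γ) := (hg.bound t ht).trans <| by
      gcongr 1; exact Real.rpow_le_rpow_of_nonpos hδ hδt (by linarith)
    have h3 := hf.lip s hs t ht δ hδ hδs hδt
    have h4 := hg.lip s hs t ht δ hδ hδs hδt
    have e1 : δ ^ (-1 - (β + γ)) = δ ^ (-β) * δ ^ (-1 - γ) := by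
      rw [← Real.rpow_add hδ]; congr 1; ring
    have e2 : δ ^ (-1 - (β + γ)) = δ ^ (-γ) * δ ^ (-1 - β) := by
      rw [← Real.rpow_add hδ]; congr 1; ring
    have p1 : 0 ≤ δ ^ (-β) := Real.rpow_nonneg hδ.le _
    have p2 : 0 ≤ δ ^ (-γ) := Real.rpow_nonneg hδ.le _
    calc |f s * g s - f t * g t| = |f s * (g s - g t) + (f s - f t) * g t| := by ring_nf
      _ ≤ |f s| * |g s - g t| + |f s - f t| * |g t| := by
        rw [← abs_mul, ← abs_mul]; exact abs_add_le _ _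
      _ ≤ (A * δ ^ (-β)) * (B * |s - t| * δ ^ (-1 - γ)) +
          (A * |s - t| * δ ^ (-1 - β)) * (B * δ ^ (-γ)) := by gcongr
      _ = A * B * |s - t| * (δ ^ (-β) * δ ^ (-1 - γ)) +
          A * B * |s - t| * (δ ^ (-γ) * δ ^ (-1 - β)) := by ring
      _ = _ := by rw [← e1, ← e2]; ring

lemma abs (hf : EdgeSingular β A f) : EdgeSingular β A (fun t => |f t|) where
  nonneg := hf.nonneg
  bound t ht := by rw [abs_abs]; exact hf.bound t ht
  lip s hs t ht δ hδ hδs hδt := (abs_abs_sub_abs_le _ _).trans (hf.lip s hs t ht δ hδ hδs hδt)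

lemma abs_le_add (hf : EdgeSingular β A f) {t : ℝ} (ht : t ∈ Set.Ioo (0 : ℝ) 1) :
    |f t| ≤ A * (t ^ (-β) + (1 - t) ^ (-β)) := by
  refine (hf.bound t ht).trans ?_
  have h1 : 0 ≤ t ^ (-β) := Real.rpow_nonneg ht.1.le _
  have h2 : 0 ≤ (1 - t) ^ (-β) := Real.rpow_nonneg (by linarith [ht.2]) _
  refine mul_le_mul_of_nonneg_left ?_ hf.nonneg
  unfold edgeDist
  rcases min_choice t (1 - t) with h | h <;> rw [h] <;> linarith

lemma intervalIntegrable_weight (hβ1 : β < 1) :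
    IntervalIntegrable (fun t : ℝ => t ^ (-β) + (1 - t) ^ (-β)) volume 0 1 := by
  have h1 : IntervalIntegrable (fun t : ℝ => t ^ (-β)) volume 0 1 :=
    intervalIntegral.intervalIntegrable_rpow' (by linarith)
  have h2 := h1.comp_sub_left 1
  rw [sub_zero, sub_self] at h2
  exact h1.add h2.symm

lemma intervalIntegrable (hf : EdgeSingular β A f) (hm : Measurable f) (hβ1 : β < 1) :
    IntervalIntegrable f volume 0 1 := by
  refine ((intervalIntegrable_weight hβ1).const_mul A).mono_fun hm.aestronglyMeasurable ?_
  rw [Set.uIoc_of_le zero_le_one, ← restrict_Ioo_eq_restrict_Ioc]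
  filter_upwards [ae_restrict_mem measurableSet_Ioo] with t ht
  rw [Real.norm_eq_abs]
  exact (hf.abs_le_add ht).trans (le_abs_self _)

end EdgeSingular

/-! ### The logarithm on the unit circle and its moments -/

/-- The real part of `log (1 - w)`. -/
def reLog (w : Circle) : ℝ := (Complex.log (1 - w)).re

/-- The imaginary part of `log (1 - w)`. -/
def imLog (w : Circle) : ℝ := (Complex.log (1 - w)).im

lemma measurable_reLog : Measurable reLog := by
  have : Measurable fun w : Circle => (w : ℂ) := (by fun_prop : Continuous fun w : Circle => (w : ℂ)).measurable
  unfold reLog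
  fun_prop

lemma measurable_imLog : Measurable imLog := by
  have : Measurable fun w : Circle => (w : ℂ) := (by fun_prop : Continuous fun w : Circle => (w : ℂ)).measurable
  unfold imLog
  fun_prop

lemma continuous_circlePoint : Continuous circlePoint := by
  unfold circlePoint; fun_prop

lemma coe_circlePoint (t : ℝ) : (circlePoint t : ℂ) = Complex.exp (2 * Real.pi * t * Complex.I) := by
  unfold circlePoint
  rw [Circle.coe_exp]; push_cast; rfl

lemma circlePoint_add (s t : ℝ) : circlePoint (s + t) = circlePoint s * circlePoint t := by
  unfold circlePoint
  rw [mul_add, Circle.exp_add]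

lemma circlePoint_intCast (k : ℤ) : circlePoint k = 1 := by
  unfold circlePoint
  rw [mul_comm]
  exact Circle.exp_int_mul_two_pi k

lemma circlePoint_add_int (t : ℝ) (k : ℤ) : circlePoint (t + k) = circlePoint t := by
  rw [circlePoint_add, circlePoint_intCast, mul_one]

/-- Here 1 - e^{2πit} = 2 sin(πt) · e^{iπ(t - 1/2)}, with positive modulus and an argument in (-π/2,
π/2), hence the principal one. -/
lemma log_one_sub_circlePoint {t : ℝ} (ht : t ∈ Set.Ioo (0 : ℝ) 1) :
    Complex.log (1 - circlePoint t) =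
      (Real.log (2 * Real.sin (Real.pi * t)) : ℂ) + (Real.pi * (t - 1 / 2) : ℝ) * Complex.I := by
  have hpi := Real.pi_pos
  have hs : 0 < Real.sin (Real.pi * t) :=
    Real.sin_pos_of_pos_of_lt_pi (mul_pos hpi ht.1) (by nlinarith [ht.2])
  have h1 : (1 : ℂ) - circlePoint t = ((2 * Real.sin (Real.pi * t) : ℝ) : ℂ) *
      Complex.exp ((Real.pi * (t - 1 / 2) : ℝ) * Complex.I) := by
    rw [coe_circlePoint]
    have e1 : Complex.exp ((Real.pi * (t - 1 / 2) : ℝ) * Complex.I) =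
        Complex.exp (Real.pi * t * Complex.I) * (-Complex.I) := by
      rw [← Complex.exp_neg_pi_div_two_mul_I, ← Complex.exp_add]
      congr 1; push_cast; ring
    have e2 : Complex.exp (2 * Real.pi * t * Complex.I) =
        Complex.exp (Real.pi * t * Complex.I) * Complex.exp (Real.pi * t * Complex.I) := by
      rw [← Complex.exp_add]; congr 1; ring
    have e3 : Complex.exp (Real.pi * t * Complex.I) * Complex.exp (-(Real.pi * t) * Complex.I) = 1 := by
      rw [← Complex.exp_add]; simp
    rw [e1, e2]
    push_cast
    rw [Complex.sin]
    have hI := Complex.I_mul_I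
    linear_combination (-(1 : ℂ)) * e3 + (Complex.exp (Real.pi * t * Complex.I) *
      (Complex.exp (-(Real.pi * t) * Complex.I) - Complex.exp (Real.pi * t * Complex.I))) * hI
  rw [h1, Complex.log_ofReal_mul (by positivity) (Complex.exp_ne_zero _), Complex.log_exp]
  · rw [Complex.im_ofReal_mul, Complex.I_im, mul_one]; nlinarith [ht.1]
  · rw [Complex.im_ofReal_mul, Complex.I_im, mul_one]; nlinarith [ht.2]

lemma reLog_circlePoint {t : ℝ} (ht : t ∈ Set.Ioo (0 : ℝ) 1) :
    reLog (circlePoint t) = Real.log (2 * Real.sin (Real.pi * t)) := by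
  rw [reLog, log_one_sub_circlePoint ht]; simp

lemma imLog_circlePoint {t : ℝ} (ht : t ∈ Set.Ioo (0 : ℝ) 1) :
    imLog (circlePoint t) = Real.pi * (t - 1 / 2) := by
  rw [imLog, log_one_sub_circlePoint ht]; simp

lemma two_mul_edgeDist_le_sin {t : ℝ} (ht : t ∈ Set.Ioo (0 : ℝ) 1) :
    2 * edgeDist t ≤ Real.sin (Real.pi * t) := by
  have hpi := Real.pi_pos
  unfold edgeDist
  rcases le_total t (1 / 2) with h | h
  · have := Real.mul_le_sin (x := Real.pi * t) (by nlinarith [ht.1]) (by nlinarith)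
    have e : 2 / Real.pi * (Real.pi * t) = 2 * t := by field_simp
    rw [e] at this
    exact le_trans (by gcongr; exact min_le_left _ _) this
  · have := Real.mul_le_sin (x := Real.pi * (1 - t)) (by nlinarith [ht.2]) (by nlinarith)
    have e : 2 / Real.pi * (Real.pi * (1 - t)) = 2 * (1 - t) := by field_simp
    rw [e, show Real.pi * (1 - t) = Real.pi - Real.pi * t by ring, Real.sin_pi_sub] at this
    exact le_trans (by gcongr; exact min_le_right _ _) this

lemma one_le_edgeDist_rpow {t e : ℝ} (ht : t ∈ Set.Ioo (0 : ℝ) 1) (he : 0 ≤ e) :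
    1 ≤ edgeDist t ^ (-e) :=
  Real.one_le_rpow_of_pos_of_le_one_of_nonpos (edgeDist_pos ht) (edgeDist_le_one t) (by linarith)

lemma edgeSingular_imLog {β : ℝ} (hβ : 0 ≤ β) :
    EdgeSingular β Real.pi (fun t => imLog (circlePoint t)) where
  nonneg := Real.pi_pos.le
  bound t ht := by
    have hpi := Real.pi_pos
    rw [imLog_circlePoint ht, abs_mul, abs_of_pos hpi]
    have h1 : |t - 1 / 2| ≤ 1 := abs_le.2 ⟨by linarith [ht.1], by linarith [ht.2]⟩
    have h2 := one_le_edgeDist_rpow ht hβ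
    gcongr
    exact h1.trans h2
  lip s hs t ht δ hδ hδs hδt := by
    have hpi := Real.pi_pos
    rw [imLog_circlePoint ht, imLog_circlePoint hs, ← mul_sub, abs_mul, abs_of_pos hpi]
    have h2 : 1 ≤ δ ^ (-1 - β) :=
      Real.one_le_rpow_of_pos_of_le_one_of_nonpos hδ (hδs.trans (edgeDist_le_one s)) (by linarith)
    have e : s - 1 / 2 - (t - 1 / 2) = s - t := by ring
    rw [e]
    exact le_mul_of_one_le_right (by positivity) h2

/-- The size bound is |log d| ≤ d^(-β)/β applied to d ≤ sin(πt). For the Lipschitz bound, the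
derivative π cot(πu) is at most 2/δ in absolute value at distance δ from the ends, since sin(πu) ≥
2δ and π ≤ 4. -/
lemma edgeSingular_reLog {β : ℝ} (hβ : 0 < β) (hβ1 : β ≤ 1) :
    EdgeSingular β (2 / β) (fun t => reLog (circlePoint t)) where
  nonneg := by positivity
  bound t ht := by
    have hd := edgeDist_pos ht
    have hs := two_mul_edgeDist_le_sin ht
    have hs0 : 0 < Real.sin (Real.pi * t) := by linarith
    have h1 := one_le_edgeDist_rpow ht hβ.le
    have hβi : 1 ≤ 1 / β := by rw [le_div_iff₀ hβ]; linarith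
    rw [reLog_circlePoint ht]
    have e : 2 / β * edgeDist t ^ (-β) = 2 * (1 / β * edgeDist t ^ (-β)) := by ring
    have h0 : 1 ≤ 1 / β * edgeDist t ^ (-β) := by nlinarith
    rw [e, abs_le]
    constructor
    · have h2 : Real.log (edgeDist t) ≤ Real.log (2 * Real.sin (Real.pi * t)) :=
        Real.log_le_log hd (by linarith)
      have h3 := Real.log_le_rpow_div (x := (edgeDist t)⁻¹) (by positivity) hβ
      rw [Real.log_inv, Real.inv_rpow hd.le, ← Real.rpow_neg hd.le] at h3
      have : edgeDist t ^ (-β) / β = 1 / β * edgeDist t ^ (-β) := by ring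
      linarith
    · have h2 : Real.log (2 * Real.sin (Real.pi * t)) ≤ Real.log 2 :=
        Real.log_le_log (by positivity) (by linarith [Real.sin_le_one (Real.pi * t)])
      have h3 : Real.log 2 ≤ 1 := by linarith [Real.log_two_lt_d9]
      linarith
  lip s hs t ht δ hδ hδs hδt := by
    wlog hst : s ≤ t generalizing s t
    · rw [abs_sub_comm, abs_sub_comm s t]
      exact this t ht s hs hδt hδs (le_of_not_ge hst)
    have hpi := Real.pi_pos
    rw [reLog_circlePoint ht, reLog_circlePoint hs, abs_sub_comm, abs_sub_comm s t]
    have hmem : ∀ u ∈ Set.Icc s t, u ∈ Set.Ioo (0 : ℝ) 1 := fun u hu =>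
      ⟨hs.1.trans_le hu.1, hu.2.trans_lt ht.2⟩
    have hsin : ∀ u ∈ Set.Icc s t, 2 * δ ≤ Real.sin (Real.pi * u) := fun u hu => by
      have h1 := edgeDist_le_of_mem_Icc hδs hδt hu
      have h2 := two_mul_edgeDist_le_sin (hmem u hu)
      linarith
    have key := (convex_Icc s t).norm_image_sub_le_of_norm_hasDerivWithin_le
      (f := fun u => Real.log (2 * Real.sin (Real.pi * u)))
      (f' := fun u => (2 * (Real.cos (Real.pi * u) * Real.pi)) / (2 * Real.sin (Real.pi * u)))
      (C := 2 * δ⁻¹) (fun u hu => ?_) (fun u hu => ?_)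
      (Set.left_mem_Icc.2 hst) (Set.right_mem_Icc.2 hst)
    · rw [Real.norm_eq_abs, Real.norm_eq_abs] at key
      refine key.trans ?_
      have h1 : δ⁻¹ ≤ δ ^ (-1 - β) := by
        rw [← Real.rpow_neg_one]
        exact Real.rpow_le_rpow_of_exponent_ge hδ (hδs.trans (edgeDist_le_one s)) (by linarith)
      have h2 : 2 ≤ 2 / β := by rw [le_div_iff₀ hβ]; linarith
      calc 2 * δ⁻¹ * |t - s| ≤ 2 / β * δ ^ (-1 - β) * |t - s| := by gcongr
        _ = _ := by ring
    · have h1 := hsin u hu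
      have h2 : (0 : ℝ) < Real.sin (Real.pi * u) := by linarith
      have h3 : HasDerivAt (fun u : ℝ => 2 * Real.sin (Real.pi * u))
          (2 * (Real.cos (Real.pi * u) * Real.pi)) u := by
        have := (((hasDerivAt_id u).const_mul Real.pi).sin).const_mul 2
        simpa using this
      exact (h3.log (by positivity)).hasDerivWithinAt
    · have h1 := hsin u hu
      have h2 : (0 : ℝ) < Real.sin (Real.pi * u) := by linarith
      rw [Real.norm_eq_abs, abs_div, abs_mul, abs_mul, abs_of_pos hpi, abs_of_pos (two_pos),
        abs_of_pos (show 0 < 2 * Real.sin (Real.pi * u) by positivity), div_le_iff₀ (by positivity)]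
      have h3 := Real.abs_cos_le_one (Real.pi * u)
      have h4 : Real.pi ≤ 4 := Real.pi_le_four
      calc 2 * (|Real.cos (Real.pi * u)| * Real.pi) ≤ 2 * (1 * 4) := by gcongr
        _ = 2 * δ⁻¹ * (2 * (2 * δ)) := by field_simp; norm_num
        _ ≤ _ := by gcongr

lemma measurable_reLog_circlePoint : Measurable fun t => reLog (circlePoint t) :=
  measurable_reLog.comp continuous_circlePoint.measurable

lemma measurable_imLog_circlePoint : Measurable fun t => imLog (circlePoint t) :=
  measurable_imLog.comp continuous_circlePoint.measurable

lemma integral_imLog : ∫ t in (0 : ℝ)..1, imLog (circlePoint t) = 0 := by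
  rw [intervalIntegral.integral_congr_Ioo_of_le (g := fun t => Real.pi * (t - 1 / 2)) zero_le_one
    fun t ht => imLog_circlePoint ht, intervalIntegral.integral_const_mul,
    intervalIntegral.integral_sub (by simp) (by simp), integral_id]
  norm_num

lemma integral_imLog_sq :
    ∫ t in (0 : ℝ)..1, imLog (circlePoint t) * imLog (circlePoint t) = Real.pi ^ 2 / 12 := by
  rw [intervalIntegral.integral_congr_Ioo_of_le
    (g := fun t => Real.pi ^ 2 * (t - 1 / 2) ^ 2) zero_le_one fun t ht => by
      simp only [imLog_circlePoint ht]; ring,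
    intervalIntegral.integral_const_mul,
    intervalIntegral.integral_comp_sub_right (fun t => t ^ 2), integral_pow]
  norm_num
  ring

lemma integral_reLog : ∫ t in (0 : ℝ)..1, reLog (circlePoint t) = 0 := by
  have hpi := Real.pi_pos
  have hi : IntervalIntegrable (fun t => Real.log (Real.sin (Real.pi * t))) volume 0 1 := by
    have := (intervalIntegrable_log_sin (a := 0) (b := Real.pi)).comp_mul_left (c := Real.pi)
    simpa [hpi.ne'] using this
  rw [intervalIntegral.integral_congr_Ioo_of_le
    (g := fun t => Real.log 2 + Real.log (Real.sin (Real.pi * t))) zero_le_one fun t ht => by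
      have hs : 0 < Real.sin (Real.pi * t) :=
        Real.sin_pos_of_pos_of_lt_pi (mul_pos hpi ht.1) (by nlinarith [ht.2])
      simp only [reLog_circlePoint ht]
      rw [Real.log_mul two_ne_zero hs.ne'],
    intervalIntegral.integral_add (by simp) hi,
    intervalIntegral.integral_comp_mul_left (fun t => Real.log (Real.sin t)) hpi.ne',
    mul_zero, mul_one, integral_log_sin_zero_pi]
  simp
  field_simp
  ring

lemma norm_one_sub_le_two_mul {r : ℝ} (h1 : r ≤ 1) (w : Circle) :
    ‖(1 : ℂ) - w‖ ≤ 2 * ‖(1 : ℂ) - r * w‖ ∨ r < 0 := by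
  by_cases h0 : r < 0
  · exact Or.inr h0
  left
  have hw : ‖(w : ℂ)‖ = 1 := Circle.norm_coe w
  have e1 : ‖(1 : ℂ) - w‖ ≤ ‖(1 : ℂ) - r * w‖ + (1 - r) := by
    have : (1 : ℂ) - w = (1 - r * w) - ((1 - r : ℝ) : ℂ) * w := by push_cast; ring
    rw [this]
    refine (norm_sub_le _ _).trans ?_
    rw [norm_mul, hw, Complex.norm_real, Real.norm_of_nonneg (by linarith), mul_one]
  have e2 : 1 - r ≤ ‖(1 : ℂ) - r * w‖ := by
    have := norm_sub_norm_le (1 : ℂ) (r * w)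
    rw [norm_mul, hw, Complex.norm_real, Real.norm_of_nonneg (not_lt.1 h0), norm_one, mul_one] at this
    exact this
  linarith

/-- A bound uniform in r, to dominate the limit r → 1. It holds as |1 - w| ≤ 2|1 - rw| and |1 - rw|
≤ 2, so the logarithms of the moduli are comparable up to log 2; the argument costs at most π. -/
lemma norm_log_one_sub_mul_le {r : ℝ} (h0 : 0 ≤ r) (h1 : r ≤ 1) {w : Circle} (hw1 : w ≠ 1) :
    ‖Complex.log (1 - r * w)‖ ≤ |reLog w| + 5 := by
  have hw : ‖(w : ℂ)‖ = 1 := Circle.norm_coe w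
  have hne : (1 : ℂ) - w ≠ 0 := by
    rw [sub_ne_zero]; intro h; exact hw1 (Circle.ext h.symm)
  have hpos : 0 < ‖(1 : ℂ) - w‖ := norm_pos_iff.2 hne
  have h2 : ‖(1 : ℂ) - w‖ ≤ 2 * ‖(1 : ℂ) - r * w‖ :=
    (norm_one_sub_le_two_mul h1 w).resolve_right (not_lt.2 h0)
  have h3 : ‖(1 : ℂ) - r * w‖ ≤ 2 := by
    refine (norm_sub_le _ _).trans ?_
    rw [norm_mul, hw, Complex.norm_real, Real.norm_of_nonneg h0, norm_one]; linarith
  have hpos' : 0 < ‖(1 : ℂ) - r * w‖ := by linarith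
  have hlog2 : Real.log 2 ≤ 1 := by linarith [Real.log_two_lt_d9]
  have hre : reLog w = Real.log ‖(1 : ℂ) - w‖ := by rw [reLog, Complex.log_re]
  have h4 : |Real.log ‖(1 : ℂ) - r * w‖| ≤ |reLog w| + 1 := by
    rw [hre, abs_le]
    constructor
    · have h5 := Real.log_le_log hpos h2
      rw [Real.log_mul two_ne_zero hpos'.ne'] at h5
      have := neg_abs_le (Real.log ‖(1 : ℂ) - w‖)
      linarith
    · have h5 := Real.log_le_log hpos' h3
      have := abs_nonneg (Real.log ‖(1 : ℂ) - w‖)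
      linarith
  refine (Complex.norm_le_abs_re_add_abs_im _).trans ?_
  rw [Complex.log_re, Complex.log_im]
  have h6 := Complex.abs_arg_le_pi (1 - r * w)
  linarith [Real.pi_le_four]

/-- Mean value property: log(1 - z)² is holomorphic near the closed disc of radius r < 1 and
vanishes at 0. -/
lemma integral_log_one_sub_mul_sq {r : ℝ} (h0 : 0 ≤ r) (h1 : r < 1) :
    ∫ t in (0 : ℝ)..1, Complex.log (1 - r * circlePoint t) ^ 2 = 0 := by
  have hball : ∀ z ∈ Metric.closedBall (0 : ℂ) |r|, 1 - z ∈ Complex.slitPlane := by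
    intro z hz
    rw [mem_closedBall_zero_iff, abs_of_nonneg h0] at hz
    left
    have := (Complex.re_le_norm z)
    rw [Complex.sub_re, Complex.one_re]; linarith
  have hd : DifferentiableOn ℂ (fun z : ℂ => Complex.log (1 - z) ^ 2)
      (Metric.closedBall (0 : ℂ) |r|) := fun z hz =>
    (((differentiableAt_const 1).sub differentiableAt_id).clog (hball z hz)
      |>.pow 2).differentiableWithinAt
  have hc := circleAverage_of_differentiable_on_off_countable (R := r) Set.countable_empty
    hd.continuousOn (fun z hz => by
      refine (((differentiableAt_const 1).sub differentiableAt_id).clog (hball z ?_) |>.pow 2)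
      exact Metric.ball_subset_closedBall hz.1)
  rw [Real.circleAverage_def] at hc
  simp only [sub_zero, Complex.log_one] at hc
  have e : ∫ t in (0 : ℝ)..1, Complex.log (1 - r * circlePoint t) ^ 2 =
      ∫ t in (0 : ℝ)..1, (fun θ : ℝ => Complex.log (1 - circleMap 0 r θ) ^ 2) (2 * Real.pi * t) := by
    refine intervalIntegral.integral_congr fun t _ => ?_
    simp only [coe_circlePoint, circleMap, zero_add]
    push_cast
    rfl
  rw [e, intervalIntegral.integral_comp_mul_left
    (fun θ : ℝ => Complex.log (1 - circleMap 0 r θ) ^ 2) Real.two_pi_pos.ne', mul_zero, mul_one, hc]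
  simp

lemma circlePoint_ne_one {t : ℝ} (ht : t ∈ Set.Ioo (0 : ℝ) 1) : circlePoint t ≠ 1 := by
  intro h
  have h1 := log_one_sub_circlePoint ht
  have hs := two_mul_edgeDist_le_sin ht
  have hd := edgeDist_pos ht
  have hp : Complex.exp (2 * Real.pi * t * Complex.I) = 1 := by
    rw [← coe_circlePoint, h]; rfl
  rw [Complex.exp_eq_one_iff] at hp
  obtain ⟨n, hn⟩ := hp
  have h2 : (t : ℂ) = n := by
    have : (2 * Real.pi * Complex.I : ℂ) ≠ 0 := Complex.two_pi_I_ne_zero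
    have e : (2 * Real.pi * Complex.I : ℂ) * t = (2 * Real.pi * Complex.I) * n := by
      linear_combination hn
    exact mul_left_cancel₀ this e
  have h3 : t = (n : ℝ) := by exact_mod_cast h2
  have h4 : (0 : ℝ) < n := h3 ▸ ht.1
  have h5 : (n : ℝ) < 1 := h3 ▸ ht.2
  have h6 : 0 < n := by exact_mod_cast h4
  have h7 : n < 1 := by exact_mod_cast h5
  omega

lemma edgeSingular_reLog_mul_self :
    EdgeSingular (1 / 4 + 1 / 4) (2 * (2 / (1 / 4)) * (2 / (1 / 4)))
      (fun t => reLog (circlePoint t) * reLog (circlePoint t)) :=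
  (edgeSingular_reLog (by norm_num) (by norm_num)).mul
    (edgeSingular_reLog (by norm_num) (by norm_num)) (by norm_num) (by norm_num)

lemma integral_log_one_sub_sq :
    ∫ t in (0 : ℝ)..1, Complex.log (1 - circlePoint t) ^ 2 = 0 := by
  have hm : Measurable fun t => (circlePoint t : ℂ) :=
    (by have := continuous_circlePoint; fun_prop : Continuous fun t => (circlePoint t : ℂ)).measurable
  have hlim : Tendsto (fun k : ℕ => ∫ t in (0 : ℝ)..1,
      Complex.log (1 - ((1 - 1 / ((k : ℝ) + 1) : ℝ) : ℂ) * circlePoint t) ^ 2) atTop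
      (𝓝 (∫ t in (0 : ℝ)..1, Complex.log (1 - circlePoint t) ^ 2)) := by
    have hr : ∀ k : ℕ, 0 ≤ 1 - 1 / ((k : ℝ) + 1) ∧ 1 - 1 / ((k : ℝ) + 1) ≤ 1 := by
      intro k
      have h1 : 1 / ((k : ℝ) + 1) ≤ 1 := by
        rw [div_le_one (by positivity)]; linarith [(Nat.cast_nonneg k : (0 : ℝ) ≤ k)]
      have h2 : 0 ≤ 1 / ((k : ℝ) + 1) := by positivity
      constructor <;> linarith
    have hae : ∀ᵐ t ∂(volume : Measure ℝ), t ∈ Set.uIoc (0 : ℝ) 1 → t ∈ Set.Ioo (0 : ℝ) 1 := by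
      filter_upwards [Measure.ae_ne volume (1 : ℝ)] with t h1 ht
      rw [Set.uIoc_of_le zero_le_one] at ht
      exact ⟨ht.1, lt_of_le_of_ne ht.2 h1⟩
    refine intervalIntegral.tendsto_integral_filter_of_dominated_convergence
      (fun t => (|reLog (circlePoint t)| + 5) ^ 2) ?_ ?_ ?_ ?_
    · refine Eventually.of_forall fun k => Measurable.aestronglyMeasurable ?_
      fun_prop
    · refine Eventually.of_forall fun k => ?_
      filter_upwards [hae] with t h ht
      rw [norm_pow]
      gcongr
      exact norm_log_one_sub_mul_le (hr k).1 (hr k).2 (circlePoint_ne_one (h ht))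
    · have e : (fun t => (|reLog (circlePoint t)| + 5) ^ 2) = fun t =>
          reLog (circlePoint t) * reLog (circlePoint t) + 10 * |reLog (circlePoint t)| + 25 := by
        ext t
        have := abs_mul_abs_self (reLog (circlePoint t))
        linear_combination this
      rw [e]
      have h1 := edgeSingular_reLog_mul_self.intervalIntegrable
        (measurable_reLog_circlePoint.mul measurable_reLog_circlePoint) (by norm_num)
      have h2 := (edgeSingular_reLog (β := 1 / 4) (by norm_num) (by norm_num)).intervalIntegrable
        measurable_reLog_circlePoint (by norm_num)
      exact (h1.add (h2.abs.const_mul 10)).add (by simp)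
    · filter_upwards [hae] with t h ht
      have h01 := h ht
      have hsl : (1 : ℂ) - circlePoint t ∈ Complex.slitPlane := by
        rw [Complex.mem_slitPlane_iff_arg]
        constructor
        · have hl := imLog_circlePoint h01
          rw [imLog, Complex.log_im] at hl
          rw [hl]
          have := Real.pi_pos
          nlinarith [h01.2]
        · rw [sub_ne_zero]
          intro hh; exact circlePoint_ne_one h01 (Circle.ext hh.symm)
      have hr1 : Tendsto (fun k : ℕ => ((1 - 1 / ((k : ℝ) + 1) : ℝ) : ℂ)) atTop (𝓝 1) := by
        have := (tendsto_one_div_add_atTop_nhds_zero_nat (𝕜 := ℝ)).const_sub 1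
        rw [sub_zero] at this
        exact_mod_cast (Complex.continuous_ofReal.tendsto 1).comp this
      have h2 : Tendsto (fun k : ℕ => (1 : ℂ) - ((1 - 1 / ((k : ℝ) + 1) : ℝ) : ℂ) * circlePoint t)
          atTop (𝓝 (1 - 1 * circlePoint t)) := (hr1.mul_const _).const_sub 1
      rw [one_mul] at h2
      exact (h2.clog hsl).pow 2
  have hzero : ∀ k : ℕ, ∫ t in (0 : ℝ)..1,
      Complex.log (1 - ((1 - 1 / ((k : ℝ) + 1) : ℝ) : ℂ) * circlePoint t) ^ 2 = 0 := by
    intro k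
    have h2 : 0 < 1 / ((k : ℝ) + 1) := by positivity
    have h1 : 1 / ((k : ℝ) + 1) ≤ 1 := by
      rw [div_le_one (by positivity)]; linarith [(Nat.cast_nonneg k : (0 : ℝ) ≤ k)]
    exact integral_log_one_sub_mul_sq (by linarith) (by linarith)
  simp only [hzero] at hlim
  exact (tendsto_nhds_unique hlim tendsto_const_nhds)

/-- The real part of ∫ log(1 - w)² = 0 says that the squares of the real and of the imaginary part
have the same integral, and the latter is elementary. -/
lemma integral_reLog_sq :
    ∫ t in (0 : ℝ)..1, reLog (circlePoint t) * reLog (circlePoint t) = Real.pi ^ 2 / 12 := by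
  have h0 := integral_log_one_sub_sq
  have hre := edgeSingular_reLog_mul_self.intervalIntegrable
    (measurable_reLog_circlePoint.mul measurable_reLog_circlePoint) (by norm_num)
  have him : IntervalIntegrable (fun t => imLog (circlePoint t) * imLog (circlePoint t)) volume 0 1 :=
    ((edgeSingular_imLog (β := 0) le_rfl).mul (edgeSingular_imLog (β := 0) le_rfl) le_rfl
      le_rfl).intervalIntegrable
      (measurable_imLog_circlePoint.mul measurable_imLog_circlePoint) (by norm_num)
  have hmix : IntervalIntegrable (fun t => reLog (circlePoint t) * imLog (circlePoint t)) volume 0 1 :=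
    ((edgeSingular_reLog (β := 1 / 4) (by norm_num) (by norm_num)).mul
      (edgeSingular_imLog (β := 0) le_rfl) (by norm_num) le_rfl).intervalIntegrable
      (measurable_reLog_circlePoint.mul measurable_imLog_circlePoint) (by norm_num)
  have e : ∀ t, Complex.log (1 - circlePoint t) ^ 2 =
      ((reLog (circlePoint t) * reLog (circlePoint t) - imLog (circlePoint t) * imLog (circlePoint t) :
        ℝ) : ℂ) + ((2 * (reLog (circlePoint t) * imLog (circlePoint t)) : ℝ) : ℂ) * Complex.I := by
    intro t
    have h1 : Complex.log (1 - circlePoint t) =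
        (reLog (circlePoint t) : ℂ) + (imLog (circlePoint t) : ℂ) * Complex.I :=
      (Complex.re_add_im _).symm
    rw [h1]
    push_cast
    linear_combination ((imLog (circlePoint t) : ℂ)) ^ 2 * Complex.I_mul_I
  simp only [e] at h0
  have hof : ∀ {f : ℝ → ℝ}, IntervalIntegrable f volume 0 1 →
      IntervalIntegrable (fun t => (f t : ℂ)) volume 0 1 := fun h => ⟨h.1.ofReal, h.2.ofReal⟩
  rw [intervalIntegral.integral_add (hof (hre.sub him)) ((hof (hmix.const_mul 2)).mul_const _),
    intervalIntegral.integral_mul_const, intervalIntegral.integral_ofReal,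
    intervalIntegral.integral_ofReal] at h0
  have h1 := congrArg Complex.re h0
  simp only [Complex.add_re, Complex.ofReal_re, Complex.re_ofReal_mul, Complex.I_re, mul_zero,
    add_zero, Complex.zero_re] at h1
  rw [intervalIntegral.integral_sub hre him, integral_imLog_sq] at h1
  linarith

/-! ### The Denjoy–Koksma inequality with singularities -/

lemma integral_rpow_neg_le {β : ℝ} (hβ : 0 ≤ β) (hβ2 : β ≤ 1 / 2) {a h : ℝ} (ha : 0 ≤ a) (hh : 0 ≤ h) :
    ∫ t in a..(a + h), t ^ (-β) ≤ 2 * h ^ (1 - β) := by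
  rw [integral_rpow (Or.inl (by linarith))]
  have h1 : (a + h) ^ (1 - β) ≤ a ^ (1 - β) + h ^ (1 - β) :=
    Real.rpow_add_le_add_rpow ha hh (by linarith) (by linarith)
  have e : -β + 1 = 1 - β := by ring
  rw [e, div_le_iff₀ (by linarith)]
  have h2 : 0 ≤ h ^ (1 - β) := Real.rpow_nonneg hh _
  nlinarith

/-- The points `c + i φ`, `i < q`, are close to the points of a translate of `(1 / q) ℤ`. -/
lemma exists_perm_rotation {q : ℕ} (hq : 0 < q) {p : ℤ} (hpq : IsCoprime p (q : ℤ)) {φ : ℝ}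
    (hφ : |φ - p / q| ≤ 1 / (q : ℝ) ^ 2) (c : ℝ) :
    ∃ g : ℕ → ℕ, (∀ i < q, g i < q) ∧ Set.InjOn g (Finset.range q) ∧
      ∀ i < q, ∃ δ ∈ Set.Icc (-1 : ℝ) 2, ∃ k : ℤ, c + i * φ = (g i + δ) / q + k := by
  have hq0 : (0 : ℝ) < q := by exact_mod_cast hq
  have hqz : (0 : ℤ) < q := by exact_mod_cast hq
  set n0 : ℤ := ⌊c * q⌋ with hn0
  -- With c replaced by ⌊cq⌋/q and φ by p/q, the orbit lies on the grid (1/q)ℤ, and i ↦ ⌊cq⌋ + ip is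
  -- injective modulo q because p is prime to q.
  refine ⟨fun i => ((n0 + i * p) % q).toNat, fun i _ => ?_, ?_, fun i hi => ?_⟩
  · have h1 := Int.emod_nonneg (n0 + i * p) hqz.ne'
    have h2 := Int.emod_lt_of_pos (n0 + i * p) hqz
    simp only
    omega
  · intro i hi j hj hij
    have h1 := Int.emod_nonneg (n0 + i * p) hqz.ne'
    have h2 := Int.emod_nonneg (n0 + j * p) hqz.ne'
    have h3 : (n0 + i * p) % q = (n0 + j * p) % q := by
      simp only at hij; omega
    have h4 : (q : ℤ) ∣ ((i : ℤ) - j) * p := by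
      have := Int.ModEq.dvd (show (n0 + i * p) ≡ (n0 + j * p) [ZMOD q] from h3)
      have e : ((i : ℤ) - j) * p = -(n0 + j * p - (n0 + i * p)) := by ring
      rw [e]; exact (dvd_neg).2 this
    have h5 : (q : ℤ) ∣ (i : ℤ) - j := hpq.symm.dvd_of_dvd_mul_right h4
    have hi' := Finset.mem_range.1 hi
    have hj' := Finset.mem_range.1 hj
    have h6 := Int.eq_zero_of_abs_lt_dvd h5 (by rw [abs_lt]; constructor <;> omega)
    omega
  · have h1 := Int.emod_nonneg (n0 + i * p) hqz.ne'
    have h2 := Int.emod_add_mul_ediv (n0 + i * p) q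
    set l : ℤ := (n0 + i * p) % q with hl
    set k : ℤ := (n0 + i * p) / q with hk
    have hl' : ((l.toNat : ℕ) : ℝ) = (l : ℝ) := by
      have : ((l.toNat : ℕ) : ℤ) = l := Int.toNat_of_nonneg h1
      exact_mod_cast congrArg (Int.cast : ℤ → ℝ) this
    have h2' : (l : ℝ) + q * k = n0 + i * p := by exact_mod_cast h2
    -- The two errors in units of 1/q: rounding c costs something in [0, 1), and replacing φ by p/q
    -- costs at most q · i / q² ≤ 1 in absolute value. Hence the range [-1, 2].
    refine ⟨Int.fract (c * q) + q * (i * (φ - p / q)), ?_, k, ?_⟩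
    · have hf0 := Int.fract_nonneg (c * q)
      have hf1 := (Int.fract_lt_one (c * q)).le
      have hi0 : (i : ℝ) ≤ q := by exact_mod_cast hi.le
      have hb : |(q : ℝ) * (i * (φ - p / q))| ≤ 1 := by
        rw [abs_mul, abs_mul, abs_of_pos hq0, Nat.abs_cast]
        calc (q : ℝ) * (i * |φ - p / q|) ≤ q * (q * (1 / (q : ℝ) ^ 2)) := by gcongr
          _ = 1 := by field_simp
      have := abs_le.1 hb
      constructor <;> linarith [this.1, this.2]
    · simp only
      rw [hl']
      have hfr : Int.fract (c * q) = c * q - n0 := rfl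
      rw [hfr]
      field_simp
      linear_combination (-1 : ℝ) * h2'

/-- Truncated subtraction is harmless: `l = 0` and `l = 1` both give `0 ^ (-s) = 0`. -/
lemma sum_range_pred_rpow_le {s : ℝ} (hs : 1 < s) (q : ℕ) :
    ∑ l ∈ Finset.range q, ((l - 1 : ℕ) : ℝ) ^ (-s) ≤ ∑' i : ℕ, (i : ℝ) ^ (-s) := by
  have hsum : Summable fun i : ℕ => (i : ℝ) ^ (-s) := Real.summable_nat_rpow.2 (by linarith)
  cases q with
  | zero => simpa using tsum_nonneg fun i => Real.rpow_nonneg (Nat.cast_nonneg i) _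
  | succ q =>
    rw [Finset.sum_range_succ']
    simp only [Nat.add_sub_cancel, Nat.zero_sub, Nat.cast_zero]
    rw [Real.zero_rpow (by linarith), add_zero]
    exact hsum.sum_le_tsum _ fun i _ => Real.rpow_nonneg (Nat.cast_nonneg i) _

section DenjoyKoksma

variable {β A : ℝ} {f : ℝ → ℝ}

lemma EdgeSingular.intervalIntegrable_sub (hf : EdgeSingular β A f) (hm : Measurable f) (hβ1 : β < 1)
    {a b : ℝ} (ha : 0 ≤ a) (hab : a ≤ b) (hb : b ≤ 1) : IntervalIntegrable f volume a b := by
  refine (hf.intervalIntegrable hm hβ1).mono_set ?_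
  rw [Set.uIcc_of_le hab, Set.uIcc_of_le zero_le_one]
  exact Set.Icc_subset_Icc ha hb

lemma EdgeSingular.abs_integral_le (hf : EdgeSingular β A f) (hβ : 0 ≤ β)
    (hβ2 : β ≤ 1 / 2) {a h : ℝ} (ha : 0 ≤ a) (hh : 0 ≤ h) (hb : a + h ≤ 1) :
    |∫ t in a..(a + h), f t| ≤ 4 * A * h ^ (1 - β) := by
  have hA := hf.nonneg
  have hi1 : IntervalIntegrable (fun t : ℝ => t ^ (-β)) volume a (a + h) :=
    intervalIntegral.intervalIntegrable_rpow' (by linarith)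
  have hi2 : IntervalIntegrable (fun t : ℝ => (1 - t) ^ (-β)) volume a (a + h) := by
    have h1 : IntervalIntegrable (fun t : ℝ => t ^ (-β)) volume (1 - a) (1 - (a + h)) :=
      intervalIntegral.intervalIntegrable_rpow' (by linarith)
    have h2 := h1.comp_sub_left 1
    rwa [sub_sub_cancel, sub_sub_cancel] at h2
  have h1 : ‖∫ t in a..(a + h), f t‖ ≤ ∫ t in a..(a + h), A * (t ^ (-β) + (1 - t) ^ (-β)) := by
    refine intervalIntegral.norm_integral_le_of_norm_le (by linarith) ?_ ((hi1.add hi2).const_mul A)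
    filter_upwards [Measure.ae_ne volume (1 : ℝ)] with t h1 ht
    exact hf.abs_le_add ⟨ha.trans_lt ht.1, lt_of_le_of_ne (ht.2.trans hb) h1⟩
  rw [Real.norm_eq_abs] at h1
  refine h1.trans ?_
  rw [intervalIntegral.integral_const_mul, intervalIntegral.integral_add hi1 hi2,
    intervalIntegral.integral_comp_sub_left (fun t => t ^ (-β))]
  have h2 := integral_rpow_neg_le hβ hβ2 ha hh
  have h3 := integral_rpow_neg_le hβ hβ2 (a := 1 - (a + h)) (by linarith) hh
  rw [show 1 - (a + h) + h = 1 - a by ring] at h3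
  calc _ ≤ A * (2 * h ^ (1 - β) + 2 * h ^ (1 - β)) := by gcongr
    _ = _ := by ring

/-- In units of 1/q, the sampled point and the cell from l to l + 1 stay at distance at least min(l
- 1, q - 2 - l) from the ends and within 2 of each other. So the Lipschitz bound at that distance
controls the difference between the value and the cell average. -/
lemma EdgeSingular.abs_sub_integral_le (hf : EdgeSingular β A f) (hm : Measurable f)
    (hβ1 : β < 1) {q l : ℕ} (hl : 2 ≤ l) (hlq : l + 2 < q) {δ : ℝ}
    (hδ : δ ∈ Set.Icc (-1 : ℝ) 2) :
    |f ((l + δ) / q) - q * ∫ t in ((l : ℝ) / q)..((l : ℝ) / q + 1 / q), f t| ≤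
      2 * A * (q : ℝ) ^ β * (((l - 1 : ℕ) : ℝ) ^ (-(1 + β)) + ((q - 2 - l : ℕ) : ℝ) ^ (-(1 + β))) := by
  have hA := hf.nonneg
  have hq0 : (0 : ℝ) < q := by exact_mod_cast (by omega : 0 < q)
  have hl1 : ((l - 1 : ℕ) : ℝ) = l - 1 := by
    rw [Nat.cast_sub (by omega)]; simp
  have hl2 : ((q - 2 - l : ℕ) : ℝ) = q - 2 - l := by
    rw [Nat.cast_sub (by omega), Nat.cast_sub (by omega)]; simp
  have hu0 : (0 : ℝ) < ((l - 1 : ℕ) : ℝ) := by exact_mod_cast (by omega : 0 < l - 1)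
  have hv0 : (0 : ℝ) < ((q - 2 - l : ℕ) : ℝ) := by exact_mod_cast (by omega : 0 < q - 2 - l)
  set u : ℝ := ((l - 1 : ℕ) : ℝ) with hu
  set v : ℝ := ((q - 2 - l : ℕ) : ℝ) with hv
  have hdist : ∀ x : ℝ, -1 ≤ x → x ≤ 2 → min u v / q ≤ edgeDist ((l + x) / q) := by
    intro x hx1 hx2
    unfold edgeDist
    refine le_min ?_ ?_
    · rw [div_le_div_iff_of_pos_right hq0]
      exact (min_le_left _ _).trans (by linarith)
    · rw [show 1 - (l + x) / q = (q - l - x) / q by field_simp; ring,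
        div_le_div_iff_of_pos_right hq0]
      exact (min_le_right _ _).trans (by linarith)
  have hmin0 : 0 < min u v / q := div_pos (lt_min hu0 hv0) hq0
  have hmem : ∀ x : ℝ, -1 ≤ x → x ≤ 2 → (l + x) / q ∈ Set.Ioo (0 : ℝ) 1 := by
    intro x hx1 hx2
    have := hmin0.trans_le (hdist x hx1 hx2)
    unfold edgeDist at this
    rw [lt_min_iff] at this
    exact ⟨this.1, by linarith [this.2]⟩
  have hpt : ∀ t ∈ Set.Icc ((l : ℝ) / q) ((l : ℝ) / q + 1 / q),
      ∃ x : ℝ, 0 ≤ x ∧ x ≤ 1 ∧ t = (l + x) / q := by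
    intro t ht
    refine ⟨t * q - l, ?_, ?_, by field_simp; ring⟩
    · have := (div_le_iff₀ hq0).1 ht.1; linarith
    · have h1 := ht.2
      rw [← add_div, le_div_iff₀ hq0] at h1; linarith
  set W : ℝ := A * (2 / q) * (min u v / q) ^ (-1 - β) with hW
  have hbound : ∀ t ∈ Set.Icc ((l : ℝ) / q) ((l : ℝ) / q + 1 / q), |f ((l + δ) / q) - f t| ≤ W := by
    intro t ht
    obtain ⟨x, hx0, hx1, rfl⟩ := hpt t ht
    refine (hf.lip _ (hmem δ hδ.1 hδ.2) _ (hmem x (by linarith) (by linarith)) _ hmin0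
      (hdist δ hδ.1 hδ.2) (hdist x (by linarith) (by linarith))).trans ?_
    rw [hW]
    have : |(l + δ) / q - (l + x) / q| ≤ 2 / q := by
      rw [← sub_div, abs_div, abs_of_pos hq0, div_le_div_iff_of_pos_right hq0, abs_le]
      constructor <;> linarith [hδ.1, hδ.2]
    have h3 : 0 ≤ (min u v / q) ^ (-1 - β) := Real.rpow_nonneg hmin0.le _
    gcongr
  have hle1 : (l : ℝ) / q + 1 / q ≤ 1 := by
    rw [← add_div, div_le_one hq0]
    exact_mod_cast (by omega : l + 1 ≤ q)
  have hle0 : (l : ℝ) / q ≤ (l : ℝ) / q + 1 / q := by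
    have : (0 : ℝ) ≤ 1 / q := by positivity
    linarith
  have hint := hf.intervalIntegrable_sub hm hβ1 (show (0 : ℝ) ≤ (l : ℝ) / q by positivity) hle0 hle1
  have e1 : f ((l + δ) / q) - q * ∫ t in ((l : ℝ) / q)..((l : ℝ) / q + 1 / q), f t =
      q * ∫ t in ((l : ℝ) / q)..((l : ℝ) / q + 1 / q), (f ((l + δ) / q) - f t) := by
    rw [intervalIntegral.integral_sub (by simp) hint, intervalIntegral.integral_const]
    simp only [add_sub_cancel_left, smul_eq_mul]
    field_simp
  have h5 : ‖∫ t in ((l : ℝ) / q)..((l : ℝ) / q + 1 / q), (f ((l + δ) / q) - f t)‖ ≤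
      W * |(l : ℝ) / q + 1 / q - (l : ℝ) / q| := by
    refine intervalIntegral.norm_integral_le_of_norm_le_const fun t ht => ?_
    rw [Set.uIoc_of_le hle0] at ht
    exact hbound t ⟨ht.1.le, ht.2⟩
  rw [Real.norm_eq_abs, add_sub_cancel_left,
    abs_of_pos (show (0 : ℝ) < 1 / q by positivity)] at h5
  rw [e1, abs_mul, abs_of_pos hq0]
  have h6 : (min u v / q) ^ (-1 - β) ≤ (q : ℝ) ^ (1 + β) * (u ^ (-(1 + β)) + v ^ (-(1 + β))) := by
    have hp1 : 0 ≤ u ^ (-(1 + β)) := Real.rpow_nonneg hu0.le _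
    have hp2 : 0 ≤ v ^ (-(1 + β)) := Real.rpow_nonneg hv0.le _
    rw [show -1 - β = -(1 + β) by ring, Real.div_rpow (lt_min hu0 hv0).le hq0.le,
      Real.rpow_neg hq0.le, div_inv_eq_mul, mul_comm]
    gcongr
    rcases min_choice u v with h | h <;> rw [h] <;> linarith
  calc _ ≤ q * (W * (1 / q)) := by gcongr
    _ = W := by field_simp
    _ ≤ A * (2 / q) * ((q : ℝ) ^ (1 + β) * (u ^ (-(1 + β)) + v ^ (-(1 + β)))) := by
      rw [hW]; gcongr
    _ = _ := by rw [Real.rpow_add hq0, Real.rpow_one]; field_simp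

/-- The Denjoy–Koksma inequality for functions with mild singularities at the integers. -/
lemma EdgeSingular.denjoyKoksma (hf : EdgeSingular β A f) (hm : Measurable f)
    (hper : ∀ (t : ℝ) (k : ℤ), f (t + k) = f t) (hβ : 0 < β) (hβ2 : β ≤ 1 / 2) {q : ℕ} (hq : 0 < q)
    {p : ℤ} (hpq : IsCoprime p (q : ℤ)) {φ : ℝ} (hφ : |φ - p / q| ≤ 1 / (q : ℝ) ^ 2) (c : ℝ) {B : ℝ}
    (hB : ∀ i < q, |f (c + i * φ)| ≤ B) :
    |∑ i ∈ Finset.range q, f (c + i * φ) - q * ∫ t in (0 : ℝ)..1, f t| ≤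
      4 * B + (16 + 4 * ∑' i : ℕ, (i : ℝ) ^ (-(1 + β))) * A * (q : ℝ) ^ β := by
  have hA := hf.nonneg
  have hq0 : (0 : ℝ) < q := by exact_mod_cast hq
  have hqβ : 0 ≤ (q : ℝ) ^ β := Real.rpow_nonneg hq0.le _
  have hB0 : 0 ≤ B := (abs_nonneg _).trans (hB 0 hq)
  obtain ⟨g, hgq, hginj, hg⟩ := exists_perm_rotation hq hpq hφ c
  have himg : (Finset.range q).image g = Finset.range q := by
    refine Finset.eq_of_subset_of_card_le ?_ ?_
    · intro x hx
      obtain ⟨i, hi, rfl⟩ := Finset.mem_image.1 hx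
      exact Finset.mem_range.2 (hgq i (Finset.mem_range.1 hi))
    · rw [Finset.card_image_of_injOn hginj]
  have hreindex : ∀ D : ℕ → ℝ, ∑ i ∈ Finset.range q, D (g i) = ∑ l ∈ Finset.range q, D l := by
    intro D
    conv_rhs => rw [← himg]
    rw [Finset.sum_image hginj]
  set J : ℕ → ℝ := fun l => q * ∫ t in ((l : ℝ) / q)..((l : ℝ) / q + 1 / q), f t with hJ
  have hint : ∀ l < q, IntervalIntegrable f volume ((l : ℝ) / q) ((l : ℝ) / q + 1 / q) := by
    intro l hl
    refine hf.intervalIntegrable_sub hm (by linarith) (by positivity) ?_ ?_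
    · have : (0 : ℝ) ≤ 1 / q := by positivity
      linarith
    · rw [← add_div, div_le_one hq0]; exact_mod_cast hl
  have hJsum : q * ∫ t in (0 : ℝ)..1, f t = ∑ i ∈ Finset.range q, J (g i) := by
    rw [hreindex J, ← Finset.mul_sum]
    congr 1
    have := intervalIntegral.sum_integral_adjacent_intervals (f := f) (μ := volume)
      (a := fun l : ℕ => (l : ℝ) / q) (n := q) (fun l hl => by
        have := hint l hl
        rwa [← add_div, ← Nat.cast_add_one] at this)
    simp only [Nat.cast_zero, zero_div, div_self hq0.ne'] at this
    rw [← this]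
    refine Finset.sum_congr rfl fun l _ => ?_
    rw [← add_div, ← Nat.cast_add_one]
  set H : ℕ → ℝ := fun l =>
    2 * A * (q : ℝ) ^ β * (((l - 1 : ℕ) : ℝ) ^ (-(1 + β)) + ((q - 2 - l : ℕ) : ℝ) ^ (-(1 + β))) with hH
  -- The four cells next to the ends, where the Lipschitz bound fails. Each is visited once; the
  -- value there is bounded by B and the cell average by 4Aq^β. On the other cells the errors `H`
  -- sum to O(q^β), because 1 + β > 1.
  set e : ℕ → ℝ := fun l => if l ∈ ({0, 1, q - 2, q - 1} : Finset ℕ) then B + 4 * A * (q : ℝ) ^ β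
    else 0 with he
  have hH0 : ∀ l, 0 ≤ H l := by
    intro l
    have h1 : 0 ≤ ((l - 1 : ℕ) : ℝ) ^ (-(1 + β)) := Real.rpow_nonneg (Nat.cast_nonneg _) _
    have h2 : 0 ≤ ((q - 2 - l : ℕ) : ℝ) ^ (-(1 + β)) := Real.rpow_nonneg (Nat.cast_nonneg _) _
    simp only [hH]; positivity
  have hterm : ∀ i ∈ Finset.range q, |f (c + i * φ) - J (g i)| ≤ e (g i) + H (g i) := by
    intro i hi
    have hiq := Finset.mem_range.1 hi
    obtain ⟨δ, hδ, k, hk⟩ := hg i hiq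
    by_cases hedge : g i ∈ ({0, 1, q - 2, q - 1} : Finset ℕ)
    · have h1 := hB i hiq
      have hl := hgq i hiq
      have h2 : |J (g i)| ≤ 4 * A * (q : ℝ) ^ β := by
        simp only [hJ]
        rw [abs_mul, abs_of_pos hq0]
        have h3 := hf.abs_integral_le hβ.le hβ2 (a := (g i : ℝ) / q) (h := 1 / q) (by positivity)
          (by positivity) (by rw [← add_div, div_le_one hq0]; exact_mod_cast hl)
        have e1 : (q : ℝ) * (4 * A * (1 / q : ℝ) ^ (1 - β)) = 4 * A * (q : ℝ) ^ β := by
          rw [one_div, Real.inv_rpow hq0.le, ← Real.rpow_neg hq0.le,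
            show -(1 - β) = β - 1 by ring, Real.rpow_sub hq0, Real.rpow_one]
          field_simp
        rw [← e1]
        gcongr
      have h3 : e (g i) = B + 4 * A * (q : ℝ) ^ β := if_pos hedge
      rw [h3]
      have := abs_sub (f (c + i * φ)) (J (g i))
      linarith [hH0 (g i)]
    · simp only [Finset.mem_insert, Finset.mem_singleton, not_or] at hedge
      have hl := hgq i hiq
      have h1 := hf.abs_sub_integral_le hm (by linarith) (q := q) (l := g i) (by omega)
        (by omega) hδ
      rw [hk, hper]
      have : 0 ≤ e (g i) := by
        simp only [he]; split_ifs <;> positivity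
      simp only [hJ, hH]
      linarith
  have hesum : ∑ l ∈ Finset.range q, e l ≤ 4 * (B + 4 * A * (q : ℝ) ^ β) := by
    simp only [he]
    rw [← Finset.sum_filter, Finset.sum_const, nsmul_eq_mul]
    have hcard : ((Finset.range q).filter (· ∈ ({0, 1, q - 2, q - 1} : Finset ℕ))).card ≤ 4 := by
      refine (Finset.card_le_card (t := ({0, 1, q - 2, q - 1} : Finset ℕ)) ?_).trans
        Finset.card_le_four
      intro x hx; exact (Finset.mem_filter.1 hx).2
    have : (((Finset.range q).filter (· ∈ ({0, 1, q - 2, q - 1} : Finset ℕ))).card : ℝ) ≤ 4 := by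
      exact_mod_cast hcard
    gcongr
  have hHsum : ∑ l ∈ Finset.range q, H l ≤
      4 * (∑' i : ℕ, (i : ℝ) ^ (-(1 + β))) * A * (q : ℝ) ^ β := by
    have h1 := sum_range_pred_rpow_le (s := 1 + β) (by linarith) q
    have h2 : ∑ l ∈ Finset.range q, ((q - 2 - l : ℕ) : ℝ) ^ (-(1 + β)) =
        ∑ l ∈ Finset.range q, ((l - 1 : ℕ) : ℝ) ^ (-(1 + β)) := by
      rw [← Finset.sum_range_reflect]
      refine Finset.sum_congr rfl fun l hl => ?_
      have := Finset.mem_range.1 hl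
      congr 2; omega
    simp only [hH]
    rw [← Finset.mul_sum, Finset.sum_add_distrib, h2]
    calc _ ≤ 2 * A * (q : ℝ) ^ β * ((∑' i : ℕ, (i : ℝ) ^ (-(1 + β))) +
          ∑' i : ℕ, (i : ℝ) ^ (-(1 + β))) := by gcongr
      _ = _ := by ring
  rw [hJsum, ← Finset.sum_sub_distrib]
  calc _ ≤ ∑ i ∈ Finset.range q, |f (c + i * φ) - J (g i)| := Finset.abs_sum_le_sum_abs _ _
    _ ≤ ∑ i ∈ Finset.range q, (e (g i) + H (g i)) := Finset.sum_le_sum hterm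
    _ = ∑ l ∈ Finset.range q, e l + ∑ l ∈ Finset.range q, H l := by
      rw [hreindex (fun l => e l + H l), Finset.sum_add_distrib]
    _ ≤ _ := by linarith

end DenjoyKoksma

/-! ### Equidistribution of rotations of finite type -/

section Rotation

variable {β A : ℝ} {f : ℝ → ℝ}

lemma EdgeSingular.abs_le_of_le_edgeDist_fract (hf : EdgeSingular β A f)
    (hper : ∀ (t : ℝ) (k : ℤ), f (t + k) = f t) (hβ : 0 ≤ β) {x δ : ℝ} (hδ : 0 < δ)
    (h : δ ≤ edgeDist (Int.fract x)) : |f x| ≤ A * δ ^ (-β) := by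
  have h1 : f x = f (Int.fract x) := by
    conv_lhs => rw [← Int.fract_add_floor x]
    rw [hper]
  have h0 := hδ.trans_le h
  have hmem : Int.fract x ∈ Set.Ioo (0 : ℝ) 1 :=
    ⟨h0.trans_le (min_le_left _ _), Int.fract_lt_one x⟩
  rw [h1]
  refine (hf.bound _ hmem).trans ?_
  exact mul_le_mul_of_nonneg_left (Real.rpow_le_rpow_of_nonpos hδ h (by linarith)) hf.nonneg

/-- Splitting an orbit of a rotation into blocks of length `q`. -/
lemma abs_sum_sub_le_of_blocks {F : ℕ → ℝ} {q M : ℕ} (hq : 0 < q) {I D E : ℝ} (hD0 : 0 ≤ D)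
    (hD : ∀ c, c + q ≤ M → |∑ i ∈ Finset.range q, F (c + i) - q * I| ≤ D)
    (hE : ∀ i < M, |F i - I| ≤ E) (hE0 : 0 ≤ E) :
    |∑ i ∈ Finset.range M, F i - M * I| ≤ M / q * D + q * E := by
  have hq0 : (0 : ℝ) < q := by exact_mod_cast hq
  have hblocks : ∀ b, b * q ≤ M → |∑ i ∈ Finset.range (b * q), F i - (b * q : ℕ) * I| ≤ b * D := by
    intro b
    induction b with
    | zero => simp
    | succ b ih =>
      intro hb
      rw [Nat.succ_mul] at hb ⊢
      have h1 := ih (by omega)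
      have h2 := hD (b * q) hb
      rw [Finset.sum_range_add]
      have e : ∑ x ∈ Finset.range (b * q), F x + ∑ x ∈ Finset.range q, F (b * q + x) -
          (b * q + q : ℕ) * I = (∑ i ∈ Finset.range (b * q), F i - (b * q : ℕ) * I) +
          (∑ i ∈ Finset.range q, F (b * q + i) - q * I) := by push_cast; ring
      rw [e]
      refine (abs_add_le _ _).trans ?_
      push_cast at h1 ⊢
      linarith
  set b := M / q with hb
  have hbM : b * q ≤ M := Nat.div_mul_le_self M q
  have hM : M = b * q + M % q := (Nat.div_add_mod' M q).symm
  have hs : M % q < q := Nat.mod_lt _ hq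
  set s := M % q
  have h1 := hblocks b hbM
  have h2 : |∑ i ∈ Finset.range s, (F (b * q + i) - I)| ≤ s * E := by
    refine (Finset.abs_sum_le_sum_abs _ _).trans ?_
    refine (Finset.sum_le_card_nsmul _ _ E fun i hi => hE _ ?_).trans (by simp)
    have := Finset.mem_range.1 hi
    omega
  have e : ∑ i ∈ Finset.range M, F i - M * I =
      (∑ i ∈ Finset.range (b * q), F i - (b * q : ℕ) * I) +
        ∑ i ∈ Finset.range s, (F (b * q + i) - I) := by
    rw [Finset.sum_sub_distrib, Finset.sum_const, Finset.card_range, nsmul_eq_mul]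
    conv_lhs => rw [hM]
    rw [Finset.sum_range_add]
    push_cast
    ring
  rw [e]
  refine (abs_add_le _ _).trans (add_le_add (h1.trans ?_) (h2.trans ?_))
  · refine mul_le_mul_of_nonneg_right ?_ hD0
    rw [le_div_iff₀ hq0]
    exact_mod_cast hbM
  · refine mul_le_mul_of_nonneg_right ?_ hE0
    exact_mod_cast hs.le

/-- Equidistribution with a power saving of the orbits of a rotation by an angle of finite type. -/
lemma EdgeSingular.exists_abs_sum_rotation_sub_le {γ : ℝ} (hγ : 1 ≤ γ)
    (hf : EdgeSingular (1 / (8 * γ ^ 2)) A f) (hm : Measurable f)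
    (hper : ∀ (t : ℝ) (k : ℤ), f (t + k) = f t) {K : ℝ} (hK : 0 < K) {φ α : ℝ}
    (hφ : ∀ q : ℕ, 0 < q → ∀ p : ℤ, K / (q : ℝ) ^ γ ≤ |q * φ - p|)
    (hα : ∀ j : ℕ, 0 < j → K / (j : ℝ) ^ γ ≤ edgeDist (Int.fract (α + j * φ))) :
    ∃ C : ℝ, ∀ M : ℕ, 0 < M →
      |∑ i ∈ Finset.range M, f (α + (i + 1 : ℕ) * φ) - M * ∫ t in (0 : ℝ)..1, f t| ≤
        C * (M : ℝ) ^ (1 - 3 / (8 * γ)) := by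
  have hγ0 : 0 < γ := by linarith
  -- The exponent is chosen so that γβ = κ = 1/(8γ): the orbit up to time M stays at distance at
  -- least K M^(-γ) from the integers, so f is O(M^κ) along it.
  set β : ℝ := 1 / (8 * γ ^ 2) with hβ
  set κ : ℝ := 1 / (8 * γ) with hκ
  have hβ0 : 0 < β := by positivity
  have hκ0 : 0 < κ := by positivity
  have hβκ : γ * β = κ := by rw [hβ, hκ]; field_simp
  have hβκ' : β ≤ κ := by rw [← hβκ]; nlinarith
  have hκ8 : κ ≤ 1 / 8 := by
    rw [hκ]; gcongr; linarith
  have hA := hf.nonneg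
  set I : ℝ := ∫ t in (0 : ℝ)..1, f t with hI
  have hIA : |I| ≤ 4 * A := by
    have := hf.abs_integral_le hβ0.le (by linarith) (a := 0) (h := 1) le_rfl zero_le_one (by simp)
    simpa using this
  set Z : ℝ := 16 + 4 * ∑' i : ℕ, (i : ℝ) ^ (-(1 + β)) with hZ
  have hZ0 : 0 ≤ Z := by
    have : 0 ≤ ∑' i : ℕ, (i : ℝ) ^ (-(1 + β)) :=
      tsum_nonneg fun i => Real.rpow_nonneg (Nat.cast_nonneg i) _
    positivity
  refine ⟨K ^ (-(1 / γ)) * (4 * (A * K ^ (-β)) + Z * A) + (A * K ^ (-β) + 4 * A), fun M hM => ?_⟩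
  have hm1 : (1 : ℝ) ≤ M := by exact_mod_cast hM
  have hm0 : (0 : ℝ) < M := by linarith
  set m : ℝ := (M : ℝ) with hmdef
  have hKβ : 0 ≤ K ^ (-β) := Real.rpow_nonneg hK.le _
  have hKγ : 0 ≤ K ^ (-(1 / γ)) := Real.rpow_nonneg hK.le _
  have hN : 0 < Nat.sqrt M := Nat.sqrt_pos.2 hM
  -- Dirichlet's theorem provides a denominator q ≤ √M, so that an incomplete block of length less
  -- than q is affordable.
  obtain ⟨r, hr1, hr2⟩ := Real.exists_rat_abs_sub_le_and_den_le φ hN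
  set q : ℕ := r.den with hq
  have hq0 : 0 < q := r.pos
  have hq0' : (0 : ℝ) < q := by exact_mod_cast hq0
  have hcop : IsCoprime r.num (q : ℤ) := by
    rw [Int.isCoprime_iff_gcd_eq_one]
    exact r.reduced
  have hrcast : (r : ℝ) = r.num / q := Rat.cast_def r
  rw [hrcast] at hr1
  have hqN : (q : ℝ) ≤ Nat.sqrt M := by exact_mod_cast hr2
  have hsqrt_le : (Nat.sqrt M : ℝ) ≤ m ^ (1 / 2 : ℝ) := by
    rw [← Real.sqrt_eq_rpow]; exact Real.nat_sqrt_le_real_sqrt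
  have hsqrt_lt : m ^ (1 / 2 : ℝ) ≤ (Nat.sqrt M : ℝ) + 1 := by
    rw [← Real.sqrt_eq_rpow]; exact Real.real_sqrt_le_nat_sqrt_succ
  have hqm : (q : ℝ) ≤ m ^ (1 / 2 : ℝ) := hqN.trans hsqrt_le
  have hqM : (q : ℝ) ≤ m := by
    refine hqm.trans ?_
    conv_rhs => rw [← Real.rpow_one m]
    exact Real.rpow_le_rpow_of_exponent_le hm1 (by norm_num)
  have hφq : |φ - r.num / q| ≤ 1 / (q : ℝ) ^ 2 := by
    refine hr1.trans ?_
    rw [sq]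
    gcongr
    linarith
  -- Finite type forbids small denominators: K q^(-γ) ≤ |qφ - p| ≤ M^(-1/2) yields q ≥ K^(1/γ)
  -- M^(1/(2γ)), and 1/(2γ) = 4κ.
  have hinv : 1 / (q : ℝ) ≤ K ^ (-(1 / γ)) * m ^ (-(4 * κ)) := by
    have h1 := hφ q hq0 r.num
    have h2 : |q * φ - r.num| ≤ 1 / m ^ (1 / 2 : ℝ) := by
      have e : (q : ℝ) * φ - r.num = q * (φ - r.num / q) := by field_simp
      rw [e, abs_mul, abs_of_pos hq0']
      calc (q : ℝ) * |φ - r.num / q| ≤ q * (1 / ((Nat.sqrt M + 1) * q)) := by gcongr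
        _ = 1 / (Nat.sqrt M + 1) := by field_simp
        _ ≤ _ := by gcongr
    have h3 := h1.trans h2
    rw [div_le_div_iff₀ (by positivity) (by positivity), one_mul] at h3
    have h4 := Real.rpow_le_rpow (by positivity) h3 (show (0 : ℝ) ≤ 1 / γ by positivity)
    rw [← Real.rpow_mul hq0'.le, mul_one_div_cancel hγ0.ne', Real.rpow_one,
      Real.mul_rpow hK.le (by positivity), ← Real.rpow_mul hm0.le] at h4
    have e5 : (1 / 2 : ℝ) * (1 / γ) = 4 * κ := by rw [hκ]; field_simp; norm_num
    rw [e5] at h4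
    rw [Real.rpow_neg hK.le, Real.rpow_neg hm0.le, ← mul_inv, one_div]
    gcongr
  set B : ℝ := A * K ^ (-β) * m ^ κ with hB
  have hB0 : 0 ≤ B := by positivity
  have hfB : ∀ i < M, |f (α + (i + 1 : ℕ) * φ)| ≤ B := by
    intro i hi
    have h1 := hα (i + 1) (by omega)
    have hi1 : (0 : ℝ) < (i + 1 : ℕ) := by positivity
    have h2 : K / m ^ γ ≤ K / ((i + 1 : ℕ) : ℝ) ^ γ := by
      gcongr
      rw [hmdef]; exact_mod_cast hi
    have h3 := hf.abs_le_of_le_edgeDist_fract hper hβ0.le (x := α + (i + 1 : ℕ) * φ)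
      (by positivity) (h2.trans h1)
    refine h3.trans (le_of_eq ?_)
    rw [Real.div_rpow hK.le (by positivity), ← Real.rpow_mul hm0.le, hB, mul_neg, hβκ,
      Real.rpow_neg hm0.le, div_inv_eq_mul, mul_assoc]
  have hmain := abs_sum_sub_le_of_blocks (F := fun i => f (α + (i + 1 : ℕ) * φ)) (M := M) hq0
    (I := I) (D := 4 * B + Z * A * (q : ℝ) ^ β) (E := B + 4 * A) (by positivity) (fun c hc => ?_)
    (fun i hi => ?_) (by positivity)
  · refine hmain.trans ?_
    have hqβ : (q : ℝ) ^ β ≤ m ^ κ :=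
      (Real.rpow_le_rpow hq0'.le hqM hβ0.le).trans (Real.rpow_le_rpow_of_exponent_le hm1 hβκ')
    have hmκ : 1 ≤ m ^ κ := Real.one_le_rpow hm1 hκ0.le
    have e3 : 1 - 3 / (8 * γ) = 1 - 3 * κ := by rw [hκ]; ring
    rw [e3]
    -- At most M/q = O(M^(1 - 4κ)) blocks, each with an error O(M^κ).
    have t1 : m / q * (4 * B + Z * A * (q : ℝ) ^ β) ≤
        K ^ (-(1 / γ)) * (4 * (A * K ^ (-β)) + Z * A) * m ^ (1 - 3 * κ) := by
      have e4 : m ^ (1 - 3 * κ) = m * m ^ (-(4 * κ)) * m ^ κ := by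
        conv_rhs => rw [← Real.rpow_one m]
        rw [← Real.rpow_mul hm0.le, ← Real.rpow_mul hm0.le, ← Real.rpow_add hm0,
          ← Real.rpow_add hm0]
        congr 1; ring
      rw [e4]
      calc m / q * (4 * B + Z * A * (q : ℝ) ^ β) = m * (1 / q) * (4 * B + Z * A * (q : ℝ) ^ β) := by
            ring
        _ ≤ m * (K ^ (-(1 / γ)) * m ^ (-(4 * κ))) * (4 * B + Z * A * m ^ κ) := by gcongr
        _ = _ := by rw [hB]; ring
    -- The incomplete block costs at most q · O(M^κ), hence O(M^(1/2 + κ)), and 1/2 + κ ≤ 1 - 3κ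
    -- because κ ≤ 1/8.
    have t2 : q * (B + 4 * A) ≤ (A * K ^ (-β) + 4 * A) * m ^ (1 - 3 * κ) := by
      have h5 : m ^ (1 / 2 : ℝ) * m ^ κ ≤ m ^ (1 - 3 * κ) := by
        rw [← Real.rpow_add hm0]
        exact Real.rpow_le_rpow_of_exponent_le hm1 (by linarith)
      have h6 : 4 * A ≤ 4 * A * m ^ κ := le_mul_of_one_le_right (by positivity) hmκ
      calc (q : ℝ) * (B + 4 * A) ≤ m ^ (1 / 2 : ℝ) * (B + 4 * A * m ^ κ) := by
            refine mul_le_mul hqm ?_ (by positivity) (by positivity)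
            linarith
        _ = (A * K ^ (-β) + 4 * A) * (m ^ (1 / 2 : ℝ) * m ^ κ) := by rw [hB]; ring
        _ ≤ _ := by gcongr
    linarith
  · have h := hf.denjoyKoksma hm hper hβ0 (by linarith) hq0 hcop hφq (α + (c + 1 : ℕ) * φ)
      (B := B) (fun i hi => by
        have := hfB (c + i) (by omega)
        convert! this using 3
        push_cast; ring)
    convert! h using 5
    push_cast; ring
  · refine (abs_sub _ _).trans ?_
    linarith [hfB i hi]

end Rotation

/-! ### Laws with a Fourier density and their convolution powers -/

instance circleSecondCountable : SecondCountableTopology Circle :=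
  TopologicalSpace.Subtype.secondCountableTopology _

/-- The trigonometric series with coefficients `c j ^ m`. -/
def fourierPowerSum (c : ℤ → ℂ) (m : ℕ) (w : Circle) : ℂ := ∑' j : ℤ, c j ^ m * (w : ℂ) ^ j

lemma norm_circle_zpow (w : Circle) (j : ℤ) : ‖(w : ℂ) ^ j‖ = 1 := by
  rw [norm_zpow, Circle.norm_coe, one_zpow]

lemma continuous_circle_zpow (j : ℤ) : Continuous fun w : Circle => (w : ℂ) ^ j := by
  have : Continuous fun w : Circle => ((w ^ j : Circle) : ℂ) :=
    (by fun_prop : Continuous fun w : Circle => (w : ℂ)).comp (continuous_zpow j)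
  simpa using this

/-- A measure `μ` on the circle that has, with respect to a probability measure `U` that is invariant
under a subgroup carrying it, the density `∑ j, c j * w ^ j`. -/
structure HasFourierDensity (μ U : Measure Circle) (S : Subgroup Circle) (c : ℤ → ℂ) (J : Set ℤ) :
    Prop where
  zero_mem : 0 ∈ J
  summable : Summable fun j => ‖c j‖
  eq_zero : ∀ j, j ∉ J → c j = 0
  lt_one : ∀ j, j ≠ 0 → ‖c j‖ < 1
  orth : ∀ j ∈ J, ∀ k ∈ J, k ≠ j → ∫ w : Circle, (w : ℂ) ^ (k - j) ∂U = 0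
  map_mul : ∀ u ∈ S, U.map (u * ·) = U
  ae_mem : ∀ᵐ w ∂U, w ∈ S
  nonneg : ∀ w ∈ S, ∃ r : ℝ, 0 ≤ r ∧ fourierPowerSum c 1 w = r
  eq_withDensity : μ = U.withDensity fun w => ENNReal.ofReal (fourierPowerSum c 1 w).re

lemma productLaw_zero_succ (μ : Measure Circle) [IsProbabilityMeasure μ] (m : ℕ) :
    productLaw μ (m + 1) = (μ.prod (productLaw μ m)).map fun p => p.1 * p.2 := by
  have hmp := measurePreserving_piFinSuccAbove (fun _ : Fin (m + 1) => μ) 0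
  have hm : Measurable fun w : Fin m → Circle => ∏ j, w j := by fun_prop
  unfold productLaw
  have e : (fun w : Fin (m + 1) → Circle => ∏ j, w j) =
      (fun p : Circle × (Fin m → Circle) => p.1 * ∏ j, p.2 j) ∘
        (MeasurableEquiv.piFinSuccAbove (fun _ : Fin (m + 1) => Circle) 0) := by
    ext w
    simp [Fin.prod_univ_succ, MeasurableEquiv.piFinSuccAbove]
    rfl
  rw [e, ← Measure.map_map (by fun_prop) (MeasurableEquiv.measurable _), hmp.map_eq]
  have e2 : μ.prod ((Measure.pi fun _ : Fin m => μ).map fun w => ∏ j, w j) =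
      (μ.prod (Measure.pi fun _ : Fin m => μ)).map (Prod.map id fun w => ∏ j, w j) := by
    rw [← Measure.map_prod_map _ _ measurable_id hm, Measure.map_id]
  rw [e2, Measure.map_map (by fun_prop) (by fun_prop)]
  rfl

instance isProbabilityMeasure_productLaw (μ : Measure Circle) [IsProbabilityMeasure μ] (m : ℕ) :
    IsProbabilityMeasure (productLaw μ m) :=
  Measure.isProbabilityMeasure_map (by fun_prop)

lemma productLaw_one (μ : Measure Circle) [IsProbabilityMeasure μ] : productLaw μ 1 = μ := by
  have h : productLaw μ 0 = Measure.dirac 1 := by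
    unfold productLaw
    simp only [Finset.univ_eq_empty, Finset.prod_empty]
    rw [Measure.map_const]
    simp
  rw [productLaw_zero_succ, h, Measure.prod_dirac, Measure.map_map (by fun_prop) (by fun_prop)]
  simp [Function.comp_def]

namespace HasFourierDensity

variable {μ U : Measure Circle} {S : Subgroup Circle} {c : ℤ → ℂ} {J : Set ℤ}

lemma hasSum_one (h : HasFourierDensity μ U S c J) (w : Circle) :
    HasSum (fun j : ℤ => c j * (w : ℂ) ^ j) (fourierPowerSum c 1 w) := by
  unfold fourierPowerSum
  simp only [pow_one]
  refine Summable.hasSum (Summable.of_norm ?_)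
  simpa only [norm_mul, norm_circle_zpow, mul_one] using h.summable

lemma continuous_one (h : HasFourierDensity μ U S c J) : Continuous (fourierPowerSum c 1) := by
  unfold fourierPowerSum
  refine continuous_tsum (fun j => (continuous_circle_zpow j).const_mul _) h.summable fun j w => ?_
  rw [norm_mul, norm_circle_zpow, mul_one, pow_one]

/-- The coefficients of the density are its Fourier coefficients. -/
lemma integral_zpow_neg [IsProbabilityMeasure U] (h : HasFourierDensity μ U S c J) {j : ℤ}
    (hj : j ∈ J) : ∫ u : Circle, (u : ℂ) ^ (-j) ∂μ = c j := by
  have hmeas : Measurable fun w => Real.toNNReal (fourierPowerSum c 1 w).re :=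
    (Complex.measurable_re.comp h.continuous_one.measurable).real_toNNReal
  have e1 : μ = U.withDensity fun w => (Real.toNNReal (fourierPowerSum c 1 w).re : ENNReal) :=
    h.eq_withDensity
  rw [e1, integral_withDensity_eq_integral_smul hmeas]
  have e2 : ∫ w : Circle, Real.toNNReal (fourierPowerSum c 1 w).re • (w : ℂ) ^ (-j) ∂U =
      ∫ w : Circle, ∑' k : ℤ, c k * (w : ℂ) ^ (k - j) ∂U := by
    refine integral_congr_ae ?_
    filter_upwards [h.ae_mem] with w hw
    obtain ⟨r, hr0, hr⟩ := h.nonneg w hw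
    have hw0 : (w : ℂ) ≠ 0 := Circle.coe_ne_zero w
    have e3 : ∑' k : ℤ, c k * (w : ℂ) ^ (k - j) = fourierPowerSum c 1 w * (w : ℂ) ^ (-j) := by
      rw [← (h.hasSum_one w).tsum_eq, ← tsum_mul_right]
      refine tsum_congr fun k => ?_
      rw [sub_eq_add_neg, zpow_add₀ hw0, mul_assoc]
    rw [e3, hr, NNReal.smul_def, Real.coe_toNNReal _ (by simpa using hr0), Complex.ofReal_re]
    exact Complex.real_smul
  rw [e2]
  have hint : ∀ k, Integrable (fun w : Circle => c k * (w : ℂ) ^ (k - j)) U := fun k => by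
    refine Integrable.of_bound ((continuous_circle_zpow (k - j)).const_mul _).aestronglyMeasurable
      ‖c k‖ (Eventually.of_forall fun w => ?_)
    rw [norm_mul, norm_circle_zpow, mul_one]
  have hs := hasSum_integral_of_summable_integral_norm hint (by
    simpa only [norm_mul, norm_circle_zpow, mul_one, integral_const, probReal_univ, one_smul]
      using h.summable)
  rw [← hs.tsum_eq, tsum_eq_single j]
  · simp
  · intro k hk
    rw [integral_const_mul]
    by_cases hkJ : k ∈ J
    · rw [h.orth j hj k hkJ hk, mul_zero]
    · rw [h.eq_zero k hkJ, zero_mul]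

/-- The coefficient of index 0 is the total mass. -/
lemma coeff_zero [IsProbabilityMeasure U] [IsProbabilityMeasure μ] (h : HasFourierDensity μ U S c J) :
    c 0 = 1 := by
  have := h.integral_zpow_neg h.zero_mem
  simpa using this.symm

lemma norm_le_one [IsProbabilityMeasure U] [IsProbabilityMeasure μ]
    (h : HasFourierDensity μ U S c J) (j : ℤ) : ‖c j‖ ≤ 1 := by
  by_cases hj : j = 0
  · rw [hj, h.coeff_zero, norm_one]
  · exact (h.lt_one j hj).le

lemma norm_pow_le [IsProbabilityMeasure U] [IsProbabilityMeasure μ]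
    (h : HasFourierDensity μ U S c J) (m : ℕ) (j : ℤ) : ‖c j ^ (m + 1)‖ ≤ ‖c j‖ := by
  rw [norm_pow]
  exact pow_le_of_le_one (norm_nonneg _) (h.norm_le_one j) (Nat.succ_ne_zero m)

lemma summable_pow [IsProbabilityMeasure U] [IsProbabilityMeasure μ]
    (h : HasFourierDensity μ U S c J) (m : ℕ) (w : Circle) :
    Summable fun j : ℤ => c j ^ (m + 1) * (w : ℂ) ^ j := by
  refine Summable.of_norm_bounded h.summable fun j => ?_
  rw [norm_mul, norm_circle_zpow, mul_one]
  exact h.norm_pow_le m j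

lemma continuous_fourierPowerSum [IsProbabilityMeasure U] [IsProbabilityMeasure μ]
    (h : HasFourierDensity μ U S c J) (m : ℕ) : Continuous (fourierPowerSum c (m + 1)) := by
  unfold fourierPowerSum
  refine continuous_tsum (fun j => (continuous_circle_zpow j).const_mul _) h.summable fun j w => ?_
  rw [norm_mul, norm_circle_zpow, mul_one]
  exact h.norm_pow_le m j

/-- Convolution with `μ` multiplies the Fourier coefficients by `c`. -/
lemma integral_fourierPowerSum [IsProbabilityMeasure U] [IsProbabilityMeasure μ]
    (h : HasFourierDensity μ U S c J) (m : ℕ) (v : Circle) :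
    ∫ u, fourierPowerSum c (m + 1) (u⁻¹ * v) ∂μ = fourierPowerSum c (m + 2) v := by
  have hterm : ∀ j : ℤ, ∀ u : Circle, c j ^ (m + 1) * ((u⁻¹ * v : Circle) : ℂ) ^ j =
      (c j ^ (m + 1) * (v : ℂ) ^ j) * (u : ℂ) ^ (-j) := by
    intro j u
    rw [Circle.coe_mul, mul_zpow, Circle.coe_inv, inv_zpow, zpow_neg]; ring
  have hint : ∀ j : ℤ, Integrable (fun u : Circle => c j ^ (m + 1) * ((u⁻¹ * v : Circle) : ℂ) ^ j) μ := by
    intro j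
    simp only [hterm]
    refine Integrable.of_bound ((continuous_circle_zpow (-j)).const_mul _).aestronglyMeasurable
      ‖c j ^ (m + 1) * (v : ℂ) ^ j‖ (Eventually.of_forall fun w => ?_)
    rw [norm_mul _ ((w : ℂ) ^ (-j)), norm_circle_zpow, mul_one]
  have hs := hasSum_integral_of_summable_integral_norm hint (by
    refine Summable.of_nonneg_of_le (fun j => by positivity) (fun j => ?_) h.summable
    simp only [norm_mul, norm_circle_zpow, mul_one, integral_const, probReal_univ, one_smul]
    exact h.norm_pow_le m j)
  unfold fourierPowerSum
  rw [← hs.tsum_eq]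
  refine tsum_congr fun j => ?_
  simp only [hterm]
  rw [integral_const_mul]
  by_cases hj : j ∈ J
  · rw [h.integral_zpow_neg hj]; ring
  · rw [h.eq_zero j hj]; simp

lemma ae_mem' (h : HasFourierDensity μ U S c J) : ∀ᵐ w ∂μ, w ∈ S := by
  rw [h.eq_withDensity]
  exact (withDensity_absolutelyContinuous _ _).ae_le h.ae_mem

lemma integrable_fourierPowerSum [IsProbabilityMeasure U] [IsProbabilityMeasure μ]
    (h : HasFourierDensity μ U S c J) (m : ℕ) (v : Circle) :
    Integrable (fun u => fourierPowerSum c (m + 1) (u⁻¹ * v)) μ := by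
  have hc : Continuous fun u : Circle => fourierPowerSum c (m + 1) (u⁻¹ * v) := by
    have := h.continuous_fourierPowerSum m
    fun_prop
  obtain ⟨C, hC⟩ := isCompact_univ.exists_bound_of_continuousOn hc.continuousOn
  exact Integrable.of_bound hc.aestronglyMeasurable C (Eventually.of_forall fun w => hC w trivial)

/-- Each further convolution averages translates of the previous density by elements of the subgroup
`S`, which preserves nonnegativity on `S`. -/
lemma re_nonneg [IsProbabilityMeasure U] [IsProbabilityMeasure μ]
    (h : HasFourierDensity μ U S c J) (m : ℕ) :
    ∀ w ∈ S, 0 ≤ (fourierPowerSum c (m + 1) w).re := by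
  induction m with
  | zero =>
    intro w hw
    obtain ⟨r, hr0, hr⟩ := h.nonneg w hw
    rw [zero_add, hr]; simpa using hr0
  | succ m ih =>
    intro w hw
    rw [← h.integral_fourierPowerSum m w, ← RCLike.re_eq_complex_re,
      ← integral_re (h.integrable_fourierPowerSum m w)]
    refine integral_nonneg_of_ae ?_
    filter_upwards [h.ae_mem'] with u hu
    exact ih _ (S.mul_mem (S.inv_mem hu) hw)

/-- By induction, one more factor convolves with μ. Invariance of `U` under `S` moves the
translation from the test function to the density, and after Tonelli the inner integral is the
convolution computed in `integral_fourierPowerSum`. -/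
lemma productLaw_eq [IsProbabilityMeasure U] [IsProbabilityMeasure μ]
    (h : HasFourierDensity μ U S c J) (m : ℕ) :
    productLaw μ (m + 1) =
      U.withDensity fun w => ENNReal.ofReal (fourierPowerSum c (m + 1) w).re := by
  have hmeas : ∀ m, Measurable fun w => ENNReal.ofReal (fourierPowerSum c (m + 1) w).re := fun m =>
    (Complex.measurable_re.comp (h.continuous_fourierPowerSum m).measurable).ennreal_ofReal
  induction m with
  | zero => rw [productLaw_one]; exact h.eq_withDensity
  | succ m ih =>
    rw [productLaw_zero_succ, ih]
    refine Measure.ext_of_lintegral _ fun F hF => ?_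
    rw [lintegral_map hF (by fun_prop), lintegral_prod _ (by fun_prop),
      lintegral_withDensity_eq_lintegral_mul _ (hmeas (m + 1)) hF]
    have step : ∀ᵐ u ∂μ, ∫⁻ w, F (u * w) ∂(U.withDensity fun w =>
        ENNReal.ofReal (fourierPowerSum c (m + 1) w).re) =
        ∫⁻ v, ENNReal.ofReal (fourierPowerSum c (m + 1) (u⁻¹ * v)).re * F v ∂U := by
      filter_upwards [h.ae_mem'] with u hu
      rw [lintegral_withDensity_eq_lintegral_mul _ (hmeas m) (by fun_prop)]
      conv_rhs => rw [← h.map_mul u hu]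
      rw [lintegral_map _ (by fun_prop)]
      · simp only [inv_mul_cancel_left, Pi.mul_apply]
      · have := (hmeas m).comp (measurable_const_mul u⁻¹)
        exact Measurable.mul this hF
    rw [lintegral_congr_ae step, lintegral_lintegral_swap]
    · refine lintegral_congr_ae ?_
      filter_upwards [h.ae_mem] with v hv
      rw [Pi.mul_apply, lintegral_mul_const _ (by
        exact (hmeas m).comp (measurable_inv.mul_const v))]
      congr 1
      rw [← h.integral_fourierPowerSum m v, ← RCLike.re_eq_complex_re,
        ← integral_re (h.integrable_fourierPowerSum m v),
        ofReal_integral_eq_lintegral_ofReal (h.integrable_fourierPowerSum m v).re]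
      · filter_upwards [h.ae_mem'] with u hu
        exact h.re_nonneg m _ (S.mul_mem (S.inv_mem hu) hv)
    · refine Measurable.aemeasurable ?_
      have h1 : Measurable fun p : Circle × Circle =>
          ENNReal.ofReal (fourierPowerSum c (m + 1) (p.1⁻¹ * p.2)).re :=
        (hmeas m).comp (by fun_prop)
      exact h1.mul (hF.comp measurable_snd)

/-- A spectral gap: by summability only finitely many coefficients have modulus at least 1/2, and
each of those of nonzero index is less than 1. -/
lemma exists_norm_le (h : HasFourierDensity μ U S c J) :
    ∃ q : ℝ, 0 < q ∧ q < 1 ∧ ∀ j, j ≠ 0 → ‖c j‖ ≤ q := by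
  have hev := h.summable.tendsto_cofinite_zero.eventually
    (gt_mem_nhds (show (0 : ℝ) < 1 / 2 by norm_num))
  have hfin : {j : ℤ | ¬ ‖c j‖ < 1 / 2}.Finite := hev
  have key : ∀ s : Finset ℤ, ∃ q : ℝ, 1 / 2 ≤ q ∧ q < 1 ∧ ∀ j ∈ s, j ≠ 0 → ‖c j‖ ≤ q := by
    intro s
    induction s using Finset.induction_on with
    | empty => exact ⟨1 / 2, le_rfl, by norm_num, by simp⟩
    | insert a s _ ih =>
      obtain ⟨q, hq0, hq1, hq⟩ := ih
      by_cases ha : a = 0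
      · refine ⟨q, hq0, hq1, fun j hj hj0 => hq j ?_ hj0⟩
        exact Finset.mem_of_mem_insert_of_ne hj (by rwa [ha])
      · refine ⟨max q ‖c a‖, le_max_of_le_left hq0, max_lt hq1 (h.lt_one a ha), fun j hj hj0 => ?_⟩
        rcases Finset.mem_insert.1 hj with rfl | hj
        · exact le_max_right _ _
        · exact le_max_of_le_left (hq j hj hj0)
  obtain ⟨q, hq0, hq1, hq⟩ := key hfin.toFinset
  refine ⟨q, by linarith, hq1, fun j hj => ?_⟩
  by_cases hj2 : ‖c j‖ < 1 / 2
  · linarith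
  · exact hq j (by simpa using hj2) hj

/-- The densities of the product laws converge to `1` geometrically fast. -/
lemma abs_density_sub_one_le [IsProbabilityMeasure U] [IsProbabilityMeasure μ]
    (h : HasFourierDensity μ U S c J) {q : ℝ} (hq0 : 0 < q) (hq : ∀ j, j ≠ 0 → ‖c j‖ ≤ q)
    (m : ℕ) (w : Circle) :
    |(fourierPowerSum c (m + 1) w).re - 1| ≤ (∑' j, ‖c j‖) * q ^ m := by
  have hs := h.summable_pow m w
  have e : fourierPowerSum c (m + 1) w - 1 =
      ∑' j : ℤ, if j = 0 then 0 else c j ^ (m + 1) * (w : ℂ) ^ j := by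
    unfold fourierPowerSum
    rw [hs.tsum_eq_add_tsum_ite 0, h.coeff_zero]
    simp
  have e2 : (fourierPowerSum c (m + 1) w).re - 1 = (fourierPowerSum c (m + 1) w - 1).re := by simp
  rw [e2]
  refine (Complex.abs_re_le_norm _).trans ?_
  rw [e, ← tsum_mul_right]
  refine tsum_of_norm_bounded (h.summable.mul_right _).hasSum fun j => ?_
  split_ifs with hj
  · rw [norm_zero]; positivity
  · rw [norm_mul, norm_circle_zpow, mul_one, norm_pow, pow_succ, mul_comm]
    gcongr
    exact hq j hj

lemma measurable_toNNReal_density [IsProbabilityMeasure U] [IsProbabilityMeasure μ]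
    (h : HasFourierDensity μ U S c J) (m : ℕ) :
    Measurable fun w => Real.toNNReal (fourierPowerSum c (m + 1) w).re :=
  (Complex.measurable_re.comp (h.continuous_fourierPowerSum m).measurable).real_toNNReal

lemma ae_toNNReal_density [IsProbabilityMeasure U] [IsProbabilityMeasure μ]
    (h : HasFourierDensity μ U S c J) (m : ℕ) (f : Circle → ℝ) :
    (fun w => Real.toNNReal (fourierPowerSum c (m + 1) w).re • f w) =ᵐ[U]
      fun w => (fourierPowerSum c (m + 1) w).re * f w := by
  filter_upwards [h.ae_mem] with w hw
  rw [NNReal.smul_def, Real.coe_toNNReal _ (h.re_nonneg m w hw), smul_eq_mul]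

lemma integrable_density_mul [IsProbabilityMeasure U] [IsProbabilityMeasure μ]
    (h : HasFourierDensity μ U S c J) (m : ℕ) {f : Circle → ℝ} (hf : Integrable f U) :
    Integrable (fun w => (fourierPowerSum c (m + 1) w).re * f w) U := by
  obtain ⟨q, hq0, -, hq⟩ := h.exists_norm_le
  refine hf.bdd_mul (c := 1 + (∑' j, ‖c j‖) * q ^ m)
    (Complex.measurable_re.comp (h.continuous_fourierPowerSum m).measurable).aestronglyMeasurable
    (Eventually.of_forall fun w => ?_)
  have := h.abs_density_sub_one_le hq0 hq m w
  rw [Real.norm_eq_abs]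
  have h2 := abs_sub_abs_le_abs_sub (fourierPowerSum c (m + 1) w).re 1
  rw [abs_one] at h2
  linarith

lemma integrable_productLaw [IsProbabilityMeasure U] [IsProbabilityMeasure μ]
    (h : HasFourierDensity μ U S c J) (m : ℕ) {f : Circle → ℝ} (hf : Integrable f U) :
    Integrable f (productLaw μ (m + 1)) := by
  have e : productLaw μ (m + 1) = U.withDensity fun w =>
      (Real.toNNReal (fourierPowerSum c (m + 1) w).re : ENNReal) := h.productLaw_eq m
  rw [e, integrable_withDensity_iff_integrable_smul (h.measurable_toNNReal_density m)]
  exact (h.integrable_density_mul m hf).congr (h.ae_toNNReal_density m f).symm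

lemma abs_integral_productLaw_sub_le [IsProbabilityMeasure U] [IsProbabilityMeasure μ]
    (h : HasFourierDensity μ U S c J) {q : ℝ} (hq0 : 0 < q) (hq : ∀ j, j ≠ 0 → ‖c j‖ ≤ q)
    (m : ℕ) {f : Circle → ℝ} (hf : Integrable f U) :
    |∫ w, f w ∂(productLaw μ (m + 1)) - ∫ w, f w ∂U| ≤
      (∑' j, ‖c j‖) * q ^ m * ∫ w, |f w| ∂U := by
  have e : productLaw μ (m + 1) = U.withDensity fun w =>
      (Real.toNNReal (fourierPowerSum c (m + 1) w).re : ENNReal) := h.productLaw_eq m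
  rw [e, integral_withDensity_eq_integral_smul (h.measurable_toNNReal_density m),
    integral_congr_ae (h.ae_toNNReal_density m f),
    ← integral_sub (h.integrable_density_mul m hf) hf, ← integral_const_mul]
  rw [← Real.norm_eq_abs]
  refine (norm_integral_le_integral_norm _).trans ?_
  refine integral_mono ((h.integrable_density_mul m hf).sub hf).norm (hf.abs.const_mul _) fun w => ?_
  have := h.abs_density_sub_one_le hq0 hq m w
  simp only [Real.norm_eq_abs]
  have e : (fourierPowerSum c (m + 1) w).re * f w - f w =
      ((fourierPowerSum c (m + 1) w).re - 1) * f w := by ring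
  rw [e, abs_mul]
  gcongr

end HasFourierDensity

/-! ### The uniform law and absolutely continuous laws -/

lemma measurable_circlePoint : Measurable circlePoint := continuous_circlePoint.measurable

instance isProbabilityMeasure_uniformCircleLaw : IsProbabilityMeasure uniformCircleLaw := by
  refine @Measure.isProbabilityMeasure_map _ _ _ _ _ ⟨by simp⟩ _ measurable_circlePoint.aemeasurable

/-- This identifies the law with the image of Haar measure on ℝ/ℤ, from which rotation invariance
follows. -/
lemma uniformCircleLaw_eq_map_toCircle :
    uniformCircleLaw = (volume : Measure (AddCircle (1 : ℝ))).map AddCircle.toCircle := by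
  have h := AddCircle.measurePreserving_mk (1 : ℝ) 0
  rw [← h.map_eq, Measure.map_map AddCircle.continuous_toCircle.measurable h.measurable,
    uniformCircleLaw, zero_add, restrict_Ioc_eq_restrict_Icc]
  congr 1
  ext t
  simp [AddCircle.toCircle_apply_mk, circlePoint]

lemma exists_circlePoint_eq (w : Circle) : ∃ t ∈ Set.Ioc (0 : ℝ) 1, circlePoint t = w := by
  have h1 : ∃ s : ℝ, circlePoint s = w := by
    refine ⟨Complex.arg w / (2 * Real.pi), ?_⟩
    unfold circlePoint
    rw [mul_div_cancel₀ _ Real.two_pi_pos.ne', Circle.exp_arg]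
  obtain ⟨s, rfl⟩ := h1
  refine ⟨s - (⌈s⌉ - 1 : ℤ), ⟨?_, ?_⟩, ?_⟩
  · have := Int.ceil_lt_add_one s; push_cast; linarith
  · have := Int.le_ceil s; push_cast; linarith
  · have := circlePoint_add_int (s - (⌈s⌉ - 1 : ℤ)) (⌈s⌉ - 1)
    rw [sub_add_cancel] at this
    exact this.symm

lemma map_mul_uniformCircleLaw (u : Circle) : uniformCircleLaw.map (u * ·) = uniformCircleLaw := by
  obtain ⟨t, -, rfl⟩ := exists_circlePoint_eq u
  have hm : Measurable (AddCircle.toCircle (T := (1 : ℝ))) :=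
    AddCircle.continuous_toCircle.measurable
  rw [uniformCircleLaw_eq_map_toCircle, Measure.map_map (by fun_prop) hm]
  have e : ((circlePoint t * ·) ∘ AddCircle.toCircle (T := (1 : ℝ))) =
      AddCircle.toCircle ∘ ((t : AddCircle (1 : ℝ)) + ·) := by
    ext x
    simp [AddCircle.toCircle_add, AddCircle.toCircle_apply_mk, circlePoint]
  rw [e, ← Measure.map_map hm (by fun_prop), map_add_left_eq_self]

lemma integral_uniformCircleLaw {E : Type*} [NormedAddCommGroup E] [NormedSpace ℝ E]
    {f : Circle → E} (hf : AEStronglyMeasurable f uniformCircleLaw) :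
    ∫ w, f w ∂uniformCircleLaw = ∫ t in (0 : ℝ)..1, f (circlePoint t) := by
  unfold uniformCircleLaw at hf ⊢
  rw [integral_map measurable_circlePoint.aemeasurable hf,
    intervalIntegral.integral_of_le zero_le_one, restrict_Ioc_eq_restrict_Icc]

lemma integrable_uniformCircleLaw_iff {f : Circle → ℝ} (hf : Measurable f) :
    Integrable f uniformCircleLaw ↔
      IntervalIntegrable (fun t => f (circlePoint t)) volume 0 1 := by
  unfold uniformCircleLaw
  rw [integrable_map_measure hf.aestronglyMeasurable measurable_circlePoint.aemeasurable,
    intervalIntegrable_iff_integrableOn_Icc_of_le zero_le_one]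
  rfl

/-- If `U` is invariant under multiplication by `u`, then it integrates to zero every
character that is not trivial on `u`. -/
lemma integral_zpow_eq_zero {U : Measure Circle} {u : Circle} (hU : U.map (u * ·) = U) {d : ℤ}
    (hd : (u : ℂ) ^ d ≠ 1) : ∫ w : Circle, (w : ℂ) ^ d ∂U = 0 := by
  have h : ∫ w : Circle, (w : ℂ) ^ d ∂U = (u : ℂ) ^ d * ∫ w : Circle, (w : ℂ) ^ d ∂U := by
    conv_lhs => rw [← hU]
    rw [integral_map (by fun_prop) (continuous_circle_zpow d).aestronglyMeasurable,
      ← integral_const_mul]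
    simp only [Circle.coe_mul, mul_zpow]
  by_contra h0
  exact hd (mul_right_cancel₀ h0 (by rw [one_mul]; exact h.symm))

lemma exists_circle_zpow_ne_one {d : ℤ} (hd : d ≠ 0) : ∃ u : Circle, (u : ℂ) ^ d ≠ 1 := by
  refine ⟨circlePoint (1 / (2 * d)), ?_⟩
  have hd' : (d : ℂ) ≠ 0 := by exact_mod_cast hd
  rw [coe_circlePoint, ← Complex.exp_int_mul]
  have : (d : ℂ) * (2 * Real.pi * ((1 / (2 * d) : ℝ) : ℂ) * Complex.I) = Real.pi * Complex.I := by
    push_cast; field_simp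
  rw [this, Complex.exp_pi_mul_I]
  norm_num

lemma circlePoint_zpow (t : ℝ) (j : ℤ) :
    (circlePoint t : ℂ) ^ j = Complex.exp (2 * Real.pi * Complex.I * j * t) := by
  rw [coe_circlePoint, ← Complex.exp_int_mul]
  congr 1; ring

lemma hasFourierDensity_of_isFourierDensityLaw {μ : Measure Circle} (h : IsFourierDensityLaw μ) :
    ∃ c : ℤ → ℂ, HasFourierDensity μ uniformCircleLaw ⊤ c Set.univ := by
  obtain ⟨g, c, hg0, hμ, hc, hc1, hsum⟩ := h
  have hval : ∀ t ∈ Set.Icc (0 : ℝ) 1, fourierPowerSum c 1 (circlePoint t) = g t := by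
    intro t ht
    rw [← (hsum t ht).tsum_eq]
    unfold fourierPowerSum
    refine tsum_congr fun j => ?_
    rw [circlePoint_zpow, pow_one]
  refine ⟨c, trivial, hc, fun j hj => absurd trivial hj, hc1, fun j _ k _ hkj => ?_,
    fun u _ => map_mul_uniformCircleLaw u, Eventually.of_forall fun w => trivial, fun w _ => ?_, ?_⟩
  · obtain ⟨u, hu⟩ := exists_circle_zpow_ne_one (sub_ne_zero.2 hkj)
    exact integral_zpow_eq_zero (map_mul_uniformCircleLaw u) hu
  · obtain ⟨t, ht, rfl⟩ := exists_circlePoint_eq w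
    exact ⟨g t, hg0 t ⟨ht.1.le, ht.2⟩, hval t ⟨ht.1.le, ht.2⟩⟩
  · have hcont : Continuous (fourierPowerSum c 1) := by
      unfold fourierPowerSum
      refine continuous_tsum (fun j => (continuous_circle_zpow j).const_mul _) hc fun j w => ?_
      rw [norm_mul, norm_circle_zpow, mul_one, pow_one]
    have hmeas : Measurable fun w => ENNReal.ofReal (fourierPowerSum c 1 w).re :=
      (Complex.measurable_re.comp hcont.measurable).ennreal_ofReal
    rw [hμ]
    unfold circleDensityLaw uniformCircleLaw
    refine Measure.ext fun s hs => ?_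
    rw [Measure.map_apply measurable_circlePoint hs, withDensity_apply _ hs,
      withDensity_apply _ (measurable_circlePoint hs),
      setLIntegral_map hs hmeas measurable_circlePoint]
    refine setLIntegral_congr_fun_ae (measurable_circlePoint hs) ?_
    filter_upwards [ae_restrict_mem measurableSet_Icc] with t ht _
    rw [hval t ht, Complex.ofReal_re]

/-- Makes the uniform case an instance of the second condition, with the constant density 1. -/
lemma isFourierDensityLaw_uniformCircleLaw : IsFourierDensityLaw uniformCircleLaw := by
  refine ⟨fun _ => 1, fun j => if j = 0 then 1 else 0, by simp, ?_, ?_, ?_, ?_⟩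
  · unfold uniformCircleLaw circleDensityLaw
    simp
  · refine summable_of_ne_finset_zero (s := {0}) fun j hj => ?_
    simp at hj; simp [hj]
  · intro j hj; simp [hj]
  · intro φ _
    have h := hasSum_single (f := fun j : ℤ => (if j = 0 then (1 : ℂ) else 0) *
      Complex.exp (2 * Real.pi * Complex.I * j * φ)) 0 (fun j hj => by simp [hj])
    rw [if_pos rfl, Int.cast_zero, mul_zero, zero_mul, Complex.exp_zero, mul_one] at h
    simpa only [Complex.ofReal_one] using h

/-! ### Roots of unity and discrete laws -/

open scoped Classical in
/-- The `ρ`-th roots of unity on the circle. -/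
def circleRoots (ρ : ℕ) : Finset Circle :=
  (Finset.Icc 1 ρ).image fun k : ℕ => circlePoint ((k : ℝ) / ρ)

/-- The subgroup of the `ρ`-th roots of unity. -/
def circleRootsSubgroup (ρ : ℕ) : Subgroup Circle := (powMonoidHom ρ : Circle →* Circle).ker

lemma circlePoint_pow (t : ℝ) (n : ℕ) : circlePoint t ^ n = circlePoint (n * t) := by
  induction n with
  | zero =>
    have := circlePoint_intCast 0
    simpa using this.symm
  | succ n ih => rw [pow_succ, ih, ← circlePoint_add]; congr 1; push_cast; ring

lemma circlePoint_eq_one_iff {t : ℝ} : circlePoint t = 1 ↔ ∃ k : ℤ, t = k := by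
  constructor
  · intro h
    refine ⟨⌊t⌋, ?_⟩
    by_contra hne
    have h1 : Int.fract t ∈ Set.Ioo (0 : ℝ) 1 := by
      refine ⟨lt_of_le_of_ne (Int.fract_nonneg t) fun h0 => hne ?_, Int.fract_lt_one t⟩
      have := Int.fract_add_floor t
      rw [← h0, zero_add] at this
      exact this.symm
    refine circlePoint_ne_one h1 ?_
    rw [← h]
    conv_rhs => rw [← Int.fract_add_floor t, circlePoint_add_int]
  · rintro ⟨k, rfl⟩
    exact circlePoint_intCast k

lemma mem_circleRoots {ρ : ℕ} (hρ : 0 < ρ) {w : Circle} : w ∈ circleRoots ρ ↔ w ^ ρ = 1 := by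
  classical
  have hρ0 : (0 : ℝ) < ρ := by exact_mod_cast hρ
  unfold circleRoots
  rw [Finset.mem_image]
  constructor
  · rintro ⟨k, -, rfl⟩
    rw [circlePoint_pow, mul_div_cancel₀ _ hρ0.ne']
    exact_mod_cast circlePoint_intCast k
  · intro h
    obtain ⟨t, ht, rfl⟩ := exists_circlePoint_eq w
    rw [circlePoint_pow, circlePoint_eq_one_iff] at h
    obtain ⟨k, hk⟩ := h
    have hk0 : (0 : ℝ) < k := by rw [← hk]; exact mul_pos hρ0 ht.1
    have hk1 : (k : ℝ) ≤ ρ := by rw [← hk]; nlinarith [ht.2]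
    have hk0' : 0 < k := by exact_mod_cast hk0
    have hk1' : k ≤ ρ := by exact_mod_cast hk1
    refine ⟨k.toNat, by simp; omega, ?_⟩
    have : ((k.toNat : ℕ) : ℝ) = (k : ℝ) := by
      have : ((k.toNat : ℕ) : ℤ) = k := Int.toNat_of_nonneg hk0'.le
      exact_mod_cast congrArg (Int.cast : ℤ → ℝ) this
    rw [this, ← hk, mul_div_cancel_left₀ _ hρ0.ne']

lemma circlePoint_div_injOn {ρ : ℕ} (hρ : 0 < ρ) :
    Set.InjOn (fun k : ℕ => circlePoint ((k : ℝ) / ρ)) (Finset.Icc 1 ρ) := by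
  intro a ha b hb hab
  have hρ0 : (0 : ℝ) < ρ := by exact_mod_cast hρ
  simp only [Finset.coe_Icc, Set.mem_Icc] at ha hb
  simp only at hab
  have h1 : circlePoint ((a : ℝ) / ρ - b / ρ) = 1 := by
    have h2 := circlePoint_add ((a : ℝ) / ρ - b / ρ) (b / ρ)
    rw [sub_add_cancel, hab] at h2
    exact (right_eq_mul.1 h2)
  rw [circlePoint_eq_one_iff] at h1
  obtain ⟨k, hk⟩ := h1
  rw [← sub_div, div_eq_iff hρ0.ne'] at hk
  have hk' : (a : ℤ) - b = k * ρ := by exact_mod_cast hk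
  have h3 : (ρ : ℤ) ∣ (a : ℤ) - b := ⟨k, by rw [hk']; ring⟩
  have h4 := Int.eq_zero_of_abs_lt_dvd h3 (by rw [abs_lt]; constructor <;> omega)
  omega

lemma sum_circleRoots {M : Type*} [AddCommMonoid M] {ρ : ℕ} (hρ : 0 < ρ) (f : Circle → M) :
    ∑ w ∈ circleRoots ρ, f w = ∑ k ∈ Finset.Icc 1 ρ, f (circlePoint ((k : ℝ) / ρ)) := by
  classical
  exact Finset.sum_image (circlePoint_div_injOn hρ)

lemma card_circleRoots {ρ : ℕ} (hρ : 0 < ρ) : (circleRoots ρ).card = ρ := by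
  classical
  unfold circleRoots
  rw [Finset.card_image_of_injOn (circlePoint_div_injOn hρ)]
  simp

/-- The uniform distribution on the `ρ`-th roots of unity. -/
def uniformRootsLaw (ρ : ℕ) : Measure Circle :=
  ∑ w ∈ circleRoots ρ, (ENNReal.ofReal (1 / ρ)) • Measure.dirac w

lemma isProbabilityMeasure_uniformRootsLaw {ρ : ℕ} (hρ : 0 < ρ) :
    IsProbabilityMeasure (uniformRootsLaw ρ) := by
  have hρ0 : (0 : ℝ) < ρ := by exact_mod_cast hρ
  refine ⟨?_⟩
  unfold uniformRootsLaw
  rw [Measure.finsetSum_apply]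
  simp only [Measure.smul_apply, measure_univ, smul_eq_mul, mul_one, Finset.sum_const,
    card_circleRoots hρ, nsmul_eq_mul]
  rw [← ENNReal.ofReal_natCast, ← ENNReal.ofReal_mul hρ0.le, mul_one_div_cancel hρ0.ne',
    ENNReal.ofReal_one]

lemma integrable_uniformRootsLaw {ρ : ℕ} (f : Circle → ℝ) : Integrable f (uniformRootsLaw ρ) := by
  unfold uniformRootsLaw
  rw [integrable_finsetSum_measure]
  intro w _
  exact (integrable_dirac (by simp)).smul_measure ENNReal.ofReal_ne_top

lemma integral_uniformRootsLaw {E : Type*} [NormedAddCommGroup E] [NormedSpace ℝ E]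
    [CompleteSpace E] {ρ : ℕ} (f : Circle → E) :
    ∫ w, f w ∂uniformRootsLaw ρ = (1 / ρ : ℝ) • ∑ w ∈ circleRoots ρ, f w := by
  unfold uniformRootsLaw
  rw [integral_finsetSum_measure]
  · rw [Finset.smul_sum]
    refine Finset.sum_congr rfl fun w _ => ?_
    rw [integral_smul_measure, integral_dirac, ENNReal.toReal_ofReal (by positivity)]
  · intro w _
    exact (integrable_dirac (by simp)).smul_measure ENNReal.ofReal_ne_top

lemma map_mul_uniformRootsLaw {ρ : ℕ} (hρ : 0 < ρ) {u : Circle} (hu : u ^ ρ = 1) :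
    (uniformRootsLaw ρ).map (u * ·) = uniformRootsLaw ρ := by
  have hm : Measurable (u * · : Circle → Circle) := by fun_prop
  unfold uniformRootsLaw
  rw [← Measure.mapₗ_apply_of_measurable hm, map_sum]
  simp only [Measure.mapₗ_apply_of_measurable hm, Measure.map_smul, Measure.map_dirac' hm]
  refine Finset.sum_bij' (fun w _ => u * w) (fun w _ => u⁻¹ * w) ?_ ?_ ?_ ?_ ?_
  · intro w hw
    rw [mem_circleRoots hρ] at hw ⊢
    rw [mul_pow, hu, hw, one_mul]
  · intro w hw
    rw [mem_circleRoots hρ] at hw ⊢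
    rw [mul_pow, inv_pow, hu, hw, inv_one, one_mul]
  · intro w _; simp
  · intro w _; simp
  · intro w _; rfl

lemma measure_eq_sum_circleRoots {ρ : ℕ} (hρ : 0 < ρ) {μ : Measure Circle} [IsProbabilityMeasure μ]
    (h : ∀ᵐ w ∂μ, w ^ ρ = 1) :
    μ = ∑ w ∈ circleRoots ρ, ENNReal.ofReal (μ.real {w}) • Measure.dirac w := by
  ext s hs
  rw [Measure.finsetSum_apply]
  have h1 : μ s = μ (s ∩ circleRoots ρ) := by
    refine measure_congr ?_
    filter_upwards [h] with w hw
    rw [← mem_circleRoots hρ] at hw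
    exact propext ⟨fun h => ⟨h, hw⟩, fun h => h.1⟩
  classical
  have h2 : s ∩ circleRoots ρ = ((circleRoots ρ).filter (· ∈ s) : Finset Circle) := by
    ext w; simp [and_comm]
  rw [h1, h2, ← sum_measure_singleton, Finset.sum_filter]
  refine Finset.sum_congr rfl fun w _ => ?_
  rw [Measure.smul_apply, Measure.dirac_apply' _ hs, ofReal_measureReal]
  by_cases hw : w ∈ s <;> simp [hw]

/-- The coefficients are extended by zero outside `J = {0, …, ρ - 1}`. Restricting to `J` is
essential for orthogonality: characters whose indices agree modulo ρ coincide on the ρ-th roots of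
unity. Relative to the uniform law on the roots, the density at w is ρ times the mass of w. -/
lemma hasFourierDensity_of_isDiscreteFourierLaw {μ : Measure Circle} [IsProbabilityMeasure μ]
    (h : IsDiscreteFourierLaw μ) :
    ∃ ρ : ℕ, 0 < ρ ∧ ∃ (c : ℤ → ℂ) (J : Set ℤ),
      HasFourierDensity μ (uniformRootsLaw ρ) (circleRootsSubgroup ρ) c J := by
  obtain ⟨ρ, hρ, hae, c, hc1, hmass⟩ := h
  have hρ0 : (0 : ℝ) < ρ := by exact_mod_cast hρ
  have hρC : (ρ : ℂ) ≠ 0 := by exact_mod_cast hρ.ne'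
  set d : ℤ → ℂ := fun j => if 0 ≤ j ∧ j < ρ then c j.toNat else 0 with hd
  have hsum : ∀ w : Circle, fourierPowerSum d 1 w = ∑ j ∈ Finset.range ρ, c j * (w : ℂ) ^ j := by
    intro w
    unfold fourierPowerSum
    have hinj : Set.InjOn (fun j : ℕ => (j : ℤ)) (Finset.range ρ) := fun a _ b _ hab =>
      Int.ofNat_inj.1 hab
    rw [tsum_eq_sum (s := (Finset.range ρ).image fun j : ℕ => (j : ℤ)), Finset.sum_image hinj]
    · refine Finset.sum_congr rfl fun j hj => ?_
      have hj' := Finset.mem_range.1 hj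
      have : d j = c j := by
        simp only [hd]; rw [if_pos ⟨by positivity, by exact_mod_cast hj'⟩]; simp
      rw [this, pow_one, zpow_natCast]
    · intro j hj
      have : d j = 0 := by
        simp only [hd]
        rw [if_neg]
        rintro ⟨h0, h1⟩
        refine hj (Finset.mem_image.2 ⟨j.toNat, ?_, ?_⟩)
        · simp; omega
        · simp [h0]
      rw [this]; simp
  have hdens : ∀ w ∈ circleRoots ρ, fourierPowerSum d 1 w = ((ρ * μ.real {w} : ℝ) : ℂ) := by
    intro w hw
    classical
    obtain ⟨k, hk, rfl⟩ := Finset.mem_image.1 (by unfold circleRoots at hw; exact hw)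
    have hk' := Finset.mem_Icc.1 hk
    rw [Complex.ofReal_mul, hmass k hk'.1 hk'.2, hsum]
    push_cast
    rw [← mul_assoc, mul_one_div_cancel hρC, one_mul]
    refine Finset.sum_congr rfl fun j _ => ?_
    congr 1
    rw [← zpow_natCast, circlePoint_zpow]
    congr 1
    push_cast
    ring
  refine ⟨ρ, hρ, d, {j | 0 ≤ j ∧ j < ρ}, ⟨le_rfl, by exact_mod_cast hρ⟩, ?_, ?_, ?_, ?_, ?_, ?_, ?_, ?_⟩
  · refine summable_of_ne_finset_zero (s := Finset.Ico 0 (ρ : ℤ)) fun j hj => ?_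
    rw [norm_eq_zero]
    exact if_neg (by simpa using hj)
  · intro j hj
    exact if_neg hj
  · intro j hj
    simp only [hd]
    split_ifs with h1
    · exact hc1 _ (by omega) (by omega)
    · simp
  · intro j hj k hk hkj
    have hu : circlePoint ((1 : ℝ) / ρ) ^ ρ = 1 := by
      rw [circlePoint_pow, mul_one_div_cancel hρ0.ne']
      exact_mod_cast circlePoint_intCast 1
    refine integral_zpow_eq_zero (map_mul_uniformRootsLaw hρ hu) ?_
    intro h1
    have h2 : circlePoint (((k - j : ℤ) : ℝ) / ρ) = 1 := by
      apply Circle.ext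
      rw [circlePoint_zpow] at h1
      rw [coe_circlePoint, Circle.coe_one, ← h1]
      congr 1
      push_cast
      ring
    rw [circlePoint_eq_one_iff] at h2
    obtain ⟨n, hn⟩ := h2
    rw [div_eq_iff hρ0.ne'] at hn
    have hn' : k - j = n * ρ := by exact_mod_cast hn
    have h3 : (ρ : ℤ) ∣ k - j := ⟨n, by rw [hn']; ring⟩
    simp only [Set.mem_ofPred_eq] at hj hk
    have h4 := Int.eq_zero_of_abs_lt_dvd h3 (by rw [abs_lt]; constructor <;> omega)
    omega
  · intro u hu
    exact map_mul_uniformRootsLaw hρ hu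
  · unfold uniformRootsLaw
    rw [ae_finsetSum_measure_iff]
    intro w hw
    refine Measure.ae_smul_measure ?_ _
    rw [ae_dirac_eq]
    exact (mem_circleRoots hρ).1 hw
  · intro w hw
    exact ⟨ρ * μ.real {w}, by positivity, hdens w ((mem_circleRoots hρ).2 hw)⟩
  · conv_lhs => rw [measure_eq_sum_circleRoots hρ hae]
    have hmeas : Measurable fun w => ENNReal.ofReal (fourierPowerSum d 1 w).re := by
      have : Continuous fun w : Circle => ∑ j ∈ Finset.range ρ, c j * (w : ℂ) ^ j := by fun_prop
      simp only [hsum]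
      exact (Complex.measurable_re.comp this.measurable).ennreal_ofReal
    ext s hs
    rw [withDensity_apply _ hs, ← lintegral_indicator hs]
    unfold uniformRootsLaw
    rw [lintegral_finsetSum_measure, Measure.finsetSum_apply]
    refine Finset.sum_congr rfl fun w hw => ?_
    rw [lintegral_smul_measure, lintegral_dirac' _ (hmeas.indicator hs), Measure.smul_apply, Measure.dirac_apply' _ hs]
    by_cases hws : w ∈ s
    · rw [Set.indicator_of_mem hws, Set.indicator_of_mem hws, hdens w hw, Complex.ofReal_re]
      simp only [Pi.one_apply, smul_eq_mul, mul_one]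
      rw [← ENNReal.ofReal_mul (by positivity)]
      congr 1
      field_simp
    · rw [Set.indicator_of_notMem hws, Set.indicator_of_notMem hws]
      simp

/-! ### Averages of moments along the powers of `x` -/

/-- A measurable function on the circle with at most a logarithmic singularity, at `1`. -/
def MildlySingular (h : Circle → ℝ) : Prop :=
  Measurable h ∧ ∀ β : ℝ, 0 < β → β ≤ 1 → ∃ A, EdgeSingular β A fun t => h (circlePoint t)

namespace MildlySingular

variable {h k : Circle → ℝ}

/-- Since every positive exponent is allowed, each factor may use β/2; a fixed exponent would not be
stable under products. -/
lemma mul (hh : MildlySingular h) (hk : MildlySingular k) : MildlySingular fun w => h w * k w := by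
  refine ⟨hh.1.mul hk.1, fun β hβ hβ1 => ?_⟩
  obtain ⟨A, hA⟩ := hh.2 (β / 2) (by positivity) (by linarith)
  obtain ⟨B, hB⟩ := hk.2 (β / 2) (by positivity) (by linarith)
  have := hA.mul hB (by positivity) (by positivity)
  rw [add_halves] at this
  exact ⟨_, this⟩

lemma abs (hh : MildlySingular h) : MildlySingular fun w => |h w| := by
  refine ⟨by have := hh.1; fun_prop, fun β hβ hβ1 => ?_⟩
  obtain ⟨A, hA⟩ := hh.2 β hβ hβ1
  exact ⟨A, hA.abs⟩

lemma reLog : MildlySingular reLog :=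
  ⟨measurable_reLog, fun _ hβ hβ1 => ⟨_, edgeSingular_reLog hβ hβ1⟩⟩

lemma imLog : MildlySingular imLog :=
  ⟨measurable_imLog, fun _ hβ _ => ⟨_, edgeSingular_imLog hβ.le⟩⟩

lemma integrable_uniform (hh : MildlySingular h) : Integrable h uniformCircleLaw := by
  obtain ⟨A, hA⟩ := hh.2 (1 / 2) (by norm_num) (by norm_num)
  rw [integrable_uniformCircleLaw_iff hh.1]
  exact hA.intervalIntegrable (hh.1.comp measurable_circlePoint) (by norm_num)

end MildlySingular

/-- The expectation of `h (x⁻ᵐ T)`, where `T` is a product of `m` independent variables of law `μ`. -/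
def rotatedMean (x : Circle) (μ : Measure Circle) (h : Circle → ℝ) (m : ℕ) : ℝ :=
  ∫ w, h ((x ^ m)⁻¹ * w) ∂(productLaw μ m)

/-- The expectations of `h (x⁻ᵐ T)` average to the mean of `h` over the circle, with a power
saving. -/
structure AsymptoticMean (x : Circle) (μ : Measure Circle) (h : Circle → ℝ) : Prop where
  integrable : ∀ m : ℕ, Integrable (fun w => h ((x ^ (m + 1))⁻¹ * w)) (productLaw μ (m + 1))
  bound : ∃ C κ : ℝ, 0 < κ ∧ ∀ n : ℕ, 0 < n →
    |∑ i ∈ Finset.range n, (rotatedMean x μ h (i + 1) - ∫ t in (0 : ℝ)..1, h (circlePoint t))| ≤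
      C * (n : ℝ) ^ (1 - κ)

/-- Passing from the law of T_m to `U` costs a geometric factor q^i times the absolute moment under
`U`. That moment may even grow linearly, since ∑ (i + 1) q^i converges; so the total cost is bounded
and only averages under `U` remain. -/
lemma AsymptoticMean.of_hasFourierDensity {μ U : Measure Circle} {S : Subgroup Circle} {c : ℤ → ℂ}
    {J : Set ℤ} [IsProbabilityMeasure U] [IsProbabilityMeasure μ] (hd : HasFourierDensity μ U S c J)
    {x : Circle} {h : Circle → ℝ} {κ C C' : ℝ} (hκ0 : 0 < κ) (hκ1 : κ ≤ 1)
    (hint : ∀ m : ℕ, Integrable (fun w => h ((x ^ (m + 1))⁻¹ * w)) U)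
    (hU : ∀ n : ℕ, 0 < n → |∑ i ∈ Finset.range n, (∫ w, h ((x ^ (i + 1))⁻¹ * w) ∂U -
      ∫ t in (0 : ℝ)..1, h (circlePoint t))| ≤ C * (n : ℝ) ^ (1 - κ))
    (habs : ∀ i : ℕ, ∫ w, |h ((x ^ (i + 1))⁻¹ * w)| ∂U ≤ C' * (i + 1 : ℕ)) :
    AsymptoticMean x μ h := by
  obtain ⟨q, hq0, hq1, hq⟩ := hd.exists_norm_le
  have hC' : 0 ≤ C' := by
    have h1 := habs 0
    have h2 : 0 ≤ ∫ w, |h ((x ^ (0 + 1))⁻¹ * w)| ∂U := integral_nonneg fun w => abs_nonneg _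
    push_cast at h1
    linarith
  have hc0 : 0 ≤ ∑' j, ‖c j‖ := tsum_nonneg fun j => norm_nonneg _
  have hsum : Summable fun i : ℕ => ((i : ℝ) + 1) * q ^ i := by
    have h1 := summable_pow_mul_geometric_of_norm_lt_one (R := ℝ) 1 (r := q)
      (by rwa [Real.norm_of_nonneg hq0.le])
    have h2 := summable_geometric_of_lt_one hq0.le hq1
    refine (h1.add h2).congr fun i => ?_
    rw [pow_one]; ring
  set D : ℝ := (∑' j, ‖c j‖) * C' * ∑' i : ℕ, ((i : ℝ) + 1) * q ^ i with hD
  have hD0 : 0 ≤ D := by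
    have : 0 ≤ ∑' i : ℕ, ((i : ℝ) + 1) * q ^ i := tsum_nonneg fun i => by positivity
    positivity
  refine ⟨fun m => hd.integrable_productLaw m (hint m), C + D, κ, hκ0, fun n hn => ?_⟩
  have hdiff : ∀ i : ℕ, |rotatedMean x μ h (i + 1) - ∫ w, h ((x ^ (i + 1))⁻¹ * w) ∂U| ≤
      (∑' j, ‖c j‖) * C' * (((i : ℝ) + 1) * q ^ i) := by
    intro i
    refine (hd.abs_integral_productLaw_sub_le hq0 hq i (hint i)).trans ?_
    calc _ ≤ (∑' j, ‖c j‖) * q ^ i * (C' * (i + 1 : ℕ)) := by gcongr; exact habs i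
      _ = _ := by push_cast; ring
  have e : ∑ i ∈ Finset.range n, (rotatedMean x μ h (i + 1) - ∫ t in (0 : ℝ)..1, h (circlePoint t)) =
      ∑ i ∈ Finset.range n, (∫ w, h ((x ^ (i + 1))⁻¹ * w) ∂U -
        ∫ t in (0 : ℝ)..1, h (circlePoint t)) +
      ∑ i ∈ Finset.range n, (rotatedMean x μ h (i + 1) - ∫ w, h ((x ^ (i + 1))⁻¹ * w) ∂U) := by
    rw [← Finset.sum_add_distrib]
    exact Finset.sum_congr rfl fun i _ => by ring
  have h1 : (1 : ℝ) ≤ (n : ℝ) ^ (1 - κ) :=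
    Real.one_le_rpow (by exact_mod_cast hn) (by linarith)
  have h2 : |∑ i ∈ Finset.range n, (rotatedMean x μ h (i + 1) -
      ∫ w, h ((x ^ (i + 1))⁻¹ * w) ∂U)| ≤ D := by
    refine (Finset.abs_sum_le_sum_abs _ _).trans ((Finset.sum_le_sum fun i _ => hdiff i).trans ?_)
    rw [← Finset.mul_sum, hD]
    gcongr
    exact hsum.sum_le_tsum _ fun i _ => by positivity
  rw [e]
  refine (abs_add_le _ _).trans ?_
  have h3 := hU n hn
  nlinarith

/-- Here `U` is rotation invariant, so its rotated means equal the integral exactly and the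
averaging error is zero. -/
lemma AsymptoticMean.of_isFourierDensityLaw {μ : Measure Circle} [IsProbabilityMeasure μ]
    (hμ : IsFourierDensityLaw μ) (x : Circle) {h : Circle → ℝ} (hh : MildlySingular h) :
    AsymptoticMean x μ h := by
  obtain ⟨c, hd⟩ := hasFourierDensity_of_isFourierDensityLaw hμ
  have hint : ∀ (k : Circle → ℝ) (u : Circle), MildlySingular k →
      Integrable (fun w => k (u * w)) uniformCircleLaw := by
    intro k u hk
    have h1 := hk.integrable_uniform
    rw [← map_mul_uniformCircleLaw u] at h1
    exact h1.comp_measurable (by fun_prop)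
  have hval : ∀ (k : Circle → ℝ) (u : Circle), MildlySingular k →
      ∫ w, k (u * w) ∂uniformCircleLaw = ∫ t in (0 : ℝ)..1, k (circlePoint t) := by
    intro k u hk
    rw [← integral_uniformCircleLaw hk.1.aestronglyMeasurable]
    conv_rhs => rw [← map_mul_uniformCircleLaw u]
    rw [integral_map (by fun_prop) hk.1.aestronglyMeasurable]
  refine AsymptoticMean.of_hasFourierDensity hd (κ := 1) (C := 0)
    (C' := ∫ t in (0 : ℝ)..1, |h (circlePoint t)|) one_pos le_rfl (fun m => hint h _ hh)
    (fun n _ => ?_) (fun i => ?_)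
  · simp [hval h _ hh]
  · rw [hval (fun w => |h w|) _ hh.abs]
    refine le_mul_of_one_le_right ?_ ?_
    · exact intervalIntegral.integral_nonneg zero_le_one fun t _ => abs_nonneg _
    · push_cast; linarith [(Nat.cast_nonneg i : (0 : ℝ) ≤ i)]

lemma distToInt_le (a : ℝ) (j : ℤ) : distToInt a ≤ |a - j| :=
  ciInf_le ⟨0, by rintro _ ⟨j, rfl⟩; exact abs_nonneg _⟩ j

lemma edgeDist_fract_ge {y δ : ℝ} (h : ∀ n : ℤ, δ ≤ |y - n|) : δ ≤ edgeDist (Int.fract y) := by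
  unfold edgeDist
  have h0 := Int.fract_nonneg y
  have h1 := Int.fract_lt_one y
  have e : Int.fract y = y - ⌊y⌋ := rfl
  refine le_min ?_ ?_
  · have := h ⌊y⌋
    rwa [← e, abs_of_nonneg h0] at this
  · have := h (⌊y⌋ + 1)
    rw [abs_sub_comm, abs_of_nonneg (by push_cast; linarith)] at this
    push_cast at this
    linarith

/-- The mean over the roots of unity is the average over k of h at the points k/ρ - mφ, that is, of
ρ orbits of the rotation by -φ. The exponent κ depends on x only, not on h. -/
lemma exists_sum_rotation_roots {x : Circle} (hx : IsFiniteType x) {ρ : ℕ} (hρ : 0 < ρ) :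
    ∃ κ : ℝ, 0 < κ ∧ κ ≤ 1 ∧ ∀ h : Circle → ℝ, MildlySingular h → ∃ C : ℝ, ∀ n : ℕ, 0 < n →
      |∑ i ∈ Finset.range n, (∫ w, h ((x ^ (i + 1))⁻¹ * w) ∂uniformRootsLaw ρ -
        ∫ t in (0 : ℝ)..1, h (circlePoint t))| ≤ C * (n : ℝ) ^ (1 - κ) := by
  obtain ⟨φ, -, rfl, K, hK, γ, hγ, hφ⟩ := hx
  have hρ0 : (0 : ℝ) < ρ := by exact_mod_cast hρ
  have hρ1 : (1 : ℝ) ≤ ρ := by exact_mod_cast hρ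
  have hγ0 : 0 < γ := by linarith
  refine ⟨3 / (8 * γ), by positivity, ?_, fun h hh => ?_⟩
  · rw [div_le_one (by positivity)]; linarith
  have hγβ : 1 / (8 * γ ^ 2) ≤ 1 := by
    rw [div_le_one (by positivity)]; nlinarith
  obtain ⟨A, hA⟩ := hh.2 (1 / (8 * γ ^ 2)) (by positivity) hγβ
  have hK' : 0 < K / (ρ : ℝ) ^ (γ + 1) := by positivity
  have hdioph : ∀ q : ℕ, 0 < q → ∀ p : ℤ, K / (q : ℝ) ^ γ ≤ |q * φ - p| := by
    intro q hq p
    have h1 := hφ q (by exact_mod_cast hq.ne')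
    rw [Int.cast_natCast, Nat.abs_cast] at h1
    exact h1.trans (distToInt_le _ p)
  have hKK : K / (ρ : ℝ) ^ (γ + 1) ≤ K :=
    div_le_self hK.le (Real.one_le_rpow hρ1 (by linarith))
  have key : ∀ k : ℕ, ∃ C : ℝ, ∀ n : ℕ, 0 < n →
      |∑ i ∈ Finset.range n, h (circlePoint ((k : ℝ) / ρ + (i + 1 : ℕ) * (-φ))) -
        n * ∫ t in (0 : ℝ)..1, h (circlePoint t)| ≤ C * (n : ℝ) ^ (1 - 3 / (8 * γ)) := by
    intro k
    refine hA.exists_abs_sum_rotation_sub_le hγ (hh.1.comp measurable_circlePoint)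
      (fun t j => by rw [circlePoint_add_int]) hK' (fun q hq p => ?_) (fun j hj => ?_)
    · have h1 := hdioph q hq (-p)
      have e : |(q : ℝ) * -φ - p| = |q * φ - (-p : ℤ)| := by
        rw [← abs_neg]; congr 1; push_cast; ring
      rw [e]
      refine le_trans ?_ h1
      gcongr
    · refine edgeDist_fract_ge fun n => ?_
      have hj0 : (0 : ℝ) < j := by exact_mod_cast hj
      -- Multiplying k/ρ - jφ - n by ρ clears the denominator, so finite type at the integer ρj
      -- keeps the orbit away from 1; the constant becomes K / ρ^(γ+1).
      have h1 := hdioph (ρ * j) (Nat.mul_pos hρ hj) (k - ρ * n)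
      have e : |(ρ * j : ℕ) * φ - ((k - ρ * n : ℤ) : ℝ)| = ρ * |(k : ℝ) / ρ + j * -φ - n| := by
        rw [← abs_of_pos hρ0, ← abs_mul, abs_of_pos hρ0, ← abs_neg]
        congr 1
        push_cast
        field_simp
        ring
      rw [e] at h1
      push_cast at h1
      rw [Real.mul_rpow hρ0.le hj0.le, mul_comm (ρ : ℝ) |_|, ← div_le_iff₀ hρ0] at h1
      refine le_trans (le_of_eq ?_) h1
      rw [Real.rpow_add hρ0, Real.rpow_one]
      field_simp
  choose C hC using key
  refine ⟨(1 / ρ : ℝ) * ∑ k ∈ Finset.Icc 1 ρ, C k, fun n hn => ?_⟩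
  have e : ∑ i ∈ Finset.range n, (∫ w, h ((circlePoint φ ^ (i + 1))⁻¹ * w) ∂uniformRootsLaw ρ -
      ∫ t in (0 : ℝ)..1, h (circlePoint t)) = (1 / ρ : ℝ) * ∑ k ∈ Finset.Icc 1 ρ,
      (∑ i ∈ Finset.range n, h (circlePoint ((k : ℝ) / ρ + (i + 1 : ℕ) * (-φ))) -
        n * ∫ t in (0 : ℝ)..1, h (circlePoint t)) := by
    have h1 : ∀ i : ℕ, ∫ w, h ((circlePoint φ ^ (i + 1))⁻¹ * w) ∂uniformRootsLaw ρ =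
        (1 / ρ : ℝ) * ∑ k ∈ Finset.Icc 1 ρ, h (circlePoint ((k : ℝ) / ρ + (i + 1 : ℕ) * (-φ))) := by
      intro i
      rw [integral_uniformRootsLaw, smul_eq_mul, sum_circleRoots hρ]
      congr 1
      refine Finset.sum_congr rfl fun k _ => ?_
      congr 1
      have h2 : circlePoint ((i + 1 : ℕ) * (-φ)) = (circlePoint φ ^ (i + 1))⁻¹ := by
        rw [eq_inv_iff_mul_eq_one, circlePoint_pow, ← circlePoint_add, circlePoint_eq_one_iff]
        exact ⟨0, by push_cast; ring⟩
      rw [circlePoint_add, h2, mul_comm]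
    simp only [h1]
    rw [Finset.sum_sub_distrib, ← Finset.mul_sum, Finset.sum_comm, Finset.sum_sub_distrib, mul_sub]
    simp only [Finset.sum_const, Finset.card_range, Nat.card_Icc, Nat.add_sub_cancel, nsmul_eq_mul]
    rw [← mul_assoc (1 / ρ : ℝ) (ρ : ℝ), one_div_mul_cancel hρ0.ne', one_mul]
  rw [e, abs_mul, abs_of_pos (by positivity), mul_assoc, Finset.sum_mul]
  gcongr
  exact (Finset.abs_sum_le_sum_abs _ _).trans (Finset.sum_le_sum fun k _ => hC k n hn)

lemma AsymptoticMean.of_isDiscreteFourierLaw {μ : Measure Circle} [IsProbabilityMeasure μ]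
    (hμ : IsDiscreteFourierLaw μ) {x : Circle} (hx : IsFiniteType x) {h : Circle → ℝ}
    (hh : MildlySingular h) : AsymptoticMean x μ h := by
  obtain ⟨ρ, hρ, c, J, hd⟩ := hasFourierDensity_of_isDiscreteFourierLaw hμ
  have := isProbabilityMeasure_uniformRootsLaw hρ
  obtain ⟨κ, hκ0, hκ1, hκ⟩ := exists_sum_rotation_roots hx hρ
  obtain ⟨C, hC⟩ := hκ h hh
  obtain ⟨C', hC'⟩ := hκ _ hh.abs
  set I : ℝ := ∫ t in (0 : ℝ)..1, |h (circlePoint t)| with hI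
  refine AsymptoticMean.of_hasFourierDensity hd (C' := |C'| + |I|) hκ0 hκ1
    (fun m => integrable_uniformRootsLaw _) hC (fun i => ?_)
  have h1 := hC' (i + 1) (Nat.succ_pos i)
  rw [Finset.sum_sub_distrib, Finset.sum_const, Finset.card_range, nsmul_eq_mul] at h1
  -- A single absolute moment is crudely bounded by the whole sum up to it, which grows at most
  -- linearly; this is all that is needed.
  have h2 : ∫ w, |h ((x ^ (i + 1))⁻¹ * w)| ∂uniformRootsLaw ρ ≤
      ∑ j ∈ Finset.range (i + 1), ∫ w, |h ((x ^ (j + 1))⁻¹ * w)| ∂uniformRootsLaw ρ :=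
    Finset.single_le_sum (f := fun j => ∫ w, |h ((x ^ (j + 1))⁻¹ * w)| ∂uniformRootsLaw ρ)
      (fun j _ => integral_nonneg fun w => abs_nonneg _) (Finset.self_mem_range_succ i)
  have h3 := (abs_le.1 h1).2
  have hi1 : (1 : ℝ) ≤ (i + 1 : ℕ) := by push_cast; linarith [(Nat.cast_nonneg i : (0 : ℝ) ≤ i)]
  have h4 : ((i + 1 : ℕ) : ℝ) ^ (1 - κ) ≤ (i + 1 : ℕ) := by
    conv_rhs => rw [← Real.rpow_one ((i + 1 : ℕ) : ℝ)]
    exact Real.rpow_le_rpow_of_exponent_le hi1 (by linarith)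
  have h5 : C' * ((i + 1 : ℕ) : ℝ) ^ (1 - κ) ≤ |C'| * (i + 1 : ℕ) := by
    have h6 : 0 ≤ ((i + 1 : ℕ) : ℝ) ^ (1 - κ) := by positivity
    calc _ ≤ |C'| * ((i + 1 : ℕ) : ℝ) ^ (1 - κ) := by gcongr; exact le_abs_self _
      _ ≤ _ := by gcongr
  have h7 : ((i + 1 : ℕ) : ℝ) * I ≤ (i + 1 : ℕ) * |I| := by gcongr; exact le_abs_self _
  linarith

theorem asymptoticMean {μ : Measure Circle} [IsProbabilityMeasure μ] {x : Circle}
    (hcond : μ = uniformCircleLaw ∨ IsFourierDensityLaw μ ∨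
      (IsDiscreteFourierLaw μ ∧ IsFiniteType x)) {h : Circle → ℝ} (hh : MildlySingular h) :
    AsymptoticMean x μ h := by
  rcases hcond with h1 | h1 | ⟨h1, h2⟩
  · exact .of_isFourierDensityLaw (h1 ▸ isFourierDensityLaw_uniformCircleLaw) x hh
  · exact .of_isFourierDensityLaw h1 x hh
  · exact .of_isDiscreteFourierLaw h1 h2 hh

/-! ### Harmonic sums and expansion of the characteristic functions -/

lemma norm_cexp_mul_I_sub_taylor_le (u : ℝ) :
    ‖Complex.exp (u * Complex.I) - 1 - u * Complex.I + u ^ 2 / 2‖ ≤ 4 * |u| ^ 3 := by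
  rcases le_total |u| 1 with hu | hu
  · have h1 := Complex.norm_exp_sub_sum_le_norm_mul_exp (u * Complex.I) 3
    have e : Complex.exp (u * Complex.I) - ∑ m ∈ Finset.range 3, (u * Complex.I) ^ m / m.factorial =
        Complex.exp (u * Complex.I) - 1 - u * Complex.I + u ^ 2 / 2 := by
      simp only [Finset.sum_range_succ, Finset.sum_range_zero, mul_pow, Complex.I_sq]
      simp [Nat.factorial]
      ring
    have h2 : ‖(u : ℂ) * Complex.I‖ = |u| := by simp
    rw [e, h2] at h1
    refine h1.trans ?_
    have h3 : Real.exp |u| ≤ 4 := (Real.exp_le_exp.2 hu).trans (by linarith [Real.exp_one_lt_d9])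
    rw [mul_comm]
    gcongr
  · have h1 : ‖Complex.exp (u * Complex.I)‖ = 1 := Complex.norm_exp_ofReal_mul_I u
    have h2 : ‖(u : ℂ) * Complex.I‖ = |u| := by simp
    have h3 : ‖(u : ℂ) ^ 2 / 2‖ = |u| ^ 2 / 2 := by simp
    have h4 : ‖Complex.exp (u * Complex.I) - 1 - u * Complex.I + u ^ 2 / 2‖ ≤
        1 + 1 + |u| + |u| ^ 2 / 2 := by
      refine (norm_add_le _ _).trans ?_
      rw [h3]
      gcongr
      refine (norm_sub_le _ _).trans ?_
      rw [h2]
      gcongr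
      refine (norm_sub_le _ _).trans ?_
      rw [h1, norm_one]
    refine h4.trans ?_
    have h5 : |u| ≤ |u| ^ 3 := le_self_pow₀ hu (by norm_num)
    have h6 : |u| ^ 2 ≤ |u| ^ 3 := pow_le_pow_right₀ hu (by norm_num)
    linarith

/-- Summation by parts: the partial sums S satisfy |S_{i+1}| / ((i + 1)(i + 2)) ≤ C (i + 1)^(-1-κ),
which is summable. -/
lemma exists_abs_sum_div_le {v : ℕ → ℝ} {C κ : ℝ} (hκ : 0 < κ)
    (h : ∀ n : ℕ, 0 < n → |∑ i ∈ Finset.range n, v i| ≤ C * (n : ℝ) ^ (1 - κ)) :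
    ∃ D : ℝ, ∀ n : ℕ, |∑ i ∈ Finset.range n, v i / (i + 1)| ≤ D := by
  have hC : 0 ≤ C := by
    have := h 1 one_pos
    simp only [Nat.cast_one, Real.one_rpow, mul_one] at this
    exact (abs_nonneg _).trans this
  set S : ℕ → ℝ := fun n => ∑ i ∈ Finset.range n, v i with hS
  have hparts : ∀ n : ℕ, ∑ i ∈ Finset.range n, v i / (i + 1) =
      S n / (n + 1) + ∑ i ∈ Finset.range n, S (i + 1) / ((i + 1) * (i + 2)) := by
    intro n
    induction n with
    | zero => simp [hS]
    | succ n ih =>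
      rw [Finset.sum_range_succ, Finset.sum_range_succ, ih]
      have e : v n = S (n + 1) - S n := by simp only [hS, Finset.sum_range_succ]; ring
      rw [e]
      push_cast
      have : (n : ℝ) + 1 ≠ 0 := by positivity
      have : (n : ℝ) + 1 + 1 ≠ 0 := by positivity
      have : (n : ℝ) + 2 ≠ 0 := by positivity
      field_simp
      ring
  have hsum : Summable fun i : ℕ => C * ((i + 1 : ℕ) : ℝ) ^ (-(1 + κ)) := by
    refine Summable.mul_left C ?_
    exact (summable_nat_add_iff 1).2 (Real.summable_nat_rpow.2 (by linarith))
  refine ⟨C + ∑' i : ℕ, C * ((i + 1 : ℕ) : ℝ) ^ (-(1 + κ)), fun n => ?_⟩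
  rw [hparts]
  refine (abs_add_le _ _).trans (add_le_add ?_ ?_)
  · rcases n.eq_zero_or_pos with rfl | hn
    · simpa [hS] using hC
    · have hn0 : (1 : ℝ) ≤ n := by exact_mod_cast hn
      rw [abs_div, abs_of_pos (by positivity : (0 : ℝ) < n + 1), div_le_iff₀ (by positivity)]
      refine (h n hn).trans ?_
      gcongr
      calc (n : ℝ) ^ (1 - κ) ≤ (n : ℝ) ^ (1 : ℝ) :=
            Real.rpow_le_rpow_of_exponent_le hn0 (by linarith)
        _ ≤ n + 1 := by rw [Real.rpow_one]; linarith
  · refine (Finset.abs_sum_le_sum_abs _ _).trans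
      ((Finset.sum_le_sum fun i _ => ?_).trans (hsum.sum_le_tsum (Finset.range n) fun i _ => by positivity))
    have h1 := h (i + 1) i.succ_pos
    have hi : (0 : ℝ) < (i + 1 : ℕ) := by positivity
    rw [abs_div, abs_of_pos (by positivity : (0 : ℝ) < (i + 1) * (i + 2)),
      div_le_iff₀ (by positivity)]
    refine h1.trans ?_
    rw [mul_assoc]
    gcongr
    have e : (1 - κ : ℝ) = -(1 + κ) + 2 := by ring
    rw [e, Real.rpow_add hi]
    gcongr
    rw [Real.rpow_two]
    push_cast
    nlinarith [(Nat.cast_nonneg i : (0 : ℝ) ≤ i)]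

lemma tendsto_sum_inv_div_log :
    Tendsto (fun n : ℕ => (∑ i ∈ Finset.range n, (1 : ℝ) / (i + 1)) / Real.log n) atTop (𝓝 1) := by
  have hlog : Tendsto (fun n : ℕ => Real.log n) atTop atTop :=
    Real.tendsto_log_atTop.comp tendsto_natCast_atTop_atTop
  have h1 := (Real.tendsto_harmonic_sub_log.div_atTop hlog).add_const 1
  rw [zero_add] at h1
  refine h1.congr' ?_
  filter_upwards [hlog.eventually_gt_atTop 0] with n hn
  have e : ((harmonic n : ℚ) : ℝ) = ∑ i ∈ Finset.range n, (1 : ℝ) / (i + 1) := by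
    simp [harmonic]
  rw [e]
  field_simp
  ring

namespace AsymptoticMean

variable {x : Circle} {μ : Measure Circle} {h : Circle → ℝ}

lemma exists_abs_sum_div_sub_le (hh : AsymptoticMean x μ h) :
    ∃ D : ℝ, ∀ n : ℕ, |∑ i ∈ Finset.range n, rotatedMean x μ h (i + 1) / (i + 1) -
      (∫ t in (0 : ℝ)..1, h (circlePoint t)) * ∑ i ∈ Finset.range n, (1 : ℝ) / (i + 1)| ≤ D := by
  obtain ⟨C, κ, hκ, hC⟩ := hh.bound
  obtain ⟨D, hD⟩ := exists_abs_sum_div_le hκ hC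
  refine ⟨D, fun n => ?_⟩
  rw [Finset.mul_sum, ← Finset.sum_sub_distrib]
  refine le_of_eq_of_le ?_ (hD n)
  congr 1
  exact Finset.sum_congr rfl fun i _ => by ring

lemma tendsto_sum_div_log (hh : AsymptoticMean x μ h) :
    Tendsto (fun n : ℕ => (∑ i ∈ Finset.range n, rotatedMean x μ h (i + 1) / (i + 1)) / Real.log n)
      atTop (𝓝 (∫ t in (0 : ℝ)..1, h (circlePoint t))) := by
  obtain ⟨D, hD⟩ := hh.exists_abs_sum_div_sub_le
  have hlog : Tendsto (fun n : ℕ => Real.log n) atTop atTop :=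
    Real.tendsto_log_atTop.comp tendsto_natCast_atTop_atTop
  have h1 : Tendsto (fun n : ℕ => (∑ i ∈ Finset.range n, rotatedMean x μ h (i + 1) / (i + 1) -
      (∫ t in (0 : ℝ)..1, h (circlePoint t)) * ∑ i ∈ Finset.range n, (1 : ℝ) / (i + 1)) /
      Real.log n) atTop (𝓝 0) := by
    refine squeeze_zero_norm' ?_ (tendsto_const_nhds (x := D) |>.div_atTop hlog)
    filter_upwards [hlog.eventually_gt_atTop 0] with n hn
    rw [norm_div, Real.norm_eq_abs, Real.norm_of_nonneg hn.le]
    gcongr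
    exact hD n
  have h2 := h1.add (tendsto_sum_inv_div_log.const_mul (∫ t in (0 : ℝ)..1, h (circlePoint t)))
  rw [zero_add, mul_one] at h2
  refine h2.congr fun n => ?_
  ring

lemma exists_abs_sum_div_le (hh : AsymptoticMean x μ h) :
    ∃ D : ℝ, ∀ n : ℕ, |(∑ i ∈ Finset.range n, rotatedMean x μ h (i + 1)) / n| ≤ D := by
  obtain ⟨C, κ, hκ, hC⟩ := hh.bound
  refine ⟨|C| + |∫ t in (0 : ℝ)..1, h (circlePoint t)|, fun n => ?_⟩
  rcases n.eq_zero_or_pos with rfl | hn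
  · simp; positivity
  have hn0 : (1 : ℝ) ≤ n := by exact_mod_cast hn
  have h1 := hC n hn
  rw [Finset.sum_sub_distrib, Finset.sum_const, Finset.card_range, nsmul_eq_mul] at h1
  have h2 : (n : ℝ) ^ (1 - κ) ≤ n := by
    conv_rhs => rw [← Real.rpow_one (n : ℝ)]
    exact Real.rpow_le_rpow_of_exponent_le hn0 (by linarith)
  rw [abs_div, Nat.abs_cast, div_le_iff₀ (by linarith)]
  calc |∑ i ∈ Finset.range n, rotatedMean x μ h (i + 1)| =
        |(∑ i ∈ Finset.range n, rotatedMean x μ h (i + 1) -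
          n * ∫ t in (0 : ℝ)..1, h (circlePoint t)) + n * ∫ t in (0 : ℝ)..1, h (circlePoint t)| := by
        congr 1; ring
    _ ≤ |C| * n + n * |∫ t in (0 : ℝ)..1, h (circlePoint t)| := by
        refine (abs_add_le _ _).trans (add_le_add (h1.trans ?_) ?_)
        · calc C * (n : ℝ) ^ (1 - κ) ≤ |C| * (n : ℝ) ^ (1 - κ) := by gcongr; exact le_abs_self C
            _ ≤ _ := by gcongr
        · rw [abs_mul, Nat.abs_cast]
    _ = _ := by ring

end AsymptoticMean

/-- The characteristic function at `s` of `X (x⁻ᵐ T)`, where `T` is a product of `m` independent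
variables of law `μ`. -/
def rotatedCharFun (x : Circle) (μ : Measure Circle) (X : Circle → ℝ) (s : ℝ) (m : ℕ) : ℂ :=
  ∫ w, Complex.exp ((s * X ((x ^ m)⁻¹ * w) : ℝ) * Complex.I) ∂(productLaw μ m)

section

variable {x : Circle} {μ : Measure Circle} [IsProbabilityMeasure μ] {X : Circle → ℝ}

lemma norm_rotatedCharFun_le_one (s : ℝ) (m : ℕ) : ‖rotatedCharFun x μ X s m‖ ≤ 1 := by
  have := isProbabilityMeasure_productLaw μ m
  refine (norm_integral_le_integral_norm _).trans ?_
  simp only [Complex.norm_exp_ofReal_mul_I]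
  simp

lemma integrable_cexp_rotate (hX : Measurable X) (s : ℝ) (m : ℕ) :
    Integrable (fun w => Complex.exp ((s * X ((x ^ m)⁻¹ * w) : ℝ) * Complex.I)) (productLaw μ m) := by
  have := isProbabilityMeasure_productLaw μ m
  refine Integrable.of_bound (C := 1) ?_ (ae_of_all _ fun w => ?_)
  · have : Measurable fun w => X ((x ^ m)⁻¹ * w) := hX.comp (by fun_prop)
    exact Measurable.aestronglyMeasurable (by fun_prop)
  · rw [Complex.norm_exp_ofReal_mul_I]

lemma norm_rotatedCharFun_sub_one_le (hX : Measurable X)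
    (h1 : AsymptoticMean x μ fun w => |X w|) (s : ℝ) (i : ℕ) :
    ‖rotatedCharFun x μ X s (i + 1) - 1‖ ≤ |s| * rotatedMean x μ (fun w => |X w|) (i + 1) := by
  have := isProbabilityMeasure_productLaw μ (i + 1)
  have e : rotatedCharFun x μ X s (i + 1) - 1 =
      ∫ w, (Complex.exp ((s * X ((x ^ (i + 1))⁻¹ * w) : ℝ) * Complex.I) - 1)
        ∂(productLaw μ (i + 1)) := by
    rw [integral_sub (integrable_cexp_rotate hX s _) (integrable_const _)]
    simp [rotatedCharFun]
  rw [e, rotatedMean, ← integral_const_mul]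
  refine norm_integral_le_of_norm_le ((h1.integrable i).const_mul _) (ae_of_all _ fun w => ?_)
  rw [mul_comm _ Complex.I]
  refine Real.norm_exp_I_mul_ofReal_sub_one_le.trans ?_
  rw [Real.norm_eq_abs, abs_mul]

lemma norm_rotatedCharFun_sub_taylor_le (hX : Measurable X) (h1 : AsymptoticMean x μ X)
    (h2 : AsymptoticMean x μ fun w => X w * X w)
    (h3 : AsymptoticMean x μ fun w => |X w| * (X w * X w)) (s : ℝ) (i : ℕ) :
    ‖rotatedCharFun x μ X s (i + 1) - 1 - s * rotatedMean x μ X (i + 1) * Complex.I +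
      s ^ 2 / 2 * rotatedMean x μ (fun w => X w * X w) (i + 1)‖ ≤
      4 * |s| ^ 3 * rotatedMean x μ (fun w => |X w| * (X w * X w)) (i + 1) := by
  have := isProbabilityMeasure_productLaw μ (i + 1)
  have e : rotatedCharFun x μ X s (i + 1) - 1 - s * rotatedMean x μ X (i + 1) * Complex.I +
      s ^ 2 / 2 * rotatedMean x μ (fun w => X w * X w) (i + 1) =
      ∫ w, (Complex.exp ((s * X ((x ^ (i + 1))⁻¹ * w) : ℝ) * Complex.I) - 1 -
        (s * X ((x ^ (i + 1))⁻¹ * w) : ℝ) * Complex.I +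
        ((s * X ((x ^ (i + 1))⁻¹ * w) : ℝ) : ℂ) ^ 2 / 2) ∂(productLaw μ (i + 1)) := by
    have i0 := integrable_cexp_rotate (x := x) (μ := μ) hX s (i + 1)
    have i1 : Integrable (fun w => ((s * X ((x ^ (i + 1))⁻¹ * w) : ℝ) : ℂ) * Complex.I)
        (productLaw μ (i + 1)) := ((h1.integrable i).const_mul s).ofReal.mul_const _
    have e2 : ∀ w, ((s * X ((x ^ (i + 1))⁻¹ * w) : ℝ) : ℂ) ^ 2 / 2 =
        ((s ^ 2 / 2 * (X ((x ^ (i + 1))⁻¹ * w) * X ((x ^ (i + 1))⁻¹ * w)) : ℝ) : ℂ) := by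
      intro w; push_cast; ring
    have i2 : Integrable (fun w => ((s * X ((x ^ (i + 1))⁻¹ * w) : ℝ) : ℂ) ^ 2 / 2)
        (productLaw μ (i + 1)) := by
      simp only [e2]
      exact ((h2.integrable i).const_mul _).ofReal
    have i3 : Integrable (fun w => Complex.exp ((s * X ((x ^ (i + 1))⁻¹ * w) : ℝ) * Complex.I) - 1)
        (productLaw μ (i + 1)) := i0.sub (integrable_const _)
    have i4 : Integrable (fun w => Complex.exp ((s * X ((x ^ (i + 1))⁻¹ * w) : ℝ) * Complex.I) - 1 -
        (s * X ((x ^ (i + 1))⁻¹ * w) : ℝ) * Complex.I) (productLaw μ (i + 1)) := i3.sub i1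
    rw [integral_add i4 i2, integral_sub i3 i1, integral_sub i0 (integrable_const _),
      integral_mul_const]
    simp only [e2]
    rw [integral_complex_ofReal, integral_complex_ofReal, integral_const_mul, integral_const_mul]
    simp [rotatedCharFun, rotatedMean]
  rw [e, rotatedMean, ← integral_const_mul]
  refine norm_integral_le_of_norm_le ((h3.integrable i).const_mul _) (ae_of_all _ fun w => ?_)
  refine (norm_cexp_mul_I_sub_taylor_le _).trans (le_of_eq ?_)
  rw [abs_mul, mul_pow, ← mul_assoc]
  congr 1
  rw [pow_succ', pow_two, abs_mul_abs_self]

/-- Expand each term to third order and sum against 1/m. With s² = t²/log n, the three moments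
contribute, in order, o(1), the stated limit and o(1). -/
lemma tendsto_sum_rotatedCharFun_sub_one (hX : Measurable X) (h1 : AsymptoticMean x μ X)
    (h2 : AsymptoticMean x μ fun w => X w * X w)
    (h3 : AsymptoticMean x μ fun w => |X w| * (X w * X w))
    (hmean : ∫ t in (0 : ℝ)..1, X (circlePoint t) = 0) (t : ℝ) :
    Tendsto (fun n : ℕ => ∑ i ∈ Finset.range n,
      (rotatedCharFun x μ X (t / √(Real.log n)) (i + 1) - 1) / ((i + 1 : ℕ) : ℂ)) atTop
      (𝓝 (-(t ^ 2 / 2 * ∫ t in (0 : ℝ)..1, X (circlePoint t) * X (circlePoint t) : ℝ))) := by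
  have hlog : Tendsto (fun n : ℕ => Real.log n) atTop atTop :=
    Real.tendsto_log_atTop.comp tendsto_natCast_atTop_atTop
  have hsqrt : Tendsto (fun n : ℕ => √(Real.log n)) atTop atTop :=
    Real.tendsto_sqrt_atTop.comp hlog
  set s : ℕ → ℝ := fun n => t / √(Real.log n) with hs
  have hs0 : Tendsto s atTop (𝓝 0) := tendsto_const_nhds.div_atTop hsqrt
  set A : (Circle → ℝ) → ℕ → ℝ := fun h n =>
    ∑ i ∈ Finset.range n, rotatedMean x μ h (i + 1) / (i + 1) with hA
  have hs2 : ∀ (h : Circle → ℝ) (n : ℕ), s n ^ 2 * A h n = t ^ 2 * (A h n / Real.log n) := by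
    intro h n
    rw [hs, div_pow, Real.sq_sqrt (Real.log_natCast_nonneg n)]
    ring
  -- A harmonic sum of size o(log n) would not do here, as s is only of order 1/√(log n); the O(1)
  -- bound coming from the power saving is needed.
  have l1 : Tendsto (fun n => s n * A X n) atTop (𝓝 0) := by
    obtain ⟨D, hD⟩ := h1.exists_abs_sum_div_sub_le
    have := hs0.norm.mul_const D
    rw [norm_zero, zero_mul] at this
    refine squeeze_zero_norm (fun n => ?_) this
    rw [norm_mul]
    gcongr
    have := hD n
    rwa [hmean, zero_mul, sub_zero] at this
  have l2 : Tendsto (fun n => s n ^ 2 / 2 * A (fun w => X w * X w) n) atTop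
      (𝓝 (t ^ 2 / 2 * ∫ t in (0 : ℝ)..1, X (circlePoint t) * X (circlePoint t))) := by
    refine (h2.tendsto_sum_div_log.const_mul (t ^ 2 / 2)).congr fun n => ?_
    have := hs2 (fun w => X w * X w) n
    linarith
  have l3 : Tendsto (fun n => 4 * |s n| ^ 3 * A (fun w => |X w| * (X w * X w)) n) atTop (𝓝 0) := by
    have := (hs0.abs.mul (h3.tendsto_sum_div_log.const_mul (t ^ 2))).const_mul 4
    rw [abs_zero, zero_mul, mul_zero] at this
    refine this.congr fun n => ?_
    rw [← hs2, ← sq_abs (s n)]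
    ring
  have key : ∀ n : ℕ, ‖∑ i ∈ Finset.range n,
      (rotatedCharFun x μ X (s n) (i + 1) - 1) / ((i + 1 : ℕ) : ℂ) -
        (((s n * A X n : ℝ) : ℂ) * Complex.I -
          ((s n ^ 2 / 2 * A (fun w => X w * X w) n : ℝ) : ℂ))‖ ≤
      4 * |s n| ^ 3 * A (fun w => |X w| * (X w * X w)) n := by
    intro n
    have e : ∑ i ∈ Finset.range n,
      (rotatedCharFun x μ X (s n) (i + 1) - 1) / ((i + 1 : ℕ) : ℂ) -
        (((s n * A X n : ℝ) : ℂ) * Complex.I -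
          ((s n ^ 2 / 2 * A (fun w => X w * X w) n : ℝ) : ℂ)) =
        ∑ i ∈ Finset.range n, (rotatedCharFun x μ X (s n) (i + 1) - 1 -
          s n * rotatedMean x μ X (i + 1) * Complex.I +
          s n ^ 2 / 2 * rotatedMean x μ (fun w => X w * X w) (i + 1)) / ((i + 1 : ℕ) : ℂ) := by
      simp only [hA]
      push_cast
      rw [Finset.mul_sum, Finset.mul_sum, Finset.sum_mul, ← Finset.sum_sub_distrib,
        ← Finset.sum_sub_distrib]
      exact Finset.sum_congr rfl fun i _ => by ring
    rw [e]
    simp only [hA]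
    rw [Finset.mul_sum]
    refine (norm_sum_le _ _).trans (Finset.sum_le_sum fun i _ => ?_)
    rw [norm_div, Complex.norm_natCast, ← mul_div_assoc]
    push_cast
    gcongr
    exact norm_rotatedCharFun_sub_taylor_le hX h1 h2 h3 (s n) i
  have l4 := squeeze_zero_norm key l3
  have l5 := l4.add ((((Complex.continuous_ofReal.tendsto _).comp l1).mul_const Complex.I).sub
    ((Complex.continuous_ofReal.tendsto _).comp l2))
  simp only [Complex.ofReal_zero, zero_mul, zero_sub, zero_add] at l5
  refine l5.congr fun n => ?_
  simp [hs]

/-- The Poisson comparison applies since the average of |a_m - 1| is at most |s| times the average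
of E|X(x⁻ᵐ T_m)|, which is bounded; the Poisson exponent is then the sum just computed. -/
lemma tendsto_ewensGen_rotatedCharFun {θ : ℝ} (hθ : 0 < θ) (hX : Measurable X)
    (h0 : AsymptoticMean x μ fun w => |X w|) (h1 : AsymptoticMean x μ X)
    (h2 : AsymptoticMean x μ fun w => X w * X w)
    (h3 : AsymptoticMean x μ fun w => |X w| * (X w * X w))
    (hmean : ∫ t in (0 : ℝ)..1, X (circlePoint t) = 0) (t : ℝ) :
    Tendsto (fun n : ℕ => ewensGen θ (rotatedCharFun x μ X (t / √(Real.log n))) n) atTop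
      (𝓝 (Complex.exp
        (-(θ * (∫ t in (0 : ℝ)..1, X (circlePoint t) * X (circlePoint t)) * t ^ 2 / 2 : ℝ)))) := by
  have hsqrt : Tendsto (fun n : ℕ => √(Real.log n)) atTop atTop :=
    Real.tendsto_sqrt_atTop.comp (Real.tendsto_log_atTop.comp tendsto_natCast_atTop_atTop)
  have hs0 : Tendsto (fun n : ℕ => t / √(Real.log n)) atTop (𝓝 0) :=
    tendsto_const_nhds.div_atTop hsqrt
  have hav : Tendsto (fun n : ℕ => (∑ i ∈ Finset.range n,
      ‖rotatedCharFun x μ X (t / √(Real.log n)) (i + 1) - 1‖) / n) atTop (𝓝 0) := by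
    obtain ⟨D, hD⟩ := h0.exists_abs_sum_div_le
    have := hs0.abs.mul_const D
    rw [abs_zero, zero_mul] at this
    refine squeeze_zero (fun n => by positivity) (fun n => ?_) this
    calc _ ≤ (∑ i ∈ Finset.range n, |t / √(Real.log n)| *
          rotatedMean x μ (fun w => |X w|) (i + 1)) / n := by
          gcongr with i
          exact norm_rotatedCharFun_sub_one_le hX h0 _ i
      _ = |t / √(Real.log n)| * ((∑ i ∈ Finset.range n,
          rotatedMean x μ (fun w => |X w|) (i + 1)) / n) := by
          rw [← Finset.mul_sum, mul_div_assoc]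
      _ ≤ _ := by
          gcongr
          exact (le_abs_self _).trans (hD n)
  have l1 := tendsto_exp_sub_ewensGen hθ
    (a := fun n => rotatedCharFun x μ X (t / √(Real.log n)))
    (fun n m => norm_rotatedCharFun_le_one _ m) hav
  have l2 := (Complex.continuous_exp.tendsto _).comp
    ((tendsto_sum_rotatedCharFun_sub_one hX h1 h2 h3 hmean t).const_mul (θ : ℂ))
  have l3 := l2.sub l1
  simp only [sub_zero, Function.comp_def, sub_sub_cancel] at l3
  convert l3 using 3
  push_cast
  ring

end

/-- The limits of the characteristic functions for the two coordinates of the logarithm. -/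
lemma tendsto_ewensGen_rotatedCharFun_of_mildlySingular {μ : Measure Circle}
    [IsProbabilityMeasure μ] {x : Circle}
    (hcond : μ = uniformCircleLaw ∨ IsFourierDensityLaw μ ∨
      (IsDiscreteFourierLaw μ ∧ IsFiniteType x)) {θ : ℝ} (hθ : 0 < θ) {X : Circle → ℝ}
    (hX : MildlySingular X) (hmean : ∫ t in (0 : ℝ)..1, X (circlePoint t) = 0)
    (hvar : ∫ t in (0 : ℝ)..1, X (circlePoint t) * X (circlePoint t) = Real.pi ^ 2 / 12) (t : ℝ) :
    Tendsto (fun n : ℕ => ewensGen θ (rotatedCharFun x μ X (t / √(Real.log n))) n) atTop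
      (𝓝 (Complex.exp (-(θ * (Real.pi ^ 2 / 12) * t ^ 2 / 2 : ℝ)))) := by
  rw [← hvar]
  exact tendsto_ewensGen_rotatedCharFun hθ hX.1 (asymptoticMean hcond hX.abs)
    (asymptoticMean hcond hX) (asymptoticMean hcond (hX.mul hX))
    (asymptoticMean hcond (hX.abs.mul (hX.mul hX))) hmean t

/-! ### The characteristic function of the sum over cycles -/

/-- The sum of `X (x⁻ᵐ T_{m,k})` over the cycles of `τ`. -/
def cycleSum (X : Circle → ℝ) (x : Circle) {n : ℕ} (τ : Equiv.Perm (Fin n))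
    (T : ℕ × ℕ → Circle) : ℝ :=
  ∑ m ∈ Finset.Icc 1 n, ∑ k ∈ Finset.range (cycleCount τ m), X ((x ^ m)⁻¹ * T (m, k))

lemma re_logZ {n : ℕ} (x : Circle) (τ : Equiv.Perm (Fin n)) (T : ℕ × ℕ → Circle) :
    (logZ x τ fun m k => T (m, k)).re = cycleSum reLog x τ T := by
  simp [logZ, cycleSum, reLog, Complex.re_sum]

lemma im_logZ {n : ℕ} (x : Circle) (τ : Equiv.Perm (Fin n)) (T : ℕ × ℕ → Circle) :
    (logZ x τ fun m k => T (m, k)).im = cycleSum imLog x τ T := by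
  simp [logZ, cycleSum, imLog, Complex.im_sum]

lemma measurable_cycleSum {X : Circle → ℝ} (hX : Measurable X) (x : Circle) {n : ℕ} :
    Measurable fun p : Equiv.Perm (Fin n) × (ℕ × ℕ → Circle) => cycleSum X x p.1 p.2 := by
  have : MeasurableSingletonClass (Equiv.Perm (Fin n)) := ⟨fun _ => MeasurableSpace.measurableSet_top⟩
  refine measurable_from_prod_countable_right fun τ => ?_
  change Measurable fun T : ℕ × ℕ → Circle => ∑ m ∈ Finset.Icc 1 n,
    ∑ k ∈ Finset.range (cycleCount τ m), X ((x ^ m)⁻¹ * T (m, k))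
  refine Finset.measurable_fun_sum _ fun m _ => Finset.measurable_fun_sum _ fun k _ => ?_
  exact hX.comp (by fun_prop)

lemma prod_pow_cycleCount (a : ℕ → ℂ) {n : ℕ} (τ : Equiv.Perm (Fin n)) :
    ∏ m ∈ Finset.Icc 1 n, a m ^ cycleCount τ m = (τ.partition.parts.map a).prod := by
  rw [Finset.prod_multiset_map_count]
  symm
  refine Finset.prod_subset (fun m hm => ?_) fun m _ hm => ?_
  · have hm' : m ∈ τ.partition.parts := by simpa using hm
    rw [Finset.mem_Icc]
    refine ⟨τ.partition.parts_pos hm', ?_⟩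
    have := Multiset.le_sum_of_mem hm'
    rw [τ.partition.parts_sum] at this
    simpa using this
  · rw [Multiset.count_eq_zero_of_notMem (by simpa using hm), pow_zero]

lemma integral_ewensMeasure {θ : ℝ} (hθ : 0 < θ) {n : ℕ} (f : Equiv.Perm (Fin n) → ℂ) :
    ∫ τ, f τ ∂(ewensMeasure θ n) =
      (∑ τ, (θ : ℂ) ^ totalCycles τ * f τ) / ∏ i ∈ Finset.range n, ((θ : ℂ) + i) := by
  have : MeasurableSingletonClass (Equiv.Perm (Fin n)) := ⟨fun _ => MeasurableSpace.measurableSet_top⟩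
  unfold ewensMeasure
  rw [integral_finsetSum_measure fun τ _ => (integrable_dirac (by simp)).smul_measure (by simp),
    Finset.sum_div]
  refine Finset.sum_congr rfl fun τ _ => ?_
  rw [integral_smul_measure, integral_dirac, ENNReal.toReal_ofReal
    (div_nonneg (by positivity) (Finset.prod_nonneg fun i _ => by positivity)), Complex.real_smul]
  push_cast
  ring

section

variable {Ω : Type*} [MeasurableSpace Ω] {P : Measure Ω} {μ : Measure Circle}
  {n : ℕ} {σ : Ω → Equiv.Perm (Fin n)} {T : ℕ → ℕ → Ω → Circle} {θ : ℝ} {X : Circle → ℝ}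

lemma aemeasurable_family (hT : ∀ m k, HasLaw (T m k) (productLaw μ m) P) :
    AEMeasurable (fun ω (p : ℕ × ℕ) => T p.1 p.2 ω) P :=
  aemeasurable_pi_iff.2 fun p => (hT p.1 p.2).aemeasurable

/-- For a fixed permutation the exponential is a product over distinct pairs (m, k), so independence
factorises the expectation, and the C_m factors of index m are all equal. -/
lemma integral_cexp_cycleSum (hX : Measurable X) (x : Circle)
    (hT : ∀ m k, HasLaw (T m k) (productLaw μ m) P)
    (hind : iIndepFun (fun (p : ℕ × ℕ) => T p.1 p.2) P) (τ : Equiv.Perm (Fin n)) (s : ℝ) :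
    ∫ ω, Complex.exp ((s * cycleSum X x τ (fun p => T p.1 p.2 ω) : ℝ) * Complex.I) ∂P =
      (τ.partition.parts.map (rotatedCharFun x μ X s)).prod := by
  set S : Finset (Σ _ : ℕ, ℕ) := (Finset.Icc 1 n).sigma fun m => Finset.range (cycleCount τ m) with hS
  set F : ℕ → Circle → ℂ := fun m w =>
    Complex.exp ((s * X ((x ^ m)⁻¹ * w) : ℝ) * Complex.I) with hF
  have hFm : ∀ m, Measurable (F m) := by
    intro m
    have : Measurable fun w => X ((x ^ m)⁻¹ * w) := hX.comp (by fun_prop)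
    fun_prop
  have hprod : ∀ ω, Complex.exp ((s * cycleSum X x τ (fun p => T p.1 p.2 ω) : ℝ) * Complex.I) =
      ∏ p : S, F p.1.1 (T p.1.1 p.1.2 ω) := by
    intro ω
    rw [Finset.prod_coe_sort S fun p => F p.1 (T p.1 p.2 ω), hS, Finset.prod_sigma, cycleSum]
    push_cast
    rw [Finset.mul_sum, Finset.sum_mul, Complex.exp_sum]
    refine Finset.prod_congr rfl fun m _ => ?_
    rw [Finset.mul_sum, Finset.sum_mul, Complex.exp_sum]
    refine Finset.prod_congr rfl fun k _ => ?_
    simp [hF]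
  have hinj : Function.Injective fun p : S => ((p.1.1, p.1.2) : ℕ × ℕ) := by
    rintro ⟨⟨a, b⟩, h⟩ ⟨⟨c, d⟩, h'⟩ e
    simp only [Prod.mk.injEq] at e
    obtain ⟨rfl, rfl⟩ := e
    rfl
  have hind' := hind.precomp hinj
  simp only [hprod]
  rw [hind'.integral_fun_prod_comp (f := fun p : S => F p.1.1)
    (fun p => (hT _ _).aemeasurable) (fun p => (hFm _).aestronglyMeasurable)]
  have hval : ∀ m k, ∫ ω, F m (T m k ω) ∂P = rotatedCharFun x μ X s m := fun m k =>
    (hT m k).integral_comp (hFm m).aestronglyMeasurable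
  simp only [hval]
  rw [Finset.prod_coe_sort S fun p => rotatedCharFun x μ X s p.1, hS, Finset.prod_sigma,
    ← prod_pow_cycleCount]
  simp

lemma aemeasurable_cycleSum (hX : Measurable X) (x : Circle) (hσ : AEMeasurable σ P)
    (hT : ∀ m k, HasLaw (T m k) (productLaw μ m) P) :
    AEMeasurable (fun ω => cycleSum X x (σ ω) fun p => T p.1 p.2 ω) P :=
  Measurable.comp_aemeasurable
    (f := fun ω => (σ ω, fun p : ℕ × ℕ => T p.1 p.2 ω))
    (g := fun p : Equiv.Perm (Fin n) × (ℕ × ℕ → Circle) => cycleSum X x p.1 p.2)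
    (measurable_cycleSum hX x) (hσ.prodMk (aemeasurable_family hT))

/-- Independence of σ and the family makes their joint law a product; Fubini integrates first over
the family with the permutation fixed. -/
lemma charFun_cycleSum [IsProbabilityMeasure P] (hθ : 0 < θ) (hX : Measurable X) (x : Circle)
    (hσ : HasLaw σ (ewensMeasure θ n) P)
    (hT : ∀ m k, HasLaw (T m k) (productLaw μ m) P)
    (hind : iIndepFun (fun (p : ℕ × ℕ) => T p.1 p.2) P)
    (hσT : IndepFun σ (fun ω (p : ℕ × ℕ) => T p.1 p.2 ω) P) (s : ℝ) :
    charFun (P.map fun ω => cycleSum X x (σ ω) fun p => T p.1 p.2 ω) s =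
      ewensGen θ (rotatedCharFun x μ X s) n := by
  have hTm := aemeasurable_family hT
  set Φ : Equiv.Perm (Fin n) × (ℕ × ℕ → Circle) → ℂ := fun p =>
    Complex.exp ((s * cycleSum X x p.1 p.2 : ℝ) * Complex.I) with hΦ
  have hΦm : Measurable Φ := by
    have := measurable_cycleSum hX x (n := n)
    fun_prop
  have hlaw := IndepFun.hasLaw_prod hσ ⟨hTm, rfl⟩ hσT
  have hPE : IsProbabilityMeasure (ewensMeasure θ n) := by
    rw [← hσ.map_eq]; exact Measure.isProbabilityMeasure_map hσ.aemeasurable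
  have hPT := Measure.isProbabilityMeasure_map hTm
  rw [charFun_apply_real, integral_map (aemeasurable_cycleSum hX x hσ.aemeasurable hT)
    (Measurable.aestronglyMeasurable (by fun_prop))]
  have e : ∀ ω, Complex.exp (s * (cycleSum X x (σ ω) fun p => T p.1 p.2 ω : ℝ) * Complex.I) =
      (Φ ∘ fun ω => (σ ω, fun p : ℕ × ℕ => T p.1 p.2 ω)) ω := by
    intro ω; simp [hΦ]
  simp only [e]
  rw [hlaw.integral_comp hΦm.aestronglyMeasurable, integral_prod _ (Integrable.of_bound
    hΦm.aestronglyMeasurable 1 (ae_of_all _ fun p => (Complex.norm_exp_ofReal_mul_I _).le)),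
    integral_ewensMeasure hθ, ewensGen]
  congr 1
  refine Finset.sum_congr rfl fun τ _ => ?_
  congr 1
  rw [integral_map hTm (Measurable.aestronglyMeasurable
    (f := fun y => Φ (τ, y)) (hΦm.comp (by fun_prop)))]
  exact integral_cexp_cycleSum hX x hT hind τ s

end

/-- The central limit theorem for the sum over the cycles, with a general scaling. -/
theorem tendstoInDistribution_cycleSum {θ : ℝ} (hθ : 0 < θ) {μ : Measure Circle}
    [IsProbabilityMeasure μ] {x : Circle}
    (hcond : μ = uniformCircleLaw ∨ IsFourierDensityLaw μ ∨
      (IsDiscreteFourierLaw μ ∧ IsFiniteType x))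
    {Ω : ℕ → Type*} [∀ n, MeasurableSpace (Ω n)] (P : (n : ℕ) → Measure (Ω n))
    [∀ n, IsProbabilityMeasure (P n)] {σ : (n : ℕ) → Ω n → Equiv.Perm (Fin n)}
    (hσ : ∀ n, HasLaw (σ n) (ewensMeasure θ n) (P n))
    {T : (n : ℕ) → ℕ → ℕ → Ω n → Circle}
    (hT : ∀ n m k, HasLaw (T n m k) (productLaw μ m) (P n))
    (hind : ∀ n, iIndepFun (fun (p : ℕ × ℕ) => T n p.1 p.2) (P n))
    (hσT : ∀ n, IndepFun (σ n) (fun ω (p : ℕ × ℕ) => T n p.1 p.2 ω) (P n))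
    {X : Circle → ℝ} (hX : MildlySingular X)
    (hmean : ∫ t in (0 : ℝ)..1, X (circlePoint t) = 0)
    (hvar : ∫ t in (0 : ℝ)..1, X (circlePoint t) * X (circlePoint t) = Real.pi ^ 2 / 12)
    {c : ℝ} (hc : 0 < c) (v : NNReal) (hv : (v : ℝ) * c = θ * (Real.pi ^ 2 / 12)) :
    TendstoInDistribution
      (fun n ω => cycleSum X x (σ n ω) (fun p => T n p.1 p.2 ω) / √(c * Real.log n))
      atTop (id : ℝ → ℝ) P (gaussianReal 0 v) where
  forall_aemeasurable n :=
    (aemeasurable_cycleSum hX.1 x (hσ n).aemeasurable (hT n)).div_const _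
  aemeasurable_limit := aemeasurable_id
  tendsto := by
    refine ProbabilityMeasure.tendsto_iff_tendsto_charFun.2 fun t => ?_
    -- Dividing by √(c log n) and testing at t is dividing by √(log n) and testing at t/√c.
    have key := tendsto_ewensGen_rotatedCharFun_of_mildlySingular hcond hθ hX hmean hvar (t / √c)
    simp only [ProbabilityMeasure.coe_mk, Measure.map_id, charFun_gaussianReal]
    convert key using 2 with n
    · rw [← charFun_cycleSum hθ hX.1 x (hσ n) (hT n) (hind n) (hσT n)]
      simp only [div_eq_inv_mul]
      rw [charFun_map_mul_comp (aemeasurable_cycleSum hX.1 x (hσ n).aemeasurable (hT n)),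
        Real.sqrt_mul hc.le]
      congr 1
      ring
    · congr 1
      rw [div_pow, Real.sq_sqrt hc.le, ← hv]
      push_cast
      have : (c : ℂ) ≠ 0 := by exact_mod_cast hc.ne'
      field_simp
      ring

end

/-! ### The main theorem -/

theorem mainTheorem6
    (θ : ℝ) (hθ : 0 < θ)
    (x : Circle) (hx : ∀ m : ℕ, 0 < m → x ^ m ≠ 1)
    -- the random variable `z` with values in the unit circle
    {Ω₀ : Type*} [MeasurableSpace Ω₀] (P₀ : Measure Ω₀) [IsProbabilityMeasure P₀]
    (z : Ω₀ → Circle) (hz : AEMeasurable z P₀)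
    (hcond : P₀.map z = uniformCircleLaw ∨ IsFourierDensityLaw (P₀.map z) ∨
      (IsDiscreteFourierLaw (P₀.map z) ∧ IsFiniteType x))
    -- for every `n`, an Ewens permutation and a family `T_{m,k}` independent of it
    {Ω : ℕ → Type*} [∀ n, MeasurableSpace (Ω n)]
    (P : (n : ℕ) → Measure (Ω n)) [∀ n, IsProbabilityMeasure (P n)]
    (σ : (n : ℕ) → Ω n → Equiv.Perm (Fin n))
    (hσ : ∀ n, HasLaw (σ n) (ewensMeasure θ n) (P n))
    (T : (n : ℕ) → ℕ → ℕ → Ω n → Circle)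
    (hTlaw : ∀ n m k, HasLaw (T n m k) (productLaw (P₀.map z) m) (P n))
    (hTindep : ∀ n, iIndepFun (fun (p : ℕ × ℕ) => T n p.1 p.2) (P n))
    (hσT : ∀ n, IndepFun (σ n) (fun ω (p : ℕ × ℕ) => T n p.1 p.2 ω) (P n)) :
    -- the corollary
    (TendstoInDistribution
        (fun n ω => (logZ x (σ n ω) (fun m k => T n m k ω)).re / √(Real.log n))
        atTop (id : ℝ → ℝ) P (gaussianReal 0 (Real.toNNReal (θ * (Real.pi ^ 2 / 12)))) ∧
      TendstoInDistribution
        (fun n ω => (logZ x (σ n ω) (fun m k => T n m k ω)).im / √(Real.log n))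
        atTop (id : ℝ → ℝ) P (gaussianReal 0 (Real.toNNReal (θ * (Real.pi ^ 2 / 12))))) ∧
    -- the proposition, for uniform `z`
    (P₀.map z = uniformCircleLaw →
      TendstoInDistribution
        (fun n ω => (logZ x (σ n ω) (fun m k => T n m k ω)).re /
          √(Real.pi ^ 2 / 12 * θ * Real.log n))
        atTop (id : ℝ → ℝ) P (gaussianReal 0 1) ∧
      TendstoInDistribution
        (fun n ω => (logZ x (σ n ω) (fun m k => T n m k ω)).im /
          √(Real.pi ^ 2 / 12 * θ * Real.log n))
        atTop (id : ℝ → ℝ) P (gaussianReal 0 1)) := by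
  have hμ := Measure.isProbabilityMeasure_map hz
  have hre : ∀ n ω, (logZ x (σ n ω) (fun m k => T n m k ω)).re =
      cycleSum reLog x (σ n ω) fun p => T n p.1 p.2 ω :=
    fun n ω => re_logZ x (σ n ω) fun p => T n p.1 p.2 ω
  have him : ∀ n ω, (logZ x (σ n ω) (fun m k => T n m k ω)).im =
      cycleSum imLog x (σ n ω) fun p => T n p.1 p.2 ω :=
    fun n ω => im_logZ x (σ n ω) fun p => T n p.1 p.2 ω
  -- Both normalisations at once: c = 1 with variance θπ²/12, and c = θπ²/12 with variance 1.
  have hmain : ∀ (c : ℝ) (v : NNReal), 0 < c → (v : ℝ) * c = θ * (Real.pi ^ 2 / 12) →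
      TendstoInDistribution
        (fun n ω => (logZ x (σ n ω) (fun m k => T n m k ω)).re / √(c * Real.log n))
        atTop (id : ℝ → ℝ) P (gaussianReal 0 v) ∧
      TendstoInDistribution
        (fun n ω => (logZ x (σ n ω) (fun m k => T n m k ω)).im / √(c * Real.log n))
        atTop (id : ℝ → ℝ) P (gaussianReal 0 v) := by
    intro c v hc hv
    simp only [hre, him]
    exact ⟨tendstoInDistribution_cycleSum hθ hcond P hσ hTlaw hTindep hσT MildlySingular.reLog
        integral_reLog integral_reLog_sq hc v hv,
      tendstoInDistribution_cycleSum hθ hcond P hσ hTlaw hTindep hσT MildlySingular.imLog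
        integral_imLog integral_imLog_sq hc v hv⟩
  refine ⟨?_, fun _ => ?_⟩
  · have := hmain 1 (Real.toNNReal (θ * (Real.pi ^ 2 / 12))) one_pos
      (by rw [mul_one, Real.coe_toNNReal _ (by positivity)])
    simpa only [one_mul] using this
  · exact hmain (Real.pi ^ 2 / 12 * θ) 1 (by positivity) (by push_cast; ring)
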